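/- **Theorem 3.1 (functional Bahadur representation).** Let $m\ge 1$ be an integer and let $$H^m=\{f:[0,1]\to\mathbb R \mid f,f',\dots,f^{(m-1)}\text{ absolutely continuous},\ f^{(m)}\in L_2[0,1]\},\qquad J(f,g)=\int_0^1 f^{(m)}g^{(m)}.$$ *Model.* $Y_{ij}=X_i(T_{ij})+\varepsilon_{ij}$ for $i\ge 1$, $1\le j\le N_i$, where the random functions $X_i$ are i.i.d. copies of a second-order process $X$ on $[0,1]$ ($\mathbb E X(t)^2<\infty$ for every $t$) with mean function $\mu(t)=\mathbb E X(t)$; the times $T_{ij}\in[0,1]$ are i.i.d. copies of $T$, the errors $\varepsilon_{ij}$ are i.i.d. copies of $\varepsilon$, the counts $N_i$ are i.i.d. copies of $N$, and the families $(X_i)$, $(T_{ij})$, $(\varepsilon_{ij})$, $(N_i)$ are mutually independent. Assume: 1. the pairs $(Y_{ij},T_{ij})$ have a common bounded joint density, and the density of $T$ is bounded away from $0$ and $\infty$; 2. $\mathbb E\varepsilon=0$ and $\operatorname{Var}(\varepsilon)<\infty$; 3. $N$ is a positive integer, $\mathbb E N<\infty$, $\operatorname{Var}(N)<\infty$ and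 $\Pr(N>1)>0$; 4. almost surely $X\in H^m$, and $\mathbb E\int_0^1\{X^{(m)}(t)\}^2dt<\infty$; 5. with $V(f,g)=\mathbb E\{f(T)g(T)\}$, there are $h_v\in H^m$, $v\ge1$, with $\sup_v\|h_v\|_{\sup}<\infty$, and a non-decreasing real sequence $\gamma_v\asymp v^{2m}$ (i.e. $\gamma_v/v^{2m}$ is eventually bounded above and bounded away from $0$) such that $V(h_u,h_v)=\delta_{uv}$, $J(h_u,h_v)=\gamma_u\delta_{uv}$, and every $g\in H^m$ satisfies $g=\sum_v V(g,h_v)h_v$ with convergence in the norm $\{V(f,f)+J(f,f)\}^{1/2}$. For $\lambda>0$ let $\langle f,g\rangle=V(f,g)+\lambda J(f,g)$ on $H^m$, with norm $\|\cdot\|$; let $K_t\in H^m$ be the reproducing kernel, $\langle K_t,f\rangle=f(t)$ for all $f\in H^m$, and let $W_\lambda:H^m\to H^m$ be given by $\langle W_\lambda f,g\rangle=\lambda J(f,g)$ for all $g\in H^m$. For the first $n$ subjects put $M=\sum_{i=1}^nN_i$, let $$\hat\mu_\lambda\in\underset{f\in H^m}{\arg\min}\ \frac1{2M}\sum_{i=1}^n\sum_{j=1}^{N_i}\{Y_{ij}-f(T_{ij})\}^2+\frac\lambda2J(f,f)$$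 (any minimizer), and let $$S_{M,\lambda}(f)=-\frac1M\sum_{i=1}^n\sum_{j=1}^{N_i}\{Y_{ij}-f(T_{ij})\}K_{T_{ij}}+W_\lambda f .$$ Let $\lambda=\lambda_n>0$ depend on $n$ so that, with $h=\lambda^{1/(2m)}$, as $n\to\infty$, $$h=o(1)\quad\text{and}\quad \{nh^{3-1/(2m)}\}^{-1/2}(\log\log n)^{1/2}=o(1).$$ Then $\mu\in H^m$, the representers $K_t$ and $W_\lambda f$ exist for all $t\in[0,1]$, $f\in H^m$, and $$\|\hat\mu_\lambda-\mu+S_{M,\lambda}(\mu)\|=O_p(a_n),\qquad a_n=n^{-1/2}h^{-(6m-1)/(4m)}\{h^m+(nh)^{-1/2}\}(\log\log n)^{1/2}.$$ -/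

import Mathlib

open Filter Topology MeasureTheory ProbabilityTheory Asymptotics

namespace FBR

/-! ### The Sobolev space on `[0,1]` and its bilinear forms -/

/-- The `k`-th derivative of `f : [0,1] → ℝ` (one-sided at the end points), as a function on `ℝ` of
which only the values on `[0,1]` matter. -/
noncomputable def dv (k : ℕ) (f : unitInterval → ℝ) : ℝ → ℝ :=
  iteratedDerivWithin k (Set.IccExtend (zero_le_one' ℝ) f) (Set.Icc 0 1)

/-- `H^m[0,1]`: the functions `f` on `[0,1]` with `f, f', …, f^(m-1)` existing and absolutely
continuous, and `f^(m)` (which then exists almost everywhere) square integrable. -/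
def sobolev (m : ℕ) : Set (unitInterval → ℝ) :=
  {f | (∀ k, k + 1 < m → DifferentiableOn ℝ (dv k f) (Set.Icc 0 1)) ∧
    (∀ k < m, AbsolutelyContinuousOnInterval (dv k f) 0 1) ∧
    MemLp (dv m f) 2 (volume.restrict (Set.Icc (0 : ℝ) 1))}

/-- The roughness form `J(f, g) = ∫₀¹ f^(m) g^(m)`. -/
noncomputable def J (m : ℕ) (f g : unitInterval → ℝ) : ℝ :=
  ∫ t in Set.Icc (0 : ℝ) 1, dv m f t * dv m g t

/-- `V(f, g) = E{f(T) g(T)}`, where `ν` is the law of `T`. -/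
noncomputable def V (ν : Measure unitInterval) (f g : unitInterval → ℝ) : ℝ :=
  ∫ t, f t * g t ∂ν

/-- The inner product `⟨f, g⟩ = V(f, g) + lam * J(f, g)` on `H^m`. -/
noncomputable def ip (ν : Measure unitInterval) (m : ℕ) (lam : ℝ) (f g : unitInterval → ℝ) : ℝ :=
  V ν f g + lam * J m f g

/-- The norm induced by `ip`. -/
noncomputable def nrm (ν : Measure unitInterval) (m : ℕ) (lam : ℝ) (f : unitInterval → ℝ) : ℝ :=
  Real.sqrt (ip ν m lam f f)

/-- `w` is an element of `H^m` that represents the functional `φ` on `H^m`. -/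
def Represents (ν : Measure unitInterval) (m : ℕ) (lam : ℝ) (φ : (unitInterval → ℝ) → ℝ)
    (w : unitInterval → ℝ) : Prop :=
  w ∈ sobolev m ∧ ∀ g ∈ sobolev m, ip ν m lam w g = φ g

/-- The representer in `H^m` of the functional `φ`. -/
noncomputable def riesz (ν : Measure unitInterval) (m : ℕ) (lam : ℝ)
    (φ : (unitInterval → ℝ) → ℝ) : unitInterval → ℝ :=
  Classical.epsilon (Represents ν m lam φ)

/-- The reproducing kernel: `K_t = K(t, ·)` represents the evaluation at `t`. -/
noncomputable def kernelAt (ν : Measure unitInterval) (m : ℕ) (lam : ℝ) (t : unitInterval) :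
    unitInterval → ℝ :=
  riesz ν m lam (fun g => g t)

/-- The operator `W_lam`: `⟨W f, g⟩ = lam * J(f, g)` for all `g ∈ H^m`. -/
noncomputable def W (ν : Measure unitInterval) (m : ℕ) (lam : ℝ) (f : unitInterval → ℝ) :
    unitInterval → ℝ :=
  riesz ν m lam (fun g => lam * J m f g)

/-! ### The data -/

section Data

variable {Ω : Type*}

/-- The noisy observation `Y_ij = X_i(T_ij) + ε_ij`. -/
def Y (X : ℕ → Ω → unitInterval → ℝ) (T : ℕ → ℕ → Ω → unitInterval) (ε : ℕ → ℕ → Ω → ℝ)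
    (i j : ℕ) (ω : Ω) : ℝ :=
  X i ω (T i j ω) + ε i j ω

/-- The total number `M` of observations on the first `n` subjects. -/
def M (N : ℕ → Ω → ℕ) (n : ℕ) (ω : Ω) : ℕ := ∑ i ∈ Finset.range n, N i ω

/-- The penalized least squares criterion `ℓ(f, lam)` of the first `n` subjects. -/
noncomputable def loss (X : ℕ → Ω → unitInterval → ℝ) (T : ℕ → ℕ → Ω → unitInterval)
    (ε : ℕ → ℕ → Ω → ℝ) (N : ℕ → Ω → ℕ) (m : ℕ) (lam : ℝ) (n : ℕ) (ω : Ω)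
    (f : unitInterval → ℝ) : ℝ :=
  1 / (2 * (M N n ω : ℝ)) *
      ∑ i ∈ Finset.range n, ∑ j ∈ Finset.range (N i ω), (Y X T ε i j ω - f (T i j ω)) ^ 2 +
    lam / 2 * J m f f

/-- `f` is a smoothing-spline estimate: it minimizes the criterion over `H^m`. -/
def IsSplineEstimate (X : ℕ → Ω → unitInterval → ℝ) (T : ℕ → ℕ → Ω → unitInterval)
    (ε : ℕ → ℕ → Ω → ℝ) (N : ℕ → Ω → ℕ) (m : ℕ) (lam : ℝ) (n : ℕ) (ω : Ω)
    (f : unitInterval → ℝ) : Prop :=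
  f ∈ sobolev m ∧ IsMinOn (loss X T ε N m lam n ω) (sobolev m) f

/-- The score `S_{M,lam}(f) = -(1/M) ∑ᵢ ∑ⱼ {Y_ij - f(T_ij)} K_{T_ij} + W_lam f`. -/
noncomputable def score (ν : Measure unitInterval) (X : ℕ → Ω → unitInterval → ℝ)
    (T : ℕ → ℕ → Ω → unitInterval) (ε : ℕ → ℕ → Ω → ℝ) (N : ℕ → Ω → ℕ) (m : ℕ) (lam : ℝ)
    (n : ℕ) (ω : Ω) (f : unitInterval → ℝ) : unitInterval → ℝ :=
  (-(1 / (M N n ω : ℝ))) •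
      (∑ i ∈ Finset.range n, ∑ j ∈ Finset.range (N i ω),
        (Y X T ε i j ω - f (T i j ω)) • kernelAt ν m lam (T i j ω)) +
    W ν m lam f

variable [MeasurableSpace Ω]

/-- The model. The random functions `X_i` are i.i.d. second-order processes (random elements of the
product space `ℝ^[0,1]`) with mean function `μ`; the times `T_ij`, the errors `ε_ij` and the
counts `N_i` are i.i.d.; and the four families are mutually independent. -/
structure Model (P : Measure Ω) (X : ℕ → Ω → unitInterval → ℝ)
    (T : ℕ → ℕ → Ω → unitInterval) (ε : ℕ → ℕ → Ω → ℝ) (N : ℕ → Ω → ℕ)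
    (μ : unitInterval → ℝ) : Prop where
  measurable_X : ∀ i, Measurable (X i)
  measurable_T : ∀ i j, Measurable (T i j)
  measurable_ε : ∀ i j, Measurable (ε i j)
  measurable_N : ∀ i, Measurable (N i)
  indep_X : iIndepFun X P
  indep_T : iIndepFun (fun p : ℕ × ℕ => T p.1 p.2) P
  indep_ε : iIndepFun (fun p : ℕ × ℕ => ε p.1 p.2) P
  indep_N : iIndepFun N P
  ident_X : ∀ i, IdentDistrib (X i) (X 0) P P
  ident_T : ∀ i j, IdentDistrib (T i j) (T 0 0) P P
  ident_ε : ∀ i j, IdentDistrib (ε i j) (ε 0 0) P P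
  ident_N : ∀ i, IdentDistrib (N i) (N 0) P P
  indep_X_T : IndepFun (fun ω i => X i ω) (fun ω i j => T i j ω) P
  indep_XT_ε : IndepFun (fun ω => ((fun i => X i ω), (fun i j => T i j ω)))
    (fun ω i j => ε i j ω) P
  indep_XTε_N : IndepFun (fun ω => ((fun i => X i ω), (fun i j => T i j ω), (fun i j => ε i j ω)))
    (fun ω i => N i ω) P
  second_moment : ∀ i t, MemLp (fun ω => X i ω t) 2 P
  mean : ∀ i t, ∫ ω, X i ω t ∂P = μ t

/-- `(Y, T)` has a bounded joint density, and the density of `T` is bounded away from zero and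
infinity. -/
def BoundedDensities (P : Measure Ω) (X : ℕ → Ω → unitInterval → ℝ)
    (T : ℕ → ℕ → Ω → unitInterval) (ε : ℕ → ℕ → Ω → ℝ) : Prop :=
  (∃ f : ℝ × unitInterval → ℝ, ∃ C : ℝ, Measurable f ∧ (∀ p, 0 ≤ f p ∧ f p ≤ C) ∧
    ∀ i j, P.map (fun ω => (Y X T ε i j ω, T i j ω)) =
      ((volume : Measure ℝ).prod (volume : Measure unitInterval)).withDensity
        (fun p => ENNReal.ofReal (f p))) ∧
  (∃ π : unitInterval → ℝ, ∃ c C : ℝ, Measurable π ∧ 0 < c ∧ (∀ t, c ≤ π t ∧ π t ≤ C) ∧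
    ∀ i j, P.map (T i j) = (volume : Measure unitInterval).withDensity
      (fun t => ENNReal.ofReal (π t)))

/-- The errors have mean zero and finite variance. -/
def CenteredErrors (P : Measure Ω) (ε : ℕ → ℕ → Ω → ℝ) : Prop :=
  ∀ i j, MemLp (ε i j) 2 P ∧ ∫ ω, ε i j ω ∂P = 0

/-- The counts are positive with finite mean and variance, and exceed one with positive
probability. -/
def SparseCounts (P : Measure Ω) (N : ℕ → Ω → ℕ) : Prop :=
  ∀ i, (∀ᵐ ω ∂P, 0 < N i ω) ∧ MemLp (fun ω => (N i ω : ℝ)) 2 P ∧ 0 < P {ω | 1 < N i ω}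

/-- Almost every path lies in `H^m`, and `E ∫₀¹ {X^(m)(t)}² dt < ∞`. -/
def SmoothPaths (P : Measure Ω) (m : ℕ) (X : ℕ → Ω → unitInterval → ℝ) : Prop :=
  ∀ i, (∀ᵐ ω ∂P, X i ω ∈ sobolev m) ∧
    ∫⁻ ω, (∫⁻ t in Set.Icc (0 : ℝ) 1, ENNReal.ofReal (dv m (X i ω) t ^ 2)) ∂P < ⊤

end Data

/-- There are uniformly bounded functions `h_v ∈ H^m` and a nondecreasing sequence
`γ_v ≍ v^(2m)` (here `v = 0, 1, 2, …` stands for the index `v + 1`) that diagonalize `V` and `J`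
simultaneously, and every `g ∈ H^m` has the expansion `g = ∑ V(g, h_v) h_v`, convergent in the
norm of `H^m`; the norms `nrm ν m lam`, `lam > 0`, are all equivalent. -/
def HasEigenbasis (ν : Measure unitInterval) (m : ℕ) : Prop :=
  ∃ (e : ℕ → unitInterval → ℝ) (γ : ℕ → ℝ),
    (∀ v, e v ∈ sobolev m) ∧ (∃ B : ℝ, ∀ v t, |e v t| ≤ B) ∧
    Monotone γ ∧ γ =Θ[atTop] (fun v : ℕ => ((v : ℝ) + 1) ^ (2 * m)) ∧
    (∀ u v, V ν (e u) (e v) = if u = v then 1 else 0) ∧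
    (∀ u v, J m (e u) (e v) = if u = v then γ u else 0) ∧
    ∀ g ∈ sobolev m,
      Tendsto (fun k => nrm ν m 1 (g - ∑ v ∈ Finset.range k, V ν g (e v) • e v)) atTop (𝓝 0)

/-- `Z_n = O_p(a_n)`. -/
def IsBigOp {Ω : Type*} [MeasurableSpace Ω] (P : Measure Ω) (Z : ℕ → Ω → ℝ) (a : ℕ → ℝ) : Prop :=
  ∀ η : ℝ, 0 < η → ∃ C : ℝ, 0 < C ∧ ∀ᶠ n in atTop, P {ω | C * a n < |Z n ω|} ≤ ENNReal.ofReal η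

/-- The bandwidth `h = lam^(1/(2m))`. -/
noncomputable def bw (m : ℕ) (lam : ℝ) : ℝ := lam ^ (1 / (2 * (m : ℝ)))

/-- The rate `a_n = n^(-1/2) h^(-(6m-1)/(4m)) {h^m + (nh)^(-1/2)} (log log n)^(1/2)`. -/
noncomputable def rate (m : ℕ) (h : ℝ) (n : ℕ) : ℝ :=
  (n : ℝ) ^ (-(1 / 2) : ℝ) * h ^ (-((6 * (m : ℝ) - 1) / (4 * (m : ℝ)))) *
    (h ^ m + ((n : ℝ) * h) ^ (-(1 / 2) : ℝ)) * Real.sqrt (Real.log (Real.log n))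

end FBR

/-!
The remainder is controlled by a single Hilbert–Schmidt estimate. Put `g = μhat - μ`,
`S = score(μ)` and `R = g + S`. The normal equation of the penalized criterion
(`normal_equation`) says that for every `f ∈ H^m`

  `⟨R, f⟩ = V(g, f) - (1/M) ∑ᵢ ∑ⱼ g(T_ij) f(T_ij)`,

the difference between the population and the empirical inner product. Expanding `g` and `f` in the
eigenfunctions `e_v`, with weights `w_v = 1 / (1 + lam γ_v)`, Cauchy–Schwarz bounds the right-hand
side by `A ‖g‖ ‖f‖`, where `A² = ∑ Δ_uv² w_u w_v` and `Δ_uv` is the error of the empirical inner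
product of `e_u` and `e_v`. In the same way `|⟨S, f⟩| ≤ b ‖f‖` with `b = β + √(lam J(μ, μ))` and
`β² = ∑ Z_v² w_v`, where `Z_v` averages `(Y_ij - μ(T_ij)) e_v(T_ij)`. If `A ≤ 1/2`, then
`‖g‖² = ⟨R, g⟩ - ⟨S, g⟩` gives `‖g‖ ≤ 2b` and `‖R‖ ≤ A ‖g‖ ≤ 2Ab` (`Eigensystem.nrm_remainder_le`).

Both `Δ_uv` and `Z_v` are averages, over independent subjects, of centred variables with bounded
second moments; since the counts are independent of the rest and `M ≥ n`, their second moments are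
`O(1/n)` uniformly in `u` and `v` (`lintegral_average_sq_le`). As `γ_v ≍ v^(2m)`, the weights
satisfy `∑ w_v = O(1/h)` (`Eigensystem.exists_sum_wt_le`), so that by Markov's inequality
`A = O_p((n h²)^(-1/2))` and `β = O_p((n h)^(-1/2))`, while `√(lam J(μ, μ)) = O(h^m)`. The condition
on the bandwidth gives `n h² → ∞`, hence `A ≤ 1/2` eventually with high probability, and
`2Ab = O_p((n h²)^(-1/2) {h^m + (n h)^(-1/2)})`. This is within the stated rate because
`(6m-1)/(4m) ≥ 1` and `log log n ≥ 1` for large `n` (`isBigOp_remainder`).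

Three facts about `H^m` support this. An element of `H^m` is an `m`-fold primitive of a square
integrable function, which makes `H^m` closed under pointwise limits with convergent `m`-th
derivatives (`mem_sobolev_of_tendsto`); hence every coefficient sequence with `∑ (1 + γ_v) c_v² < ∞`
comes from an element of `H^m` (`Eigensystem.exists_mem_sobolev`), and the representers and the mean
`μ` (`Model.mean_mem_sobolev`) are built from their coefficients. The sup norm on `H^m` is
controlled by `J` and finitely many point values (`Eigensystem.exists_sobolev_ineq`); since
point values of `X` are square integrable, the paths are bounded by one square integrable random quantity. Finally,
`(x, t) ↦ x t` is not jointly measurable on the product space of paths; `evalLim` replaces it by an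
upper limit along rational times, which changes nothing on continuous paths.
-/

namespace FBR

/-! ### Iterated integrals and the Sobolev space -/

/-- The `m`-fold primitive of `w` with initial data `a`: the function `F` on `[0,1]` with
`F^(k) 0 = a k` for `k < m` and `F^(m) = w`. -/
noncomputable def taylorInt : (m : ℕ) → (Fin m → ℝ) → (ℝ → ℝ) → ℝ → ℝ
  | 0, _, w => w
  | m + 1, a, w => fun t => a 0 + ∫ s in (0 : ℝ)..t, taylorInt m (Fin.tail a) w s

theorem taylorInt_succ (m : ℕ) (a : Fin (m + 1) → ℝ) (w : ℝ → ℝ) (t : ℝ) :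
    taylorInt (m + 1) a w t = a 0 + ∫ s in (0 : ℝ)..t, taylorInt m (Fin.tail a) w s := rfl

theorem intervalIntegrable_taylorInt {w : ℝ → ℝ} (hw : IntervalIntegrable w volume 0 1) :
    ∀ (m : ℕ) (a : Fin m → ℝ), IntervalIntegrable (taylorInt m a w) volume 0 1
  | 0, _ => hw
  | m + 1, a => by
    apply ContinuousOn.intervalIntegrable
    exact continuousOn_const.add (intervalIntegral.continuousOn_primitive_interval'
      (intervalIntegrable_taylorInt hw m (Fin.tail a)) (by simp))

theorem continuousOn_taylorInt_succ {w : ℝ → ℝ} (hw : IntervalIntegrable w volume 0 1)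
    (m : ℕ) (a : Fin (m + 1) → ℝ) : ContinuousOn (taylorInt (m + 1) a w) (Set.Icc 0 1) := by
  rw [← Set.uIcc_of_le (zero_le_one' ℝ)]
  exact continuousOn_const.add (intervalIntegral.continuousOn_primitive_interval'
      (intervalIntegrable_taylorInt hw m (Fin.tail a)) (by simp))

theorem _root_.AbsolutelyContinuousOnInterval.congr_eqOn {f g : ℝ → ℝ} {a b : ℝ}
    (hf : AbsolutelyContinuousOnInterval f a b) (h : Set.EqOn g f (Set.uIcc a b)) :
    AbsolutelyContinuousOnInterval g a b := by
  rw [absolutelyContinuousOnInterval_iff] at hf ⊢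
  intro ε hε
  obtain ⟨δ, hδ, H⟩ := hf ε hε
  refine ⟨δ, hδ, fun E hE hlt => ?_⟩
  refine lt_of_eq_of_lt (Finset.sum_congr rfl fun i hi => ?_) (H E hE hlt)
  rw [h (hE.1 i hi).1, h (hE.1 i hi).2]

theorem absolutelyContinuous_taylorInt_succ {w : ℝ → ℝ} (hw : IntervalIntegrable w volume 0 1)
    (m : ℕ) (a : Fin (m + 1) → ℝ) :
    AbsolutelyContinuousOnInterval (taylorInt (m + 1) a w) 0 1 := by
  have h1 := (intervalIntegrable_taylorInt hw m
    (Fin.tail a)).absolutelyContinuousOnInterval_intervalIntegral (c := 0) (by simp)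
  have h2 : AbsolutelyContinuousOnInterval (fun _ : ℝ => a 0) 0 1 :=
    (LipschitzWith.const (a 0)).lipschitzOnWith.absolutelyContinuousOnInterval
  exact h2.add h1

theorem hasDerivWithinAt_taylorInt {w : ℝ → ℝ} (hw : IntervalIntegrable w volume 0 1)
    (m : ℕ) (a : Fin (m + 2) → ℝ) {t : ℝ} (ht : t ∈ Set.Icc (0 : ℝ) 1) :
    HasDerivWithinAt (taylorInt (m + 2) a w) (taylorInt (m + 1) (Fin.tail a) w t)
      (Set.Icc 0 1) t := by
  have hc := continuousOn_taylorInt_succ hw m (Fin.tail a)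
  have : Fact (t ∈ Set.Icc (0 : ℝ) 1) := ⟨ht⟩
  have hi : IntervalIntegrable (taylorInt (m + 1) (Fin.tail a) w) volume 0 t :=
    (hc.mono (by rw [Set.uIcc_of_le ht.1]; exact Set.Icc_subset_Icc_right ht.2)).intervalIntegrable
  have h := intervalIntegral.integral_hasDerivWithinAt_right hi (s := Set.Icc 0 1)
    (t := Set.Icc 0 1)
    (hc.stronglyMeasurableAtFilter_nhdsWithin measurableSet_Icc t) (hc t ht)
  exact h.const_add (a 0)

theorem ae_restrict_Icc_iff_Ioo {p : ℝ → Prop} :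
    (∀ᵐ t ∂(volume.restrict (Set.Icc (0 : ℝ) 1)), p t) ↔ ∀ᵐ t, t ∈ Set.Ioo (0 : ℝ) 1 → p t := by
  rw [← restrict_Ioo_eq_restrict_Icc, ae_restrict_iff' measurableSet_Ioo]

theorem derivWithin_taylorInt_one_ae {w : ℝ → ℝ} (hw : IntervalIntegrable w volume 0 1)
    (a : Fin 1 → ℝ) :
    derivWithin (taylorInt 1 a w) (Set.Icc 0 1) =ᵐ[volume.restrict (Set.Icc (0 : ℝ) 1)] w := by
  refine ae_restrict_Icc_iff_Ioo.2 ?_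
  filter_upwards [hw.ae_hasDerivAt_integral] with t ht h01
  have ht' := ht (by rw [Set.uIcc_of_le zero_le_one]; exact Set.Ioo_subset_Icc_self h01) 0 (by simp)
  have h2 : HasDerivAt (taylorInt 1 a w) (w t) t := by
    exact ht'.const_add (a 0)
  exact h2.hasDerivWithinAt.derivWithin
    (uniqueDiffOn_Icc zero_lt_one t (Set.Ioo_subset_Icc_self h01))

/-- `H^m` membership for a function on the line, of which only the values on `[0,1]` matter. -/
def SobolevOn (m : ℕ) (F : ℝ → ℝ) : Prop :=
  (∀ k, k + 1 < m → DifferentiableOn ℝ (iteratedDerivWithin k F (Set.Icc 0 1)) (Set.Icc 0 1)) ∧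
    (∀ k < m, AbsolutelyContinuousOnInterval (iteratedDerivWithin k F (Set.Icc 0 1)) 0 1) ∧
    MemLp (iteratedDerivWithin m F (Set.Icc 0 1)) 2 (volume.restrict (Set.Icc (0 : ℝ) 1))

theorem intervalIntegrable_of_memLp {w : ℝ → ℝ}
    (hw : MemLp w 2 (volume.restrict (Set.Icc (0 : ℝ) 1))) : IntervalIntegrable w volume 0 1 := by
  rw [intervalIntegrable_iff_integrableOn_Icc_of_le zero_le_one]
  exact hw.integrable (by norm_num)

theorem sobolevOn_of_eqOn_taylorInt {w : ℝ → ℝ}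
    (hw : MemLp w 2 (volume.restrict (Set.Icc (0 : ℝ) 1))) :
    ∀ (m : ℕ) (a : Fin (m + 1) → ℝ) (F : ℝ → ℝ), Set.EqOn F (taylorInt (m + 1) a w) (Set.Icc 0 1) →
      SobolevOn (m + 1) F ∧ iteratedDerivWithin (m + 1) F (Set.Icc 0 1)
        =ᵐ[volume.restrict (Set.Icc (0 : ℝ) 1)] w := by
  have hwi := intervalIntegrable_of_memLp hw
  intro m
  induction m with
  | zero =>
    intro a F hF
    have hd : iteratedDerivWithin 1 F (Set.Icc 0 1)
        =ᵐ[volume.restrict (Set.Icc (0 : ℝ) 1)] w := by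
      filter_upwards [derivWithin_taylorInt_one_ae hwi a,
        ae_restrict_mem measurableSet_Icc] with t ht htI
      rw [iteratedDerivWithin_one, ← ht]
      exact derivWithin_congr hF (hF htI)
    refine ⟨⟨fun k hk => absurd hk (by omega), fun k hk => ?_, hw.ae_eq hd.symm⟩, hd⟩
    obtain rfl : k = 0 := by omega
    rw [iteratedDerivWithin_zero]
    exact (absolutelyContinuous_taylorInt_succ hwi 0 a).congr_eqOn
      (by rwa [Set.uIcc_of_le zero_le_one])
  | succ m ih =>
    intro a F hF
    have hdF : ∀ t ∈ Set.Icc (0 : ℝ) 1,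
        HasDerivWithinAt F (taylorInt (m + 1) (Fin.tail a) w t) (Set.Icc 0 1) t := fun t ht =>
      (hasDerivWithinAt_taylorInt hwi m a ht).congr hF (hF ht)
    have hG : Set.EqOn (derivWithin F (Set.Icc 0 1)) (taylorInt (m + 1) (Fin.tail a) w)
        (Set.Icc 0 1) := fun t ht =>
      (hdF t ht).derivWithin (uniqueDiffOn_Icc zero_lt_one t ht)
    obtain ⟨⟨h1, h2, h3⟩, h4⟩ := ih (Fin.tail a) _ hG
    refine ⟨⟨fun k hk => ?_, fun k hk => ?_, ?_⟩, ?_⟩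
    · cases k with
      | zero =>
        rw [iteratedDerivWithin_zero]
        exact fun t ht => (hdF t ht).differentiableWithinAt
      | succ k =>
        rw [iteratedDerivWithin_succ']
        exact h1 k (by omega)
    · cases k with
      | zero =>
        rw [iteratedDerivWithin_zero]
        exact (absolutelyContinuous_taylorInt_succ hwi (m + 1) a).congr_eqOn
          (by rwa [Set.uIcc_of_le zero_le_one])
      | succ k =>
        rw [iteratedDerivWithin_succ']
        exact h2 k (by omega)
    · rw [iteratedDerivWithin_succ']; exact h3
    · rw [iteratedDerivWithin_succ']; exact h4

/-- The fundamental theorem of calculus with the one-sided derivative at the end points. -/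
theorem eq_add_integral_derivWithin {F : ℝ → ℝ} (hF : AbsolutelyContinuousOnInterval F 0 1)
    {t : ℝ} (ht : t ∈ Set.Icc (0 : ℝ) 1) :
    F t = F 0 + ∫ s in (0 : ℝ)..t, derivWithin F (Set.Icc 0 1) s := by
  have h1 := (hF.mono (c := 0) (d := t) (by
    rw [Set.uIcc_of_le zero_le_one, Set.uIcc_of_le ht.1]
    exact Set.Icc_subset_Icc_right ht.2)).integral_deriv_eq_sub
  have h2 : ∫ s in (0 : ℝ)..t, derivWithin F (Set.Icc 0 1) s = ∫ s in (0 : ℝ)..t, deriv F s := by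
    rw [intervalIntegral.integral_of_le ht.1, intervalIntegral.integral_of_le ht.1,
      integral_Ioc_eq_integral_Ioo, integral_Ioc_eq_integral_Ioo]
    refine setIntegral_congr_fun measurableSet_Ioo fun s hs => ?_
    exact derivWithin_of_mem_nhds (Icc_mem_nhds hs.1 (hs.2.trans_le ht.2))
  rw [h2, h1]; ring

theorem SobolevOn.exists_eqOn_taylorInt :
    ∀ (m : ℕ) (F : ℝ → ℝ), SobolevOn (m + 1) F → ∃ a : Fin (m + 1) → ℝ,
      Set.EqOn F (taylorInt (m + 1) a (iteratedDerivWithin (m + 1) F (Set.Icc 0 1)))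
        (Set.Icc 0 1) := by
  intro m
  induction m with
  | zero =>
    rintro F ⟨-, h2, -⟩
    refine ⟨fun _ => F 0, fun t ht => ?_⟩
    have h := h2 0 (by omega)
    rw [iteratedDerivWithin_zero] at h
    rw [taylorInt_succ, iteratedDerivWithin_one]
    exact eq_add_integral_derivWithin h ht
  | succ m ih =>
    rintro F ⟨h1, h2, h3⟩
    have hG : SobolevOn (m + 1) (derivWithin F (Set.Icc 0 1)) := by
      refine ⟨fun k hk => ?_, fun k hk => ?_, ?_⟩
      · rw [← iteratedDerivWithin_succ']; exact h1 _ (by omega)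
      · rw [← iteratedDerivWithin_succ']; exact h2 _ (by omega)
      · rw [← iteratedDerivWithin_succ']; exact h3
    obtain ⟨a, ha⟩ := ih _ hG
    refine ⟨Fin.cons (F 0) a, fun t ht => ?_⟩
    have h := h2 0 (by omega)
    rw [iteratedDerivWithin_zero] at h
    rw [taylorInt_succ, eq_add_integral_derivWithin h ht, Fin.cons_zero, Fin.tail_cons,
      iteratedDerivWithin_succ']
    congr 1
    refine intervalIntegral.integral_congr fun s hs => ?_
    rw [Set.uIcc_of_le ht.1] at hs
    exact ha ⟨hs.1, hs.2.trans ht.2⟩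

/-- Taylor's formula at `0`: elements of `H^m` are `m`-fold primitives of their `m`-th
derivatives. -/
theorem exists_taylorInt_of_mem_sobolev {m : ℕ} (hm : 1 ≤ m) {f : unitInterval → ℝ}
    (hf : f ∈ sobolev m) :
    ∃ a : Fin m → ℝ, ∀ t : unitInterval, f t = taylorInt m a (dv m f) t := by
  obtain ⟨m, rfl⟩ : ∃ k, m = k + 1 := ⟨m - 1, by omega⟩
  obtain ⟨a, ha⟩ := SobolevOn.exists_eqOn_taylorInt m _ hf
  refine ⟨a, fun t => ?_⟩
  rw [← Set.IccExtend_val (zero_le_one' ℝ) f t]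
  exact ha t.2

theorem mem_sobolev_of_eq_taylorInt {m : ℕ} (hm : 1 ≤ m) {f : unitInterval → ℝ}
    {a : Fin m → ℝ} {w : ℝ → ℝ} (hw : MemLp w 2 (volume.restrict (Set.Icc (0 : ℝ) 1)))
    (h : ∀ t : unitInterval, f t = taylorInt m a w t) :
    f ∈ sobolev m ∧ dv m f =ᵐ[volume.restrict (Set.Icc (0 : ℝ) 1)] w := by
  obtain ⟨m, rfl⟩ : ∃ k, m = k + 1 := ⟨m - 1, by omega⟩
  refine sobolevOn_of_eqOn_taylorInt hw m a _ fun t ht => ?_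
  rw [Set.IccExtend_of_mem _ _ ht]
  exact h ⟨t, ht⟩

theorem memLp_dv {m : ℕ} {f : unitInterval → ℝ} (hf : f ∈ sobolev m) :
    MemLp (dv m f) 2 (volume.restrict (Set.Icc (0 : ℝ) 1)) := hf.2.2

theorem continuous_of_mem_sobolev {m : ℕ} (hm : 1 ≤ m) {f : unitInterval → ℝ}
    (hf : f ∈ sobolev m) : Continuous f := by
  obtain ⟨a, ha⟩ := exists_taylorInt_of_mem_sobolev hm hf
  obtain ⟨m, rfl⟩ : ∃ k, m = k + 1 := ⟨m - 1, by omega⟩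
  have h := continuousOn_taylorInt_succ (intervalIntegrable_of_memLp (memLp_dv hf)) m a
  rw [show f = (Set.Icc (0 : ℝ) 1).domRestrict (taylorInt (m + 1) a (dv (m + 1) f)) from
    funext ha]
  exact continuousOn_iff_continuous_domRestrict.1 h

/-! ### Linearity -/

theorem taylorInt_smul (c : ℝ) (w : ℝ → ℝ) :
    ∀ (m : ℕ) (a : Fin m → ℝ) (t : ℝ), taylorInt m (c • a) (c • w) t = c * taylorInt m a w t
  | 0, _, _ => rfl
  | m + 1, a, t => by
    have h : ∀ s, taylorInt m (Fin.tail (c • a)) (c • w) s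
        = c * taylorInt m (Fin.tail a) w s := fun s => taylorInt_smul c w m (Fin.tail a) s
    simp only [taylorInt_succ, h, intervalIntegral.integral_const_mul, Pi.smul_apply, smul_eq_mul]
    ring

theorem taylorInt_add {w z : ℝ → ℝ} (hw : IntervalIntegrable w volume 0 1)
    (hz : IntervalIntegrable z volume 0 1) :
    ∀ (m : ℕ) (a b : Fin m → ℝ) (t : ℝ), t ∈ Set.Icc (0 : ℝ) 1 →
      taylorInt m (a + b) (w + z) t = taylorInt m a w t + taylorInt m b z t
  | 0, _, _, _, _ => rfl
  | m + 1, a, b, t, ht => by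
    have hsub : Set.uIcc 0 t ⊆ Set.uIcc (0 : ℝ) 1 := by
      rw [Set.uIcc_of_le ht.1, Set.uIcc_of_le zero_le_one]
      exact Set.Icc_subset_Icc_right ht.2
    have h : ∫ s in (0 : ℝ)..t, taylorInt m (Fin.tail (a + b)) (w + z) s
        = ∫ s in (0 : ℝ)..t, (taylorInt m (Fin.tail a) w s + taylorInt m (Fin.tail b) z s) := by
      refine intervalIntegral.integral_congr fun s hs => ?_
      rw [Set.uIcc_of_le ht.1] at hs
      exact taylorInt_add hw hz m (Fin.tail a) (Fin.tail b) s ⟨hs.1, hs.2.trans ht.2⟩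
    rw [taylorInt_succ, taylorInt_succ, taylorInt_succ, h, intervalIntegral.integral_add
      ((intervalIntegrable_taylorInt hw m _).mono_set hsub)
      ((intervalIntegrable_taylorInt hz m _).mono_set hsub), Pi.add_apply]
    ring

theorem sobolev_add {m : ℕ} (hm : 1 ≤ m) {f g : unitInterval → ℝ} (hf : f ∈ sobolev m)
    (hg : g ∈ sobolev m) : f + g ∈ sobolev m ∧
      dv m (f + g) =ᵐ[volume.restrict (Set.Icc (0 : ℝ) 1)] dv m f + dv m g := by
  obtain ⟨a, ha⟩ := exists_taylorInt_of_mem_sobolev hm hf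
  obtain ⟨b, hb⟩ := exists_taylorInt_of_mem_sobolev hm hg
  refine mem_sobolev_of_eq_taylorInt hm (a := a + b) ((memLp_dv hf).add (memLp_dv hg)) fun t => ?_
  rw [taylorInt_add (intervalIntegrable_of_memLp (memLp_dv hf))
    (intervalIntegrable_of_memLp (memLp_dv hg)) m a b t t.2, ← ha, ← hb, Pi.add_apply]

theorem sobolev_smul {m : ℕ} (hm : 1 ≤ m) (c : ℝ) {f : unitInterval → ℝ} (hf : f ∈ sobolev m) :
    c • f ∈ sobolev m ∧
      dv m (c • f) =ᵐ[volume.restrict (Set.Icc (0 : ℝ) 1)] c • dv m f := by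
  obtain ⟨a, ha⟩ := exists_taylorInt_of_mem_sobolev hm hf
  refine mem_sobolev_of_eq_taylorInt hm (a := c • a) ((memLp_dv hf).const_smul c) fun t => ?_
  rw [taylorInt_smul, ← ha, Pi.smul_apply, smul_eq_mul]

/-- `H^m` as a vector space. -/
def sobolevSubmodule (m : ℕ) (hm : 1 ≤ m) : Submodule ℝ (unitInterval → ℝ) where
  carrier := sobolev m
  add_mem' hf hg := (sobolev_add hm hf hg).1
  zero_mem' := (mem_sobolev_of_eq_taylorInt hm (a := 0) (w := 0) MemLp.zero fun t => by
    simpa using (taylorInt_smul 0 0 m 0 t).symm).1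
  smul_mem' c _ hf := (sobolev_smul hm c hf).1

theorem integrable_dv_mul {m : ℕ} {f g : unitInterval → ℝ} (hf : f ∈ sobolev m)
    (hg : g ∈ sobolev m) :
    Integrable (fun t => dv m f t * dv m g t) (volume.restrict (Set.Icc (0 : ℝ) 1)) :=
  (memLp_dv hf).integrable_mul (memLp_dv hg)

theorem J_comm (m : ℕ) (f g : unitInterval → ℝ) : J m f g = J m g f := by
  simp only [J, mul_comm]

theorem J_self_nonneg (m : ℕ) (f : unitInterval → ℝ) : 0 ≤ J m f f :=
  integral_nonneg fun _ => mul_self_nonneg _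

theorem J_add_left {m : ℕ} (hm : 1 ≤ m) {f g k : unitInterval → ℝ} (hf : f ∈ sobolev m)
    (hg : g ∈ sobolev m) (hk : k ∈ sobolev m) : J m (f + g) k = J m f k + J m g k := by
  unfold J
  rw [← integral_add (integrable_dv_mul hf hk) (integrable_dv_mul hg hk)]
  refine integral_congr_ae ?_
  filter_upwards [(sobolev_add hm hf hg).2] with t ht
  rw [ht, Pi.add_apply]; ring

theorem J_smul_left {m : ℕ} (hm : 1 ≤ m) (c : ℝ) {f : unitInterval → ℝ} (hf : f ∈ sobolev m)
    (k : unitInterval → ℝ) : J m (c • f) k = c * J m f k := by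
  unfold J
  rw [← integral_const_mul]
  refine integral_congr_ae ?_
  filter_upwards [(sobolev_smul hm c hf).2] with t ht
  rw [ht, Pi.smul_apply, smul_eq_mul]; ring

/-- `J` as a bilinear form on `H^m`. -/
noncomputable def JForm (m : ℕ) (hm : 1 ≤ m) : LinearMap.BilinForm ℝ (sobolevSubmodule m hm) :=
  LinearMap.mk₂ ℝ (fun f g => J m f g)
    (fun f g k => J_add_left hm f.2 g.2 k.2)
    (fun c f k => J_smul_left hm c f.2 k)
    (fun f g k => by
      rw [J_comm m (f : unitInterval → ℝ), J_comm m (f : unitInterval → ℝ),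
        J_comm m (f : unitInterval → ℝ)]
      exact J_add_left hm g.2 k.2 f.2)
    (fun c f k => by
      rw [J_comm m (f : unitInterval → ℝ), J_comm m (f : unitInterval → ℝ)]
      exact J_smul_left hm c k.2 f)

theorem integrable_mul_of_mem_sobolev {m : ℕ} (hm : 1 ≤ m) (ν : Measure unitInterval)
    [IsFiniteMeasure ν] {f g : unitInterval → ℝ} (hf : f ∈ sobolev m) (hg : g ∈ sobolev m) :
    Integrable (fun t => f t * g t) ν :=
  ((continuous_of_mem_sobolev hm hf).mul (continuous_of_mem_sobolev hm hg)).integrable_of_hasCompactSupport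
    (HasCompactSupport.of_compactSpace _)

/-- `V` as a bilinear form on `H^m`. -/
noncomputable def VForm (ν : Measure unitInterval) [IsFiniteMeasure ν] (m : ℕ) (hm : 1 ≤ m) :
    LinearMap.BilinForm ℝ (sobolevSubmodule m hm) :=
  LinearMap.mk₂ ℝ (fun f g => V ν f g)
    (fun f g k => by
      simp only [V]
      rw [← integral_add (integrable_mul_of_mem_sobolev hm ν f.2 k.2)
        (integrable_mul_of_mem_sobolev hm ν g.2 k.2)]
      simp [add_mul])
    (fun c f k => by simp [V, ← integral_const_mul, mul_assoc])
    (fun f g k => by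
      simp only [V]
      rw [← integral_add (integrable_mul_of_mem_sobolev hm ν f.2 g.2)
        (integrable_mul_of_mem_sobolev hm ν f.2 k.2)]
      simp [mul_add])
    (fun c f k => by simp [V, ← integral_const_mul, mul_left_comm])

/-! ### Closedness -/

theorem abs_taylorInt_zero_le {w : ℝ → ℝ} (hw : IntervalIntegrable w volume 0 1) :
    ∀ (m : ℕ) (t : ℝ), t ∈ Set.Icc (0 : ℝ) 1 →
      |taylorInt (m + 1) 0 w t| ≤ ∫ s in (0 : ℝ)..1, |w s|
  | 0, t, ht => by
    have hsub : Set.uIcc 0 t ⊆ Set.uIcc (0 : ℝ) 1 := by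
      rw [Set.uIcc_of_le ht.1, Set.uIcc_of_le zero_le_one]
      exact Set.Icc_subset_Icc_right ht.2
    rw [taylorInt_succ]
    simp only [Pi.zero_apply, zero_add]
    refine (intervalIntegral.abs_integral_le_integral_abs ht.1).trans ?_
    exact intervalIntegral.integral_mono_interval le_rfl ht.1 ht.2
      (Eventually.of_forall fun _ => abs_nonneg _) hw.abs
  | m + 1, t, ht => by
    rw [taylorInt_succ]
    simp only [Pi.zero_apply, zero_add]
    have h := intervalIntegral.norm_integral_le_of_norm_le_const
      (f := taylorInt (m + 1) 0 w) (a := 0) (b := t) (C := ∫ s in (0 : ℝ)..1, |w s|)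
      (fun s hs => by
        rw [Set.uIoc_of_le ht.1] at hs
        exact abs_taylorInt_zero_le hw m s ⟨hs.1.le, hs.2.trans ht.2⟩)
    rw [sub_zero, abs_of_nonneg ht.1, Real.norm_eq_abs] at h
    refine h.trans (mul_le_of_le_one_right ?_ ht.2)
    exact intervalIntegral.integral_nonneg zero_le_one fun _ _ => abs_nonneg _

/-- The primitive of `0` with initial data `a`, that is, the polynomial of degree `< m` with these
derivatives at `0`, as a linear function of `a`. -/
noncomputable def taylorPoly (m : ℕ) : (Fin m → ℝ) →ₗ[ℝ] (unitInterval → ℝ) where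
  toFun a t := taylorInt m a 0 t
  map_add' a b := by
    funext t
    have h0 : IntervalIntegrable (0 : ℝ → ℝ) volume 0 1 := intervalIntegrable_const (c := (0 : ℝ))
    simpa using taylorInt_add h0 h0 m a b t t.2
  map_smul' c a := by
    funext t
    simpa using taylorInt_smul c 0 m a t

/-- `H^m` is closed: a pointwise limit of elements whose `m`-th derivatives are Cauchy in `L²`
is in `H^m`. The `m`-th derivatives converge to some `w`; hence so do the remainders of the Taylor
expansions at `0`, so that the Taylor polynomials converge as well, and they range over a
finite-dimensional, hence closed, space. -/
theorem mem_sobolev_of_tendsto {m : ℕ} (hm : 1 ≤ m) {F : ℕ → unitInterval → ℝ}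
    (hF : ∀ k, F k ∈ sobolev m) {f : unitInterval → ℝ}
    (hlim : ∀ t, Tendsto (fun k => F k t) atTop (𝓝 (f t)))
    (hJ : ∀ ε > 0, ∃ K, ∀ k ≥ K, ∀ l ≥ K, J m (F k - F l) (F k - F l) < ε) :
    f ∈ sobolev m := by
  set ρ : Measure ℝ := volume.restrict (Set.Icc (0 : ℝ) 1) with hρ
  have hsub : ∀ k l, dv m (F k - F l) =ᵐ[ρ] dv m (F k) - dv m (F l) := fun k l => by
    have h1 := sobolev_smul hm (-1) (hF l)
    have h2 := (sobolev_add hm (hF k) h1.1).2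
    rw [show F k - F l = F k + (-1 : ℝ) • F l by rw [neg_one_smul, sub_eq_add_neg]]
    filter_upwards [h1.2, h2] with t h1 h2
    rw [h2, Pi.add_apply, h1, Pi.sub_apply, Pi.smul_apply, neg_one_smul, sub_eq_add_neg]
  let L : ℕ → Lp ℝ 2 ρ := fun k => (memLp_dv (hF k)).toLp _
  have hnorm : ∀ k l, ‖L k - L l‖ ^ 2 = J m (F k - F l) (F k - F l) := fun k l => by
    rw [← real_inner_self_eq_norm_sq, L2.inner_def]
    refine integral_congr_ae ?_
    filter_upwards [hsub k l, Lp.coeFn_sub (L k) (L l), (memLp_dv (hF k)).coeFn_toLp,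
      (memLp_dv (hF l)).coeFn_toLp] with t h1 h2 h3 h4
    rw [h1, h2, Pi.sub_apply, Pi.sub_apply, h3, h4, real_inner_self_eq_norm_sq, Real.norm_eq_abs,
      sq_abs, sq]
  have hc : CauchySeq L := by
    refine Metric.cauchySeq_iff.2 fun ε hε => ?_
    obtain ⟨K, hK⟩ := hJ (ε ^ 2) (by positivity)
    refine ⟨K, fun k hk l hl => ?_⟩
    rw [dist_eq_norm]
    have := hK k hk l hl
    rw [← hnorm] at this
    exact lt_of_pow_lt_pow_left₀ 2 hε.le this
  obtain ⟨Lw, hLw⟩ := cauchySeq_tendsto_of_complete hc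
  have hw : MemLp (Lw : ℝ → ℝ) 2 ρ := Lp.memLp Lw
  have hwi := intervalIntegrable_of_memLp hw
  have hbound : ∀ k, ∫ s in (0 : ℝ)..1, |dv m (F k) s - Lw s| ≤ ‖L k - Lw‖ := fun k => by
    have hd : MemLp (dv m (F k) - (Lw : ℝ → ℝ)) 2 ρ := (memLp_dv (hF k)).sub hw
    have h1 : ‖L k - Lw‖ = (eLpNorm (dv m (F k) - (Lw : ℝ → ℝ)) 2 ρ).toReal := by
      rw [Lp.norm_def]
      congr 1
      refine eLpNorm_congr_ae ?_
      filter_upwards [Lp.coeFn_sub (L k) Lw, (memLp_dv (hF k)).coeFn_toLp] with t h1 h2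
      rw [h1, Pi.sub_apply, Pi.sub_apply, h2]
    have : IsProbabilityMeasure ρ := ⟨by simp [hρ]⟩
    rw [h1, intervalIntegral.integral_of_le zero_le_one, ← integral_Icc_eq_integral_Ioc]
    have h2 := eLpNorm_le_eLpNorm_of_exponent_le (μ := ρ) (p := 1) (q := 2) (by norm_num)
      hd.aestronglyMeasurable
    have h3 := ENNReal.toReal_mono hd.eLpNorm_ne_top h2
    rwa [toReal_eLpNorm hd.aestronglyMeasurable, lpNorm_one_eq_integral_norm
      hd.aestronglyMeasurable] at h3
  choose a ha using fun k => exists_taylorInt_of_mem_sobolev hm (hF k)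
  have h0 : IntervalIntegrable (0 : ℝ → ℝ) volume 0 1 := intervalIntegrable_const (c := (0 : ℝ))
  have hsplit : ∀ (b : Fin m → ℝ) (z : ℝ → ℝ) (_ : IntervalIntegrable z volume 0 1)
      (t : unitInterval), taylorInt m b z t = taylorPoly m b t + taylorInt m 0 z t := by
    intro b z hz t
    have h := taylorInt_add h0 hz m b 0 t t.2
    rwa [add_zero, zero_add] at h
  have hrem : ∀ t : unitInterval, Tendsto (fun k => taylorInt m 0 (dv m (F k)) t) atTop
      (𝓝 (taylorInt m 0 Lw t)) := fun t => by
    rw [tendsto_iff_norm_sub_tendsto_zero]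
    refine squeeze_zero (fun _ => norm_nonneg _) (fun k => ?_)
      (tendsto_iff_norm_sub_tendsto_zero.1 hLw)
    refine le_trans ?_ (hbound k)
    have hki := intervalIntegrable_of_memLp (memLp_dv (hF k))
    have hdi := hki.sub hwi
    have h1 := taylorInt_add hdi hwi m 0 0 t t.2
    rw [show (fun s => dv m (F k) s - Lw s) + (Lw : ℝ → ℝ) = dv m (F k) from
      funext fun s => sub_add_cancel _ _, add_zero] at h1
    rw [h1, add_sub_cancel_right, Real.norm_eq_abs]
    obtain ⟨m, rfl⟩ : ∃ k, m = k + 1 := ⟨m - 1, by omega⟩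
    exact abs_taylorInt_zero_le hdi m t t.2
  have hpoly : Tendsto (fun k => taylorPoly m (a k)) atTop
      (𝓝 (fun t : unitInterval => f t - taylorInt m 0 Lw t)) := by
    refine tendsto_pi_nhds.2 fun t => ?_
    refine ((hlim t).sub (hrem t)).congr fun k => ?_
    rw [ha k t, hsplit _ _ (intervalIntegrable_of_memLp (memLp_dv (hF k))), add_sub_cancel_right]
  have hclosed : IsClosed ((LinearMap.range (taylorPoly m) : Submodule ℝ (unitInterval → ℝ)) :
      Set (unitInterval → ℝ)) := Submodule.closed_of_finiteDimensional _
  obtain ⟨b, hb⟩ := hclosed.mem_of_tendsto hpoly (Eventually.of_forall fun k => ⟨a k, rfl⟩)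
  refine (mem_sobolev_of_eq_taylorInt hm (a := b) hw fun t => ?_).1
  rw [hsplit b Lw hwi t, hb]
  ring

/-! ### Algebra of the forms `V`, `J` and `ip` on `H^m` -/

section Forms

variable {ν : Measure unitInterval} [IsFiniteMeasure ν] {m : ℕ} {f g k : unitInterval → ℝ}

theorem V_comm (ν : Measure unitInterval) (f g : unitInterval → ℝ) : V ν f g = V ν g f := by
  simp only [V, mul_comm]

theorem V_self_nonneg (ν : Measure unitInterval) (f : unitInterval → ℝ) : 0 ≤ V ν f f :=
  integral_nonneg fun _ => mul_self_nonneg _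

theorem ip_self_nonneg (ν : Measure unitInterval) (m : ℕ) {lam : ℝ} (hlam : 0 ≤ lam)
    (f : unitInterval → ℝ) : 0 ≤ ip ν m lam f f :=
  add_nonneg (V_self_nonneg ν f) (mul_nonneg hlam (J_self_nonneg m f))

theorem nrm_sq (ν : Measure unitInterval) (m : ℕ) {lam : ℝ} (hlam : 0 ≤ lam)
    (f : unitInterval → ℝ) : nrm ν m lam f ^ 2 = ip ν m lam f f :=
  Real.sq_sqrt (ip_self_nonneg ν m hlam f)

theorem V_add_left (hm : 1 ≤ m) (hf : f ∈ sobolev m) (hg : g ∈ sobolev m) (hk : k ∈ sobolev m) :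
    V ν (f + g) k = V ν f k + V ν g k :=
  LinearMap.map_add₂ (VForm ν m hm) ⟨f, hf⟩ ⟨g, hg⟩ ⟨k, hk⟩

theorem V_smul_left (ν : Measure unitInterval) (c : ℝ) (f k : unitInterval → ℝ) :
    V ν (c • f) k = c * V ν f k := by
  simp [V, ← integral_const_mul, mul_assoc]

theorem J_sq_le (hm : 1 ≤ m) (hf : f ∈ sobolev m) (hg : g ∈ sobolev m) :
    J m f g ^ 2 ≤ J m f f * J m g g := by
  have h := LinearMap.BilinForm.apply_mul_apply_le_of_forall_zero_le (JForm m hm)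
    (fun x => J_self_nonneg m x) ⟨f, hf⟩ ⟨g, hg⟩
  have h' : J m f g * J m g f ≤ J m f f * J m g g := h
  rwa [J_comm m g f, ← sq] at h'

theorem V_sq_le (hm : 1 ≤ m) (hf : f ∈ sobolev m) (hg : g ∈ sobolev m) :
    V ν f g ^ 2 ≤ V ν f f * V ν g g := by
  have h := LinearMap.BilinForm.apply_mul_apply_le_of_forall_zero_le (VForm ν m hm)
    (fun x => V_self_nonneg ν x) ⟨f, hf⟩ ⟨g, hg⟩
  have h' : V ν f g * V ν g f ≤ V ν f f * V ν g g := h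
  rwa [V_comm ν g f, ← sq] at h'

theorem ip_add_left (hm : 1 ≤ m) (lam : ℝ) (hf : f ∈ sobolev m) (hg : g ∈ sobolev m)
    (hk : k ∈ sobolev m) : ip ν m lam (f + g) k = ip ν m lam f k + ip ν m lam g k := by
  simp only [ip, V_add_left hm hf hg hk, J_add_left hm hf hg hk]; ring

theorem ip_smul_left (ν : Measure unitInterval) (hm : 1 ≤ m) (lam c : ℝ) (hf : f ∈ sobolev m)
    (k : unitInterval → ℝ) : ip ν m lam (c • f) k = c * ip ν m lam f k := by
  simp only [ip, V_smul_left, J_smul_left hm c hf]; ring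

theorem sub_mem_sobolev (hm : 1 ≤ m) (hf : f ∈ sobolev m) (hg : g ∈ sobolev m) :
    f - g ∈ sobolev m :=
  (sobolevSubmodule m hm).sub_mem hf hg

theorem V_sub_left (hm : 1 ≤ m) (hf : f ∈ sobolev m) (hg : g ∈ sobolev m) (hk : k ∈ sobolev m) :
    V ν (f - g) k = V ν f k - V ν g k :=
  LinearMap.map_sub₂ (VForm ν m hm) ⟨f, hf⟩ ⟨g, hg⟩ ⟨k, hk⟩

theorem J_sub_left (hm : 1 ≤ m) (hf : f ∈ sobolev m) (hg : g ∈ sobolev m) (hk : k ∈ sobolev m) :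
    J m (f - g) k = J m f k - J m g k :=
  LinearMap.map_sub₂ (JForm m hm) ⟨f, hf⟩ ⟨g, hg⟩ ⟨k, hk⟩

theorem sum_smul_mem_sobolev (hm : 1 ≤ m) {ι : Type*} (s : Finset ι) (c : ι → ℝ)
    {e : ι → unitInterval → ℝ} (he : ∀ i, e i ∈ sobolev m) :
    (∑ i ∈ s, c i • e i) ∈ sobolev m :=
  (sobolevSubmodule m hm).sum_mem fun i _ => (sobolevSubmodule m hm).smul_mem _ (he i)

theorem zero_mem_sobolev (hm : 1 ≤ m) : (0 : unitInterval → ℝ) ∈ sobolev m :=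
  (sobolevSubmodule m hm).zero_mem

theorem V_sum_left (hm : 1 ≤ m) {ι : Type*} (s : Finset ι) (c : ι → ℝ)
    {e : ι → unitInterval → ℝ} (he : ∀ i, e i ∈ sobolev m) (hk : k ∈ sobolev m) :
    V ν (∑ i ∈ s, c i • e i) k = ∑ i ∈ s, c i * V ν (e i) k := by
  classical
  induction s using Finset.induction_on with
  | empty => simp [V]
  | insert i s hi ih =>
    rw [Finset.sum_insert hi, Finset.sum_insert hi, V_add_left hm (sobolev_smul hm _ (he i)).1
      (sum_smul_mem_sobolev hm s c he) hk, V_smul_left, ih]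

theorem J_sum_left (hm : 1 ≤ m) {ι : Type*} (s : Finset ι) (c : ι → ℝ)
    {e : ι → unitInterval → ℝ} (he : ∀ i, e i ∈ sobolev m) (hk : k ∈ sobolev m) :
    J m (∑ i ∈ s, c i • e i) k = ∑ i ∈ s, c i * J m (e i) k := by
  classical
  induction s using Finset.induction_on with
  | empty =>
    have := J_smul_left hm 0 (zero_mem_sobolev hm) k
    simpa using this
  | insert i s hi ih =>
    rw [Finset.sum_insert hi, Finset.sum_insert hi, J_add_left hm (sobolev_smul hm _ (he i)).1
      (sum_smul_mem_sobolev hm s c he) hk, J_smul_left hm _ (he i), ih]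

theorem ip_sum_left (hm : 1 ≤ m) (lam : ℝ) {ι : Type*} (s : Finset ι) (c : ι → ℝ)
    {e : ι → unitInterval → ℝ} (he : ∀ i, e i ∈ sobolev m) (hk : k ∈ sobolev m) :
    ip ν m lam (∑ i ∈ s, c i • e i) k = ∑ i ∈ s, c i * ip ν m lam (e i) k := by
  simp only [ip, V_sum_left hm s c he hk, J_sum_left hm s c he hk, mul_add, Finset.mul_sum,
    Finset.sum_add_distrib]
  congr 1
  exact Finset.sum_congr rfl fun i _ => by ring

end Forms

/-! ### Expansions in the eigenfunctions -/

/-- The data of `HasEigenbasis`: `e` diagonalizes `V` and `J` simultaneously, with `J`-eigenvalues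
`γ` of order `v^(2m)` and `|e v| ≤ B`. -/
structure Eigensystem (ν : Measure unitInterval) (m : ℕ) (e : ℕ → unitInterval → ℝ) (γ : ℕ → ℝ)
    (B : ℝ) : Prop where
  mem : ∀ v, e v ∈ sobolev m
  bound : ∀ v t, |e v t| ≤ B
  growth : γ =Θ[atTop] (fun v : ℕ => ((v : ℝ) + 1) ^ (2 * m))
  V_eq : ∀ u v, V ν (e u) (e v) = if u = v then 1 else 0
  J_eq : ∀ u v, J m (e u) (e v) = if u = v then γ u else 0
  expand : ∀ g ∈ sobolev m,
      Tendsto (fun k => nrm ν m 1 (g - ∑ v ∈ Finset.range k, V ν g (e v) • e v)) atTop (𝓝 0)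

theorem HasEigenbasis.exists_eigensystem {ν : Measure unitInterval} {m : ℕ}
    (h : HasEigenbasis ν m) : ∃ e γ B, Eigensystem ν m e γ B := by
  obtain ⟨e, γ, h1, ⟨B, h2⟩, -, h4, h5, h6, h7⟩ := h
  exact ⟨e, γ, B, h1, h2, h4, h5, h6, h7⟩

/-- The weights `1 / (1 + lam * γ_v)`. -/
noncomputable def wt (γ : ℕ → ℝ) (lam : ℝ) (v : ℕ) : ℝ := 1 / (1 + lam * γ v)

theorem bw_pos {m : ℕ} {lam : ℝ} (hlam : 0 < lam) : 0 < bw m lam := Real.rpow_pos_of_pos hlam _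

theorem bw_pow {m : ℕ} (hm : 1 ≤ m) {lam : ℝ} (hlam : 0 < lam) : bw m lam ^ (2 * m) = lam := by
  have hm' : (m : ℝ) ≠ 0 := by positivity
  rw [bw, ← Real.rpow_natCast, ← Real.rpow_mul hlam.le]
  push_cast
  rw [one_div_mul_cancel (by positivity), Real.rpow_one]

theorem sum_one_div_one_add_sq_le {h : ℝ} (hh : 0 < h) (k : ℕ) :
    ∑ v ∈ Finset.range k, 1 / (1 + (h * ((v : ℝ) + 1)) ^ 2) ≤ 2 / h := by
  have key : ∀ k : ℕ, ∑ v ∈ Finset.range k, 1 / (1 + (h * ((v : ℝ) + 1)) ^ 2)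
      ≤ 2 / h - 2 / h * (1 / (1 + h * k)) := by
    intro k
    induction k with
    | zero => simp
    | succ k ih =>
      rw [Finset.sum_range_succ]
      -- telescoping: `1 / (1 + a ^ 2) ≤ 2 / (1 + a) ^ 2`
      have h1 : 1 / (1 + (h * ((k : ℝ) + 1)) ^ 2)
          ≤ 2 / h * (1 / (1 + h * k)) - 2 / h * (1 / (1 + h * (k + 1))) := by
        have hk : (0 : ℝ) ≤ k := by positivity
        have e1 : 2 / h * (1 / (1 + h * k)) - 2 / h * (1 / (1 + h * (k + 1)))
            = 2 / ((1 + h * k) * (1 + h * (k + 1))) := by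
          field_simp; ring
        rw [e1, div_le_div_iff₀ (by positivity) (by positivity)]
        have : 0 ≤ h * k := by positivity
        nlinarith [sq_nonneg (h * (k + 1) - 1), sq_nonneg (h * k), mul_pos hh hh]
      push_cast
      linarith
  refine (key k).trans ?_
  have : 0 ≤ 2 / h * (1 / (1 + h * k)) := by positivity
  linarith

theorem tendsto_zero_of_sq_le {a b : ℕ → ℝ} {c : ℝ} (hb : Tendsto b atTop (𝓝 0))
    (h : ∀ k, a k ^ 2 ≤ b k * c) : Tendsto a atTop (𝓝 0) := by
  have h1 : Tendsto (fun k => a k ^ 2) atTop (𝓝 0) :=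
    squeeze_zero (fun _ => sq_nonneg _) h (by simpa using hb.mul_const c)
  have h2 := (Real.continuous_sqrt.tendsto 0).comp h1
  simp only [Function.comp_def, Real.sqrt_sq_eq_abs, Real.sqrt_zero] at h2
  exact (tendsto_zero_iff_abs_tendsto_zero a).2 h2

namespace Eigensystem

variable {ν : Measure unitInterval} {m : ℕ} {e : ℕ → unitInterval → ℝ} {γ : ℕ → ℝ} {B : ℝ}

theorem gamma_nonneg (E : Eigensystem ν m e γ B) (v : ℕ) : 0 ≤ γ v := by
  have h := J_self_nonneg m (e v)
  rwa [E.J_eq, if_pos rfl] at h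

theorem B_nonneg (E : Eigensystem ν m e γ B) : 0 ≤ B :=
  (abs_nonneg _).trans (E.bound 0 0)

theorem one_le (E : Eigensystem ν m e γ B) {lam : ℝ} (hlam : 0 ≤ lam) (v : ℕ) :
    1 ≤ 1 + lam * γ v := by
  have := mul_nonneg hlam (E.gamma_nonneg v)
  linarith

theorem wt_pos (E : Eigensystem ν m e γ B) {lam : ℝ} (hlam : 0 ≤ lam) (v : ℕ) :
    0 < wt γ lam v :=
  one_div_pos.2 (zero_lt_one.trans_le (E.one_le hlam v))

theorem wt_le_one (E : Eigensystem ν m e γ B) {lam : ℝ} (hlam : 0 ≤ lam) (v : ℕ) :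
    wt γ lam v ≤ 1 := by
  have := E.one_le hlam v
  rw [wt, div_le_one (by linarith)]
  exact this

theorem exists_le_gamma (E : Eigensystem ν m e γ B) :
    ∃ c : ℝ, 0 < c ∧ c ≤ 1 ∧ ∃ v0 : ℕ, ∀ v ≥ v0, c * ((v : ℝ) + 1) ^ (2 * m) ≤ γ v := by
  obtain ⟨C, hC, h⟩ := E.growth.2.exists_pos
  obtain ⟨v0, hv0⟩ := eventually_atTop.1 h.bound
  refine ⟨min 1 (1 / C), lt_min one_pos (by positivity), min_le_left _ _, v0, fun v hv => ?_⟩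
  have h1 := hv0 v hv
  rw [Real.norm_of_nonneg (by positivity), Real.norm_of_nonneg (E.gamma_nonneg v)] at h1
  calc min 1 (1 / C) * ((v : ℝ) + 1) ^ (2 * m) ≤ 1 / C * ((v : ℝ) + 1) ^ (2 * m) := by
        gcongr; exact min_le_right _ _
    _ ≤ 1 / C * (C * γ v) := by gcongr
    _ = γ v := by field_simp

/-- The effective dimension `∑ 1 / (1 + lam * γ_v)` is of order `1 / h`. -/
theorem exists_sum_wt_le (hm : 1 ≤ m) (E : Eigensystem ν m e γ B) :
    ∃ C : ℝ, 0 < C ∧ ∀ lam, 0 < lam → ∀ k,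
      ∑ v ∈ Finset.range k, wt γ lam v ≤ C * (1 + 1 / bw m lam) := by
  obtain ⟨c, hc, hc1, v0, hv0⟩ := E.exists_le_gamma
  refine ⟨v0 + 4 / c, by positivity, fun lam hlam k => ?_⟩
  set h := bw m lam with hh
  have hpos : 0 < h := bw_pos hlam
  have hterm : ∀ v, wt γ lam v ≤ (if v < v0 then 1 else 0)
      + 2 / c * (1 / (1 + (h * ((v : ℝ) + 1)) ^ 2)) := by
    intro v
    have hp : 0 ≤ 2 / c * (1 / (1 + (h * ((v : ℝ) + 1)) ^ 2)) := by positivity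
    by_cases hv : v < v0
    · rw [if_pos hv]
      linarith [E.wt_le_one hlam.le v]
    · rw [if_neg hv, zero_add]
      have h1 := hv0 v (not_lt.1 hv)
      set x : ℝ := h * ((v : ℝ) + 1) with hx
      have hx0 : 0 ≤ x := by positivity
      have hxm : x ^ (2 * m) = lam * ((v : ℝ) + 1) ^ (2 * m) := by
        rw [hx, mul_pow, hh, bw_pow hm hlam]
      have hx2 : 1 + x ^ 2 ≤ 2 * (1 + x ^ (2 * m)) := by
        rcases le_total x 1 with h' | h'
        · have : x ^ 2 ≤ 1 := pow_le_one₀ hx0 h'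
          have : 0 ≤ x ^ (2 * m) := by positivity
          linarith
        · have : x ^ 2 ≤ x ^ (2 * m) := pow_le_pow_right₀ h' (by omega)
          have : 0 ≤ x ^ (2 * m) := by positivity
          linarith
      have h3 : c * x ^ (2 * m) ≤ lam * γ v := by
        rw [hxm]
        calc c * (lam * ((v : ℝ) + 1) ^ (2 * m)) = lam * (c * ((v : ℝ) + 1) ^ (2 * m)) := by ring
          _ ≤ lam * γ v := by gcongr
      rw [wt, div_mul_div_comm, mul_one,
        div_le_div_iff₀ (by linarith [E.one_le hlam.le v]) (by positivity)]
      have : c * (1 + x ^ 2) ≤ c * (2 * (1 + x ^ (2 * m))) := by gcongr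
      linarith
  have hsum : ∑ v ∈ Finset.range k, (if v < v0 then (1 : ℝ) else 0) ≤ v0 := by
    rw [← Finset.sum_filter, Finset.sum_const, nsmul_eq_mul, mul_one]
    have : (Finset.range k).filter (· < v0) ⊆ Finset.range v0 := fun v hv => by
      simp only [Finset.mem_filter] at hv
      exact Finset.mem_range.2 hv.2
    have := Finset.card_le_card this
    rw [Finset.card_range] at this
    exact_mod_cast this
  calc ∑ v ∈ Finset.range k, wt γ lam v
      ≤ ∑ v ∈ Finset.range k, ((if v < v0 then (1 : ℝ) else 0)
        + 2 / c * (1 / (1 + (h * ((v : ℝ) + 1)) ^ 2))) := Finset.sum_le_sum fun v _ => hterm v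
    _ = ∑ v ∈ Finset.range k, (if v < v0 then (1 : ℝ) else 0)
        + 2 / c * ∑ v ∈ Finset.range k, (1 / (1 + (h * ((v : ℝ) + 1)) ^ 2)) := by
        rw [Finset.sum_add_distrib, Finset.mul_sum]
    _ ≤ v0 + 2 / c * (2 / h) := by
        gcongr
        exact sum_one_div_one_add_sq_le hpos k
    _ ≤ (v0 + 4 / c) * (1 + 1 / h) := by
        have h1 : 2 / c * (2 / h) = 4 / c * (1 / h) := by field_simp; norm_num
        rw [h1]
        have h2 : 0 ≤ 4 / c := by positivity
        have h3 : 0 ≤ (v0 : ℝ) * (1 / h) := by positivity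
        nlinarith

theorem summable_wt (hm : 1 ≤ m) (E : Eigensystem ν m e γ B) {lam : ℝ} (hlam : 0 < lam) :
    Summable (wt γ lam) := by
  obtain ⟨C, -, hC⟩ := E.exists_sum_wt_le hm
  exact summable_of_sum_range_le (fun v => (E.wt_pos hlam.le v).le) (hC lam hlam)

theorem tendsto_V_J_sub (E : Eigensystem ν m e γ B) {f : unitInterval → ℝ}
    (hf : f ∈ sobolev m) :
    Tendsto (fun k => V ν (f - ∑ v ∈ Finset.range k, V ν f (e v) • e v)
      (f - ∑ v ∈ Finset.range k, V ν f (e v) • e v)) atTop (𝓝 0) ∧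
    Tendsto (fun k => J m (f - ∑ v ∈ Finset.range k, V ν f (e v) • e v)
      (f - ∑ v ∈ Finset.range k, V ν f (e v) • e v)) atTop (𝓝 0) := by
  have h := (E.expand f hf).pow 2
  simp only [nrm_sq ν m zero_le_one, ip, one_mul, ne_eq, OfNat.ofNat_ne_zero, not_false_eq_true,
    zero_pow] at h
  exact ⟨squeeze_zero (fun _ => V_self_nonneg ν _)
      (fun _ => le_add_of_nonneg_right (J_self_nonneg m _)) h,
    squeeze_zero (fun _ => J_self_nonneg m _)
      (fun _ => le_add_of_nonneg_left (V_self_nonneg ν _)) h⟩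

/-- `∑ |c_v|` converges as soon as `∑ (1 + γ_v) c_v²` does. -/
theorem summable_abs (hm : 1 ≤ m) (E : Eigensystem ν m e γ B) {c : ℕ → ℝ}
    (hc : Summable fun v => (1 + γ v) * c v ^ 2) : Summable fun v => |c v| := by
  refine Summable.of_nonneg_of_le (fun _ => abs_nonneg _) (fun v => ?_)
    (hc.add (E.summable_wt hm zero_lt_one))
  have h1 := E.one_le zero_le_one v
  rw [one_mul] at h1
  rw [wt, one_mul]
  have h2 : 0 < 1 + γ v := by linarith
  have h3 : |c v| * (1 + γ v) ≤ ((1 + γ v) * |c v|) ^ 2 + 1 := by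
    nlinarith [sq_nonneg ((1 + γ v) * |c v| - 1 / 2)]
  rw [← sub_nonneg]
  have : (1 + γ v) * c v ^ 2 + 1 / (1 + γ v) - |c v|
      = (((1 + γ v) * |c v|) ^ 2 + 1 - |c v| * (1 + γ v)) / (1 + γ v) := by
    rw [mul_pow, sq_abs]; field_simp
  rw [this]
  exact div_nonneg (by linarith) h2.le

theorem summable_mul (hm : 1 ≤ m) (E : Eigensystem ν m e γ B) {c : ℕ → ℝ}
    (hc : Summable fun v => (1 + γ v) * c v ^ 2) (t : unitInterval) :
    Summable fun v => c v * e v t :=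
  Summable.of_norm_bounded ((E.summable_abs hm hc).mul_right B) fun v => by
    rw [Real.norm_eq_abs, abs_mul]
    exact mul_le_mul_of_nonneg_left (E.bound v t) (abs_nonneg _)

theorem abs_sum_le (hm : 1 ≤ m) (E : Eigensystem ν m e γ B) {c : ℕ → ℝ}
    (hc : Summable fun v => (1 + γ v) * c v ^ 2) (t : unitInterval) (k : ℕ) :
    |∑ v ∈ Finset.range k, c v * e v t| ≤ (∑' v, |c v|) * B := by
  calc |∑ v ∈ Finset.range k, c v * e v t| ≤ ∑ v ∈ Finset.range k, |c v| * B :=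
        (Finset.abs_sum_le_sum_abs _ _).trans (Finset.sum_le_sum fun v _ => by
          rw [abs_mul]
          exact mul_le_mul_of_nonneg_left (E.bound v t) (abs_nonneg _))
    _ ≤ (∑' v, |c v|) * B := by
        rw [← Finset.sum_mul]
        exact mul_le_mul_of_nonneg_right
          ((E.summable_abs hm hc).sum_le_tsum _ fun _ _ => abs_nonneg _) E.B_nonneg

theorem continuous_tsum (hm : 1 ≤ m) (E : Eigensystem ν m e γ B) {c : ℕ → ℝ}
    (hc : Summable fun v => (1 + γ v) * c v ^ 2) : Continuous fun t => ∑' v, c v * e v t := by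
  refine _root_.continuous_tsum
    (fun v => continuous_const.mul (continuous_of_mem_sobolev hm (E.mem v)))
    ((E.summable_abs hm hc).mul_right B) fun v t => ?_
  rw [Real.norm_eq_abs, abs_mul]
  exact mul_le_mul_of_nonneg_left (E.bound v t) (abs_nonneg _)

theorem tendsto_J_partial_aux (hm : 1 ≤ m) (E : Eigensystem ν m e γ B) {f g : unitInterval → ℝ}
    (hf : f ∈ sobolev m) (hg : g ∈ sobolev m) :
    Tendsto (fun k => ∑ v ∈ Finset.range k, V ν f (e v) * J m (e v) g) atTop
      (𝓝 (J m f g)) := by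
  have h0 : Tendsto (fun k => J m (f - ∑ v ∈ Finset.range k, V ν f (e v) • e v) g) atTop (𝓝 0) :=
    tendsto_zero_of_sq_le (E.tendsto_V_J_sub hf).2 fun k =>
      J_sq_le hm (sub_mem_sobolev hm hf (sum_smul_mem_sobolev hm _ _ E.mem)) hg
  have h1 := h0.const_sub (J m f g)
  rw [sub_zero] at h1
  refine h1.congr fun k => ?_
  rw [J_sub_left hm hf (sum_smul_mem_sobolev hm _ _ E.mem) hg, J_sum_left hm _ _ E.mem hg,
    sub_sub_cancel]

theorem J_eigen (hm : 1 ≤ m) (E : Eigensystem ν m e γ B) {f : unitInterval → ℝ}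
    (hf : f ∈ sobolev m) (u : ℕ) : J m f (e u) = γ u * V ν f (e u) := by
  refine tendsto_nhds_unique (E.tendsto_J_partial_aux hm hf (E.mem u)) ?_
  refine tendsto_const_nhds.congr' ?_
  filter_upwards [eventually_gt_atTop u] with k hk
  rw [Finset.sum_eq_single u]
  · rw [E.J_eq, if_pos rfl, mul_comm]
  · intro v _ hv
    rw [E.J_eq, if_neg hv, mul_zero]
  · intro h
    exact absurd (Finset.mem_range.2 hk) h

theorem tendsto_J_partial (hm : 1 ≤ m) (E : Eigensystem ν m e γ B) {f g : unitInterval → ℝ}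
    (hf : f ∈ sobolev m) (hg : g ∈ sobolev m) :
    Tendsto (fun k => ∑ v ∈ Finset.range k, γ v * (V ν f (e v) * V ν g (e v))) atTop
      (𝓝 (J m f g)) := by
  refine (E.tendsto_J_partial_aux hm hf hg).congr fun k => Finset.sum_congr rfl fun v _ => ?_
  rw [J_comm, E.J_eigen hm hg]; ring

theorem sum_gamma_le_J (hm : 1 ≤ m) (E : Eigensystem ν m e γ B)
    {f : unitInterval → ℝ} (hf : f ∈ sobolev m) (s : Finset ℕ) :
    ∑ v ∈ s, γ v * V ν f (e v) ^ 2 ≤ J m f f := by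
  have h := E.tendsto_J_partial hm hf hf
  simp only [← sq] at h
  have hn : ∀ v, 0 ≤ γ v * V ν f (e v) ^ 2 := fun v =>
    mul_nonneg (E.gamma_nonneg v) (sq_nonneg _)
  obtain ⟨k, hk⟩ := s.exists_nat_subset_range
  refine (Finset.sum_le_sum_of_subset_of_nonneg hk fun v _ _ => hn v).trans ?_
  refine Monotone.ge_of_tendsto (monotone_nat_of_le_succ fun k => ?_) h k
  rw [Finset.sum_range_succ]
  exact le_add_of_nonneg_right (hn k)

variable [IsFiniteMeasure ν]

theorem tendsto_V_partial (hm : 1 ≤ m) (E : Eigensystem ν m e γ B) {f g : unitInterval → ℝ}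
    (hf : f ∈ sobolev m) (hg : g ∈ sobolev m) :
    Tendsto (fun k => ∑ v ∈ Finset.range k, V ν f (e v) * V ν g (e v)) atTop
      (𝓝 (V ν f g)) := by
  have h0 : Tendsto (fun k => V ν (f - ∑ v ∈ Finset.range k, V ν f (e v) • e v) g) atTop (𝓝 0) :=
    tendsto_zero_of_sq_le (E.tendsto_V_J_sub hf).1 fun k =>
      V_sq_le hm (sub_mem_sobolev hm hf (sum_smul_mem_sobolev hm _ _ E.mem)) hg
  have h1 := h0.const_sub (V ν f g)
  rw [sub_zero] at h1
  refine h1.congr fun k => ?_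
  rw [V_sub_left hm hf (sum_smul_mem_sobolev hm _ _ E.mem) hg, V_sum_left hm _ _ E.mem hg,
    sub_sub_cancel]
  exact Finset.sum_congr rfl fun v _ => by rw [V_comm ν g]

/-- Parseval's identity for `ip`. -/
theorem tendsto_ip_partial (hm : 1 ≤ m) (E : Eigensystem ν m e γ B) (lam : ℝ)
    {f g : unitInterval → ℝ} (hf : f ∈ sobolev m) (hg : g ∈ sobolev m) :
    Tendsto (fun k => ∑ v ∈ Finset.range k, (1 + lam * γ v) * (V ν f (e v) * V ν g (e v))) atTop
      (𝓝 (ip ν m lam f g)) := by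
  refine ((E.tendsto_V_partial hm hf hg).add
    ((E.tendsto_J_partial hm hf hg).const_mul lam)).congr fun k => ?_
  rw [Finset.mul_sum, ← Finset.sum_add_distrib]
  exact Finset.sum_congr rfl fun v _ => by ring

theorem sum_le_nrm_sq (hm : 1 ≤ m) (E : Eigensystem ν m e γ B) {lam : ℝ} (hlam : 0 ≤ lam)
    {f : unitInterval → ℝ} (hf : f ∈ sobolev m) (k : ℕ) :
    ∑ v ∈ Finset.range k, (1 + lam * γ v) * V ν f (e v) ^ 2 ≤ nrm ν m lam f ^ 2 := by
  rw [nrm_sq ν m hlam]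
  have h := E.tendsto_ip_partial hm lam hf hf
  simp only [← sq] at h
  refine Monotone.ge_of_tendsto (monotone_nat_of_le_succ fun k => ?_) h k
  rw [Finset.sum_range_succ]
  have := E.one_le hlam k
  exact le_add_of_nonneg_right (by positivity)

theorem summable_sq (hm : 1 ≤ m) (E : Eigensystem ν m e γ B)
    {f : unitInterval → ℝ} (hf : f ∈ sobolev m) :
    Summable fun v => (1 + γ v) * V ν f (e v) ^ 2 := by
  have h := E.sum_le_nrm_sq hm zero_le_one hf
  simp only [one_mul] at h
  exact summable_of_sum_range_le
    (fun v => mul_nonneg (by linarith [E.gamma_nonneg v]) (sq_nonneg _)) h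

/-- The expansion converges at every point. The partial sums converge uniformly, and the limit is
a continuous function that agrees with `f` almost everywhere for `ν`. -/
theorem hasSum_eval (hm : 1 ≤ m) [ν.IsOpenPosMeasure] (E : Eigensystem ν m e γ B)
    {f : unitInterval → ℝ} (hf : f ∈ sobolev m) (t : unitInterval) :
    HasSum (fun v => V ν f (e v) * e v t) (f t) := by
  have hc := E.summable_sq hm hf
  have hfc := continuous_of_mem_sobolev hm hf
  have hgc := E.continuous_tsum hm hc
  suffices h : (fun t => ∑' v, V ν f (e v) * e v t) = f by
    have h1 := (E.summable_mul hm hc t).hasSum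
    rwa [congrFun h t] at h1
  refine (Continuous.ae_eq_iff_eq ν hgc hfc).1 ?_
  obtain ⟨A, hA⟩ : ∃ A, ∀ t, |f t| ≤ A := by
    obtain ⟨A, hA⟩ := isCompact_univ.exists_bound_of_continuousOn hfc.continuousOn
    exact ⟨A, fun t => hA t (Set.mem_univ t)⟩
  have hpt : ∀ t, Tendsto (fun k => ∑ v ∈ Finset.range k, V ν f (e v) * e v t) atTop
      (𝓝 (∑' v, V ν f (e v) * e v t)) := fun t =>
    (E.summable_mul hm hc t).hasSum.tendsto_sum_nat
  have happ : ∀ k t, (f - ∑ v ∈ Finset.range k, V ν f (e v) • e v) t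
      = f t - ∑ v ∈ Finset.range k, V ν f (e v) * e v t := fun k t => by simp
  have hlim := tendsto_integral_of_dominated_convergence (μ := ν)
    (F := fun k t => (f - ∑ v ∈ Finset.range k, V ν f (e v) • e v) t *
      (f - ∑ v ∈ Finset.range k, V ν f (e v) • e v) t)
    (f := fun t => (f t - ∑' v, V ν f (e v) * e v t) * (f t - ∑' v, V ν f (e v) * e v t))
    (fun _ => (A + (∑' v, |V ν f (e v)|) * B) * (A + (∑' v, |V ν f (e v)|) * B))
    (fun k => (integrable_mul_of_mem_sobolev hm ν
      (sub_mem_sobolev hm hf (sum_smul_mem_sobolev hm _ _ E.mem))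
      (sub_mem_sobolev hm hf (sum_smul_mem_sobolev hm _ _ E.mem))).aestronglyMeasurable)
    (integrable_const _)
    (fun k => Eventually.of_forall fun t => by
      have : |f t - ∑ v ∈ Finset.range k, V ν f (e v) * e v t|
          ≤ A + (∑' v, |V ν f (e v)|) * B :=
        (abs_sub _ _).trans (add_le_add (hA t) (E.abs_sum_le hm hc t k))
      rw [happ, Real.norm_eq_abs, abs_mul]
      exact mul_le_mul this this (abs_nonneg _) ((abs_nonneg _).trans this))
    (Eventually.of_forall fun t => by
      simp only [happ]
      exact ((hpt t).const_sub _).mul ((hpt t).const_sub _))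
  have h0 := tendsto_nhds_unique hlim (E.tendsto_V_J_sub hf).1
  have hi : Integrable (fun t => (f t - ∑' v, V ν f (e v) * e v t) *
      (f t - ∑' v, V ν f (e v) * e v t)) ν :=
    ((hfc.sub hgc).mul (hfc.sub hgc)).integrable_of_hasCompactSupport
      (HasCompactSupport.of_compactSpace _)
  rw [integral_eq_zero_iff_of_nonneg (fun _ => mul_self_nonneg _) hi] at h0
  filter_upwards [h0] with t ht
  exact (sub_eq_zero.1 (mul_self_eq_zero.1 ht)).symm

/-- The synthesis of an element of `H^m` from its coefficients. -/
theorem exists_mem_sobolev (hm : 1 ≤ m) (E : Eigensystem ν m e γ B) {c : ℕ → ℝ}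
    (hc : Summable fun v => (1 + γ v) * c v ^ 2) :
    (fun t => ∑' v, c v * e v t) ∈ sobolev m ∧
      ∀ v, V ν (fun t => ∑' v, c v * e v t) (e v) = c v := by
  have hlim : ∀ t, Tendsto (fun k => (∑ v ∈ Finset.range k, c v • e v) t) atTop
      (𝓝 (∑' v, c v * e v t)) := fun t => by
    simpa using (E.summable_mul hm hc t).hasSum.tendsto_sum_nat
  constructor
  · refine mem_sobolev_of_tendsto hm (fun k => sum_smul_mem_sobolev hm (Finset.range k) c E.mem)
      hlim fun ε hε => ?_
    have hJs : ∀ s : Finset ℕ, J m (∑ v ∈ s, c v • e v) (∑ v ∈ s, c v • e v)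
        = ∑ v ∈ s, γ v * c v ^ 2 := by
      intro s
      rw [J_sum_left hm _ _ E.mem (sum_smul_mem_sobolev hm _ _ E.mem)]
      refine Finset.sum_congr rfl fun v hv => ?_
      rw [J_comm, J_sum_left hm _ _ E.mem (E.mem v), Finset.sum_eq_single v]
      · rw [E.J_eq, if_pos rfl]; ring
      · intro u _ hu
        rw [E.J_eq, if_neg hu, mul_zero]
      · intro h; exact absurd hv h
    have hs : Summable fun v => γ v * c v ^ 2 := hc.of_nonneg_of_le
      (fun v => mul_nonneg (E.gamma_nonneg v) (sq_nonneg _))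
      (fun v => mul_le_mul_of_nonneg_right (by linarith) (sq_nonneg _))
    obtain ⟨K, hK⟩ := Metric.cauchySeq_iff.1 hs.hasSum.tendsto_sum_nat.cauchySeq ε hε
    refine ⟨K, ?_⟩
    have hle : ∀ k l, l ≤ k → K ≤ l →
        J m (∑ v ∈ Finset.range k, c v • e v - ∑ v ∈ Finset.range l, c v • e v)
          (∑ v ∈ Finset.range k, c v • e v - ∑ v ∈ Finset.range l, c v • e v) < ε := by
      intro k l hlk hl
      rw [← Finset.sum_Ico_eq_sub _ hlk, hJs, Finset.sum_Ico_eq_sub _ hlk]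
      exact (le_abs_self _).trans_lt (hK k (hl.trans hlk) l hl)
    intro k hk l hl
    rcases le_total l k with h | h
    · exact hle k l h hl
    · have h1 := hle l k h hk
      rw [← neg_sub, ← neg_one_smul ℝ]
      have hmem := sub_mem_sobolev hm (sum_smul_mem_sobolev hm (Finset.range l) c E.mem)
        (sum_smul_mem_sobolev hm (Finset.range k) c E.mem)
      rw [J_smul_left hm _ hmem, J_comm, J_smul_left hm _ hmem]
      simpa using h1
  · intro u
    have hl := tendsto_integral_of_dominated_convergence (μ := ν)
      (F := fun k t => (∑ v ∈ Finset.range k, c v • e v) t * e u t)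
      (f := fun t => (∑' v, c v * e v t) * e u t)
      (fun _ => (∑' v, |c v|) * B * B)
      (fun k => (integrable_mul_of_mem_sobolev hm ν
        (sum_smul_mem_sobolev hm _ _ E.mem) (E.mem u)).aestronglyMeasurable)
      (integrable_const _)
      (fun k => Eventually.of_forall fun t => by
        have h1 := E.abs_sum_le hm hc t k
        rw [Real.norm_eq_abs, abs_mul]
        refine mul_le_mul ?_ (E.bound u t) (abs_nonneg _) ((abs_nonneg _).trans h1)
        simpa using h1)
      (Eventually.of_forall fun t => (hlim t).mul_const _)
    refine tendsto_nhds_unique hl (tendsto_const_nhds.congr' ?_)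
    filter_upwards [eventually_gt_atTop u] with k hk
    change c u = V ν (∑ v ∈ Finset.range k, c v • e v) (e u)
    rw [V_sum_left hm _ _ E.mem (E.mem u), Finset.sum_eq_single u]
    · rw [E.V_eq, if_pos rfl, mul_one]
    · intro v _ hv
      rw [E.V_eq, if_neg hv, mul_zero]
    · intro h
      exact absurd (Finset.mem_range.2 hk) h

end Eigensystem

/-! ### Representers -/

namespace Eigensystem

variable {ν : Measure unitInterval} [IsFiniteMeasure ν] {m : ℕ} {e : ℕ → unitInterval → ℝ}
  {γ : ℕ → ℝ} {B : ℝ}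

theorem exists_represents_eval (hm : 1 ≤ m) [ν.IsOpenPosMeasure] (E : Eigensystem ν m e γ B)
    {lam : ℝ} (hlam : 0 < lam) (t : unitInterval) :
    ∃ w, Represents ν m lam (fun g => g t) w := by
  have hc : Summable fun v => (1 + γ v) * (wt γ lam v * e v t) ^ 2 := by
    refine Summable.of_nonneg_of_le
      (fun v => mul_nonneg (by linarith [E.gamma_nonneg v]) (sq_nonneg _)) (fun v => ?_)
      ((E.summable_wt hm hlam).mul_left (B ^ 2 * max 1 (1 / lam)))
    have h1 := E.one_le hlam.le v
    have h2 : (e v t) ^ 2 ≤ B ^ 2 := sq_le_sq' (abs_le.1 (E.bound v t)).1 (abs_le.1 (E.bound v t)).2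
    have h3 : (1 + γ v) * wt γ lam v ≤ max 1 (1 / lam) := by
      rw [wt, mul_one_div, div_le_iff₀ (by linarith)]
      have h4 : 1 / lam * (lam * γ v) = γ v := by field_simp
      have h5 : 1 / lam * (lam * γ v) ≤ max 1 (1 / lam) * (lam * γ v) :=
        mul_le_mul_of_nonneg_right (le_max_right _ _) (by linarith)
      have h6 : 1 ≤ max 1 (1 / lam) := le_max_left _ _
      nlinarith
    have hw := E.wt_pos hlam.le v
    have h0 : 0 ≤ (1 + γ v) * wt γ lam v := mul_nonneg (by linarith [E.gamma_nonneg v]) hw.le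
    calc (1 + γ v) * (wt γ lam v * e v t) ^ 2
        = (e v t) ^ 2 * ((1 + γ v) * wt γ lam v) * wt γ lam v := by ring
      _ ≤ B ^ 2 * max 1 (1 / lam) * wt γ lam v := by gcongr
  obtain ⟨h1, h2⟩ := E.exists_mem_sobolev hm hc
  refine ⟨_, h1, fun g hg => ?_⟩
  refine tendsto_nhds_unique (E.tendsto_ip_partial hm lam h1 hg) ?_
  refine ((E.hasSum_eval hm hg t).tendsto_sum_nat).congr fun k => Finset.sum_congr rfl fun v _ => ?_
  have h3 : (1 + lam * γ v) * wt γ lam v = 1 :=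
    mul_one_div_cancel (by linarith [E.one_le hlam.le v])
  rw [h2, show (1 + lam * γ v) * (wt γ lam v * e v t * V ν g (e v))
    = (1 + lam * γ v) * wt γ lam v * (V ν g (e v) * e v t) by ring, h3, one_mul]

theorem exists_represents_J (hm : 1 ≤ m) (E : Eigensystem ν m e γ B)
    {lam : ℝ} (hlam : 0 < lam) {f : unitInterval → ℝ} (hf : f ∈ sobolev m) :
    ∃ w, Represents ν m lam (fun g => lam * J m f g) w := by
  have hc : Summable fun v => (1 + γ v) * (wt γ lam v * (lam * γ v * V ν f (e v))) ^ 2 := by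
    refine Summable.of_nonneg_of_le
      (fun v => mul_nonneg (by linarith [E.gamma_nonneg v]) (sq_nonneg _)) (fun v => ?_)
      (E.summable_sq hm hf)
    have h1 := E.one_le hlam.le v
    have h2 : wt γ lam v * (lam * γ v) ≤ 1 := by
      rw [wt, one_div_mul_eq_div, div_le_one (by linarith)]; linarith
    have h3 : 0 ≤ wt γ lam v * (lam * γ v) :=
      mul_nonneg (E.wt_pos hlam.le v).le (by linarith)
    have h4 : (wt γ lam v * (lam * γ v)) ^ 2 ≤ 1 := pow_le_one₀ h3 h2
    have h5 := E.gamma_nonneg v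
    calc (1 + γ v) * (wt γ lam v * (lam * γ v * V ν f (e v))) ^ 2
        = (1 + γ v) * ((wt γ lam v * (lam * γ v)) ^ 2 * V ν f (e v) ^ 2) := by ring
      _ ≤ (1 + γ v) * (1 * V ν f (e v) ^ 2) := by gcongr
      _ = _ := by rw [one_mul]
  obtain ⟨h1, h2⟩ := E.exists_mem_sobolev hm hc
  refine ⟨_, h1, fun g hg => ?_⟩
  refine tendsto_nhds_unique (E.tendsto_ip_partial hm lam h1 hg) ?_
  refine ((E.tendsto_J_partial hm hf hg).const_mul lam).congr fun k => ?_
  rw [Finset.mul_sum]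
  refine Finset.sum_congr rfl fun v _ => ?_
  have h3 : (1 + lam * γ v) * wt γ lam v = 1 :=
    mul_one_div_cancel (by linarith [E.one_le hlam.le v])
  rw [h2, show (1 + lam * γ v) * (wt γ lam v * (lam * γ v * V ν f (e v)) * V ν g (e v))
    = (1 + lam * γ v) * wt γ lam v * (lam * (γ v * (V ν f (e v) * V ν g (e v)))) by ring, h3,
    one_mul]

theorem represents_kernelAt (hm : 1 ≤ m) [ν.IsOpenPosMeasure] (E : Eigensystem ν m e γ B)
    {lam : ℝ} (hlam : 0 < lam) (t : unitInterval) :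
    Represents ν m lam (fun g => g t) (kernelAt ν m lam t) :=
  Classical.epsilon_spec (E.exists_represents_eval hm hlam t)

theorem represents_W (hm : 1 ≤ m) (E : Eigensystem ν m e γ B)
    {lam : ℝ} (hlam : 0 < lam) {f : unitInterval → ℝ} (hf : f ∈ sobolev m) :
    Represents ν m lam (fun g => lam * J m f g) (W ν m lam f) :=
  Classical.epsilon_spec (E.exists_represents_J hm hlam hf)

/-! ### A Sobolev inequality -/

/-- Finitely many point evaluations determine the first `K` coefficients of a function spanned by
the first `K` eigenfunctions, because these are linearly independent. -/
theorem exists_dual_points (hm : 1 ≤ m) (E : Eigensystem ν m e γ B) (K : ℕ) :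
    ∃ a : Fin K → unitInterval →₀ ℝ, ∀ u v : Fin K,
      ((a u).sum fun t x => x * e v t) = if u = v then 1 else 0 := by
  let ev : unitInterval → (Fin K → ℝ) := fun t v => e v t
  have hspan : Submodule.span ℝ (Set.range ev) = ⊤ := by
    by_contra hne
    obtain ⟨φ, hφ0, hφ⟩ := Submodule.exists_le_ker_of_lt_top _ (lt_top_iff_ne_top.2 hne)
    refine hφ0 (LinearMap.pi_ext' fun u => LinearMap.ext_ring ?_)
    have hz : (∑ v : Fin K, φ (Pi.single v 1) • e v) = 0 := by
      funext t
      have h1 : φ (ev t) = 0 := hφ (Submodule.subset_span ⟨t, rfl⟩)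
      rw [LinearMap.pi_apply_eq_sum_univ φ (ev t)] at h1
      have hs : ∀ x : Fin K, (fun j => if x = j then (1 : ℝ) else 0) = Pi.single x 1 := fun x => by
        funext j
        simp [Pi.single_apply, eq_comm]
      simp only [hs, ev, smul_eq_mul] at h1
      rw [Finset.sum_apply, Pi.zero_apply, ← h1]
      exact Finset.sum_congr rfl fun v _ => mul_comm _ _
    have h2 := V_sum_left (ν := ν) hm Finset.univ (fun v : Fin K => φ (Pi.single v 1))
      (fun v => E.mem v) (E.mem u)
    rw [hz, Finset.sum_eq_single u, E.V_eq, if_pos rfl, mul_one] at h2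
    · simpa [V] using h2.symm
    · intro v _ hv
      rw [E.V_eq, if_neg (fun h => hv (Fin.ext h)), mul_zero]
    · simp
  have hmem : ∀ u : Fin K, Pi.single u (1 : ℝ) ∈ Submodule.span ℝ (Set.range ev) := fun u => by
    rw [hspan]; trivial
  choose a ha using fun u => (Finsupp.mem_span_range_iff_exists_finsupp.1 (hmem u))
  refine ⟨a, fun u v => ?_⟩
  have h := congrFun (ha u) v
  rw [Finsupp.sum, Finset.sum_apply] at h
  simpa [Finsupp.sum, ev, Pi.single_apply, eq_comm] using h

/-- A Sobolev inequality: the supremum norm on `H^m` is controlled by `J` and finitely many point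
values. High-frequency parts are controlled by `J`, and the remaining coefficients are recovered
from point values. -/
theorem exists_sobolev_ineq (hm : 1 ≤ m) [ν.IsOpenPosMeasure] (E : Eigensystem ν m e γ B) :
    ∃ (S : Finset unitInterval) (C : ℝ), 0 ≤ C ∧ ∀ f ∈ sobolev m, ∀ t,
      f t ^ 2 ≤ C * (∑ p ∈ S, f p ^ 2 + J m f f) := by
  classical
  obtain ⟨c, hc, hc1, v0, hv0⟩ := E.exists_le_gamma
  obtain ⟨K1, hK1⟩ := exists_nat_gt (1 / c)
  set K := max v0 K1 with hK
  have hγ1 : ∀ v ≥ K, 1 ≤ γ v := by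
    intro v hv
    refine le_trans ?_ (hv0 v ((le_max_left _ _).trans hv))
    have h1 : (K1 : ℝ) ≤ v := by exact_mod_cast (le_max_right _ _).trans hv
    have h2 : (v : ℝ) + 1 ≤ ((v : ℝ) + 1) ^ (2 * m) :=
      le_self_pow₀ (by linarith [Nat.cast_nonneg (α := ℝ) v]) (by omega)
    have h3 : 1 / c ≤ ((v : ℝ) + 1) ^ (2 * m) := by linarith
    rwa [div_le_iff₀' hc] at h3
  set G := ∑' v, wt γ 1 v
  have hG0 : 0 ≤ G := tsum_nonneg fun v => (E.wt_pos zero_le_one v).le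
  have htail : ∀ f ∈ sobolev m, ∀ t,
      |f t - ∑ v ∈ Finset.range K, V ν f (e v) * e v t| ≤ Real.sqrt (2 * G * B ^ 2 * J m f f) := by
    intro f hf t
    have hlim : Tendsto (fun k => |∑ v ∈ Finset.range k, V ν f (e v) * e v t
        - ∑ v ∈ Finset.range K, V ν f (e v) * e v t|) atTop
        (𝓝 |f t - ∑ v ∈ Finset.range K, V ν f (e v) * e v t|) :=
      ((E.hasSum_eval hm hf t).tendsto_sum_nat.sub_const _).abs
    refine le_of_tendsto hlim ?_
    filter_upwards [eventually_ge_atTop K] with k hk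
    rw [← Finset.sum_Ico_eq_sub _ hk]
    refine Real.abs_le_sqrt ?_
    have hg : ∀ v ∈ Finset.Ico K k, 1 ≤ γ v := fun v hv => hγ1 v (Finset.mem_Ico.1 hv).1
    calc (∑ v ∈ Finset.Ico K k, V ν f (e v) * e v t) ^ 2
        ≤ (∑ v ∈ Finset.Ico K k, γ v * V ν f (e v) ^ 2)
          * ∑ v ∈ Finset.Ico K k, 2 * wt γ 1 v * B ^ 2 := by
          refine Finset.sum_sq_le_sum_mul_sum_of_sq_le_mul _ (fun v hv => ?_) (fun v hv => ?_)
            fun v hv => ?_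
          · exact mul_nonneg (E.gamma_nonneg v) (sq_nonneg _)
          · have := (E.wt_pos zero_le_one v).le
            positivity
          · have h2 : (e v t) ^ 2 ≤ B ^ 2 :=
              sq_le_sq' (abs_le.1 (E.bound v t)).1 (abs_le.1 (E.bound v t)).2
            have h3 := hg v hv
            have h4 : 1 ≤ γ v * (2 * wt γ 1 v) := by
              rw [wt, one_mul, mul_one_div, mul_div_assoc', le_div_iff₀ (by linarith)]
              linarith
            calc (V ν f (e v) * e v t) ^ 2 = 1 * (V ν f (e v) ^ 2 * (e v t) ^ 2) := by ring
              _ ≤ γ v * (2 * wt γ 1 v) * (V ν f (e v) ^ 2 * B ^ 2) := by gcongr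
              _ = _ := by ring
      _ ≤ J m f f * (2 * G * B ^ 2) := by
          refine mul_le_mul (E.sum_gamma_le_J hm hf _) ?_
            (Finset.sum_nonneg fun v _ => ?_) (J_self_nonneg m f)
          · rw [← Finset.sum_mul, ← Finset.mul_sum]
            gcongr
            exact (E.summable_wt hm zero_lt_one).sum_le_tsum _
              fun v _ => (E.wt_pos zero_le_one v).le
          · have := (E.wt_pos zero_le_one v).le
            positivity
      _ = 2 * G * B ^ 2 * J m f f := by ring
  obtain ⟨a, ha⟩ := E.exists_dual_points hm K
  set S : Finset unitInterval := Finset.univ.biUnion fun u => (a u).support with hS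
  have ha' : ∀ u v : Fin K, ∑ p ∈ S, a u p * e v p = if u = v then 1 else 0 := fun u v => by
    rw [← ha u v, Finsupp.sum]
    refine (Finset.sum_subset (Finset.subset_biUnion_of_mem (fun u => (a u).support)
      (Finset.mem_univ u)) fun p _ hp => ?_).symm
    rw [Finsupp.notMem_support_iff.1 hp, zero_mul]
  set A := ∑ u : Fin K, ∑ p ∈ S, |a u p| with hA
  have hA0 : 0 ≤ A := Finset.sum_nonneg fun _ _ => Finset.sum_nonneg fun _ _ => abs_nonneg _
  have hB := E.B_nonneg
  have hmain : ∀ f ∈ sobolev m, ∀ t, |f t| ≤ A * B * (∑ p ∈ S, |f p|)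
      + (A * B + 1) * Real.sqrt (2 * G * B ^ 2 * J m f f) := by
    intro f hf t
    set s := Real.sqrt (2 * G * B ^ 2 * J m f f) with hs
    have hs0 : 0 ≤ s := Real.sqrt_nonneg _
    have hcoef : ∀ u : Fin K, V ν f (e u)
        = ∑ p ∈ S, a u p * ∑ v ∈ Finset.range K, V ν f (e v) * e v p := by
      intro u
      simp only [Finset.mul_sum, ← Fin.sum_univ_eq_sum_range
        (fun v => a u _ * (V ν f (e v) * e v _))]
      rw [Finset.sum_comm]
      have : ∀ v : Fin K, ∑ p ∈ S, a u p * (V ν f (e v) * e v p)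
          = V ν f (e v) * if u = v then 1 else 0 := fun v => by
        rw [← ha', Finset.mul_sum]
        exact Finset.sum_congr rfl fun p _ => by ring
      simp [this]
    have hhead : ∀ p ∈ S, |∑ v ∈ Finset.range K, V ν f (e v) * e v p| ≤ ∑ p ∈ S, |f p| + s := by
      intro p hp
      have h1 := htail f hf p
      have h2 : |f p| ≤ ∑ p ∈ S, |f p| :=
        Finset.single_le_sum (f := fun p => |f p|) (fun _ _ => abs_nonneg _) hp
      have h3 := abs_sub_abs_le_abs_sub (∑ v ∈ Finset.range K, V ν f (e v) * e v p) (f p)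
      rw [abs_sub_comm] at h3
      linarith
    have hcoef' : ∑ u : Fin K, |V ν f (e u)| ≤ A * (∑ p ∈ S, |f p| + s) := by
      rw [hA, Finset.sum_mul]
      refine Finset.sum_le_sum fun u _ => ?_
      rw [hcoef u, Finset.sum_mul]
      refine (Finset.abs_sum_le_sum_abs _ _).trans (Finset.sum_le_sum fun p hp => ?_)
      rw [abs_mul]
      exact mul_le_mul_of_nonneg_left (hhead p hp) (abs_nonneg _)
    have h1 : |∑ v ∈ Finset.range K, V ν f (e v) * e v t| ≤ A * (∑ p ∈ S, |f p| + s) * B := by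
      rw [← Fin.sum_univ_eq_sum_range (fun v => V ν f (e v) * e v t)]
      refine (Finset.abs_sum_le_sum_abs _ _).trans ?_
      refine le_trans ?_ (mul_le_mul_of_nonneg_right hcoef' hB)
      rw [Finset.sum_mul]
      refine Finset.sum_le_sum fun u _ => ?_
      rw [abs_mul]
      exact mul_le_mul_of_nonneg_left (E.bound _ t) (abs_nonneg _)
    have h2 := htail f hf t
    have h3 := abs_sub_abs_le_abs_sub (f t) (∑ v ∈ Finset.range K, V ν f (e v) * e v t)
    nlinarith
  refine ⟨S, 2 * (A * B) ^ 2 * S.card + 2 * (A * B + 1) ^ 2 * (2 * G * B ^ 2), by positivity,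
    fun f hf t => ?_⟩
  have h := hmain f hf t
  have hJ := J_self_nonneg m f
  have hX0 : 0 ≤ ∑ p ∈ S, |f p| := Finset.sum_nonneg fun _ _ => abs_nonneg _
  have hX : (∑ p ∈ S, |f p|) ^ 2 ≤ S.card * ∑ p ∈ S, f p ^ 2 := by
    simpa using sq_sum_le_card_mul_sum_sq (s := S) (f := fun p => |f p|)
  have hY : Real.sqrt (2 * G * B ^ 2 * J m f f) ^ 2 = 2 * G * B ^ 2 * J m f f :=
    Real.sq_sqrt (by positivity)
  set x := ∑ p ∈ S, |f p|
  set y := Real.sqrt (2 * G * B ^ 2 * J m f f)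
  have hQ : 0 ≤ ∑ p ∈ S, f p ^ 2 := Finset.sum_nonneg fun _ _ => sq_nonneg _
  have h1 : f t ^ 2 ≤ (A * B * x + (A * B + 1) * y) ^ 2 := by
    rw [← sq_abs (f t)]
    exact pow_le_pow_left₀ (abs_nonneg _) h 2
  have h2 : (A * B * x + (A * B + 1) * y) ^ 2
      ≤ 2 * (A * B) ^ 2 * x ^ 2 + 2 * (A * B + 1) ^ 2 * y ^ 2 := by
    nlinarith [sq_nonneg (A * B * x - (A * B + 1) * y)]
  have h3 : 2 * (A * B) ^ 2 * x ^ 2 ≤ 2 * (A * B) ^ 2 * (S.card * ∑ p ∈ S, f p ^ 2) := by gcongr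
  have h4 : 0 ≤ 2 * (A * B) ^ 2 * S.card * J m f f := by positivity
  have h5 : 0 ≤ 2 * (A * B + 1) ^ 2 * (2 * G * B ^ 2) * ∑ p ∈ S, f p ^ 2 := by positivity
  rw [hY] at h2
  nlinarith

/-! ### The deterministic inequality behind the representation -/

/-- A bilinear form with matrix `Δ` in the eigenfunctions is bounded in the norm `nrm ν m lam` by
the Hilbert–Schmidt norm of `Δ` with weights `wt`. -/
theorem abs_sum_sum_le (hm : 1 ≤ m) (E : Eigensystem ν m e γ B) {lam : ℝ} (hlam : 0 ≤ lam)
    {Δ : ℕ → ℕ → ℝ} {δ : ℝ} (hδ : 0 ≤ δ)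
    (hΔ : ∀ k, ∑ u ∈ Finset.range k, ∑ v ∈ Finset.range k,
      Δ u v ^ 2 * (wt γ lam u * wt γ lam v) ≤ δ ^ 2)
    {f g : unitInterval → ℝ} (hf : f ∈ sobolev m) (hg : g ∈ sobolev m) (k : ℕ) :
    |∑ u ∈ Finset.range k, ∑ v ∈ Finset.range k, V ν f (e u) * V ν g (e v) * Δ u v|
      ≤ δ * (nrm ν m lam f * nrm ν m lam g) := by
  have hn : 0 ≤ nrm ν m lam f * nrm ν m lam g := mul_nonneg (Real.sqrt_nonneg _) (Real.sqrt_nonneg _)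
  refine abs_le_of_sq_le_sq ?_ (mul_nonneg hδ hn)
  rw [← Finset.sum_product', mul_pow]
  calc (∑ x ∈ Finset.range k ×ˢ Finset.range k, V ν f (e x.1) * V ν g (e x.2) * Δ x.1 x.2) ^ 2
      ≤ (∑ x ∈ Finset.range k ×ˢ Finset.range k, Δ x.1 x.2 ^ 2 * (wt γ lam x.1 * wt γ lam x.2))
        * ∑ x ∈ Finset.range k ×ˢ Finset.range k, ((1 + lam * γ x.1) * V ν f (e x.1) ^ 2) *
          ((1 + lam * γ x.2) * V ν g (e x.2) ^ 2) := by
        refine Finset.sum_sq_le_sum_mul_sum_of_sq_le_mul _ (fun x _ => ?_) (fun x _ => ?_)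
          fun x _ => ?_
        · exact mul_nonneg (sq_nonneg _)
            (mul_nonneg (E.wt_pos hlam _).le (E.wt_pos hlam _).le)
        · have h1 := E.one_le hlam x.1
          have h2 := E.one_le hlam x.2
          positivity
        · have h1 : wt γ lam x.1 * (1 + lam * γ x.1) = 1 :=
            one_div_mul_cancel (by linarith [E.one_le hlam x.1])
          have h2 : wt γ lam x.2 * (1 + lam * γ x.2) = 1 :=
            one_div_mul_cancel (by linarith [E.one_le hlam x.2])
          rw [show Δ x.1 x.2 ^ 2 * (wt γ lam x.1 * wt γ lam x.2) *
            (((1 + lam * γ x.1) * V ν f (e x.1) ^ 2) * ((1 + lam * γ x.2) * V ν g (e x.2) ^ 2))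
            = Δ x.1 x.2 ^ 2 * (wt γ lam x.1 * (1 + lam * γ x.1)) *
              (wt γ lam x.2 * (1 + lam * γ x.2)) * V ν f (e x.1) ^ 2 * V ν g (e x.2) ^ 2 by ring,
            h1, h2]
          exact le_of_eq (by ring)
    _ ≤ δ ^ 2 * (nrm ν m lam f * nrm ν m lam g) ^ 2 := by
        have h1 := hΔ k
        rw [← Finset.sum_product'] at h1
        have h2 : ∑ x ∈ Finset.range k ×ˢ Finset.range k,
            ((1 + lam * γ x.1) * V ν f (e x.1) ^ 2) * ((1 + lam * γ x.2) * V ν g (e x.2) ^ 2)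
            ≤ (nrm ν m lam f * nrm ν m lam g) ^ 2 := by
          rw [Finset.sum_product' (f := fun u v => ((1 + lam * γ u) * V ν f (e u) ^ 2) *
            ((1 + lam * γ v) * V ν g (e v) ^ 2)), ← Finset.sum_mul_sum, mul_pow]
          refine mul_le_mul (E.sum_le_nrm_sq hm hlam hf k) (E.sum_le_nrm_sq hm hlam hg k)
            (Finset.sum_nonneg fun v _ => ?_) (sq_nonneg _)
          have h1 := E.one_le hlam v
          positivity
        refine mul_le_mul h1 h2 (Finset.sum_nonneg fun x _ => ?_) (sq_nonneg _)
        have h1 := E.one_le hlam x.1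
        have h2 := E.one_le hlam x.2
        positivity

theorem abs_sum_coef_le (hm : 1 ≤ m) (E : Eigensystem ν m e γ B) {lam : ℝ} (hlam : 0 ≤ lam)
    {Z : ℕ → ℝ} {β : ℝ} (hβ : 0 ≤ β)
    (hZ : ∀ k, ∑ v ∈ Finset.range k, Z v ^ 2 * wt γ lam v ≤ β ^ 2)
    {f : unitInterval → ℝ} (hf : f ∈ sobolev m) (k : ℕ) :
    |∑ v ∈ Finset.range k, V ν f (e v) * Z v| ≤ β * nrm ν m lam f := by
  refine abs_le_of_sq_le_sq ?_ (mul_nonneg hβ (Real.sqrt_nonneg _))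
  rw [mul_pow]
  refine (Finset.sum_sq_le_sum_mul_sum_of_sq_le_mul (Finset.range k)
    (f := fun v => Z v ^ 2 * wt γ lam v) (g := fun v => (1 + lam * γ v) * V ν f (e v) ^ 2)
    (fun v _ => mul_nonneg (sq_nonneg _) (E.wt_pos hlam v).le) (fun v _ => ?_)
    fun v _ => ?_).trans (mul_le_mul (hZ k) (E.sum_le_nrm_sq hm hlam hf k)
      (Finset.sum_nonneg fun v _ => ?_) (sq_nonneg _))
  · have h1 := E.one_le hlam v
    positivity
  · have h1 : wt γ lam v * (1 + lam * γ v) = 1 :=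
      one_div_mul_cancel (by linarith [E.one_le hlam v])
    rw [show Z v ^ 2 * wt γ lam v * ((1 + lam * γ v) * V ν f (e v) ^ 2)
      = Z v ^ 2 * (wt γ lam v * (1 + lam * γ v)) * V ν f (e v) ^ 2 by ring, h1]
    exact le_of_eq (by ring)
  · have h1 := E.one_le hlam v
    positivity

section Regression

variable {ι : Type*} {s : Finset ι} {τ : ι → unitInterval} {y : ι → ℝ} {M lam : ℝ}

/-- The first-order condition at a minimizer of the penalized least squares criterion. -/
theorem _root_.FBR.normal_equation (hm : 1 ≤ m) {fhat : unitInterval → ℝ} (hfm : fhat ∈ sobolev m)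
    (hmin : IsMinOn (fun f => 1 / (2 * M) * ∑ p ∈ s, (y p - f (τ p)) ^ 2 + lam / 2 * J m f f)
      (sobolev m) fhat) {g : unitInterval → ℝ} (hg : g ∈ sobolev m) :
    -(1 / M) * ∑ p ∈ s, (y p - fhat (τ p)) * g (τ p) + lam * J m fhat g = 0 := by
  set b := -(1 / M) * ∑ p ∈ s, (y p - fhat (τ p)) * g (τ p) + lam * J m fhat g with hb
  set c := 1 / (2 * M) * ∑ p ∈ s, g (τ p) ^ 2 + lam / 2 * J m g g with hc
  have hq : ∀ x : ℝ, 0 ≤ b * x + c * x ^ 2 := by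
    intro x
    have hxg := (sobolev_smul hm x hg).1
    have hmem := (sobolev_add hm hfm hxg).1
    have h := isMinOn_iff.1 hmin _ hmem
    have hJ : J m (fhat + x • g) (fhat + x • g)
        = J m fhat fhat + 2 * x * J m fhat g + x ^ 2 * J m g g := by
      rw [J_add_left hm hfm hxg hmem, J_smul_left hm _ hg, J_comm m fhat, J_comm m g,
        J_add_left hm hfm hxg hfm, J_add_left hm hfm hxg hg, J_smul_left hm _ hg,
        J_smul_left hm _ hg, J_comm m g fhat]
      ring
    have hS : ∑ p ∈ s, (y p - (fhat + x • g) (τ p)) ^ 2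
        = ∑ p ∈ s, (y p - fhat (τ p)) ^ 2 - 2 * x * ∑ p ∈ s, (y p - fhat (τ p)) * g (τ p)
          + x ^ 2 * ∑ p ∈ s, g (τ p) ^ 2 := by
      rw [Finset.mul_sum, Finset.mul_sum, ← Finset.sum_sub_distrib, ← Finset.sum_add_distrib]
      refine Finset.sum_congr rfl fun p _ => ?_
      simp only [Pi.add_apply, Pi.smul_apply, smul_eq_mul]
      ring
    rw [hJ, hS] at h
    have hM : 1 / (2 * M) = 1 / M * (1 / 2) := by rw [one_div_mul_one_div, mul_comm]
    rw [hb, hc, hM]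
    rw [hM] at h
    linarith
  -- a quadratic that is nonnegative near its root at `0` has zero slope there
  by_contra hne
  rcases le_or_gt c 0 with hc0 | hc0
  · have h1 := hq (-b)
    nlinarith [sq_nonneg b, mul_self_pos.2 hne, mul_nonneg (neg_nonneg.2 hc0) (sq_nonneg b)]
  · have h1 := hq (-b / (2 * c))
    have h2 : b * (-b / (2 * c)) + c * (-b / (2 * c)) ^ 2 = -(b ^ 2) / (4 * c) := by
      field_simp; ring
    rw [h2, le_div_iff₀ (by positivity), zero_mul] at h1
    have := mul_self_pos.2 hne
    nlinarith

/-- The remainder of the linearization is small when the empirical and the true inner products of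
the eigenfunctions are close (`hΔ`) and the score is small (`hZ`). -/
theorem nrm_remainder_le (hm : 1 ≤ m) [ν.IsOpenPosMeasure] (E : Eigensystem ν m e γ B)
    (hlam : 0 < lam) {μ fhat : unitInterval → ℝ} (hμ : μ ∈ sobolev m) (hfm : fhat ∈ sobolev m)
    (hmin : IsMinOn (fun f => 1 / (2 * M) * ∑ p ∈ s, (y p - f (τ p)) ^ 2 + lam / 2 * J m f f)
      (sobolev m) fhat)
    {δ β : ℝ} (hδ : 0 ≤ δ) (hδ' : δ ≤ 1 / 2) (hβ : 0 ≤ β)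
    (hΔ : ∀ k, ∑ u ∈ Finset.range k, ∑ v ∈ Finset.range k,
      (V ν (e u) (e v) - 1 / M * ∑ p ∈ s, e u (τ p) * e v (τ p)) ^ 2 *
        (wt γ lam u * wt γ lam v) ≤ δ ^ 2)
    (hZ : ∀ k, ∑ v ∈ Finset.range k,
      (1 / M * ∑ p ∈ s, (y p - μ (τ p)) * e v (τ p)) ^ 2 * wt γ lam v ≤ β ^ 2) :
    nrm ν m lam (fhat - μ + ((-(1 / M)) • (∑ p ∈ s, (y p - μ (τ p)) • kernelAt ν m lam (τ p))
      + W ν m lam μ)) ≤ 2 * δ * (β + Real.sqrt (lam * J m μ μ)) := by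
  have hKm : ∀ p, kernelAt ν m lam (τ p) ∈ sobolev m := fun p =>
    (E.represents_kernelAt hm hlam (τ p)).1
  have hsm := sum_smul_mem_sobolev hm s (fun p => y p - μ (τ p)) hKm
  have hsm' := (sobolev_smul hm (-(1 / M)) hsm).1
  have hWm := (E.represents_W hm hlam hμ).1
  set S := (-(1 / M)) • (∑ p ∈ s, (y p - μ (τ p)) • kernelAt ν m lam (τ p)) + W ν m lam μ with hS
  have hSm : S ∈ sobolev m := (sobolev_add hm hsm' hWm).1
  have hipS : ∀ f ∈ sobolev m, ip ν m lam S f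
      = -(1 / M) * ∑ p ∈ s, (y p - μ (τ p)) * f (τ p) + lam * J m μ f := by
    intro f hf
    rw [hS, ip_add_left hm lam hsm' hWm hf, ip_smul_left ν hm lam _ hsm, ip_sum_left hm lam _ _ hKm hf,
      (E.represents_W hm hlam hμ).2 f hf]
    simp only [(E.represents_kernelAt hm hlam _).2 f hf]
  set g := fhat - μ with hg
  have hgm : g ∈ sobolev m := sub_mem_sobolev hm hfm hμ
  have hRm : g + S ∈ sobolev m := (sobolev_add hm hgm hSm).1
  have hipR : ∀ f ∈ sobolev m, ip ν m lam (g + S) f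
      = V ν g f - 1 / M * ∑ p ∈ s, g (τ p) * f (τ p) := by
    intro f hf
    have h1 := normal_equation hm hfm hmin hf
    have h2 : lam * J m g f = lam * J m fhat f - lam * J m μ f := by
      rw [hg, J_sub_left hm hfm hμ hf]; ring
    have h3 : ∑ p ∈ s, g (τ p) * f (τ p) = ∑ p ∈ s, (y p - μ (τ p)) * f (τ p)
        - ∑ p ∈ s, (y p - fhat (τ p)) * f (τ p) := by
      rw [← Finset.sum_sub_distrib]
      refine Finset.sum_congr rfl fun p _ => ?_
      rw [hg, Pi.sub_apply]; ring
    rw [ip_add_left hm lam hgm hSm hf, hipS f hf, ip, h2, h3]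
    linear_combination h1
  -- the difference of the two inner products, bounded through the eigenfunction expansions
  have hD : ∀ f ∈ sobolev m, |ip ν m lam (g + S) f| ≤ δ * (nrm ν m lam g * nrm ν m lam f) := by
    intro f hf
    have hev : ∀ t, Tendsto (fun k => (∑ v ∈ Finset.range k, V ν g (e v) * e v t) *
        ∑ v ∈ Finset.range k, V ν f (e v) * e v t) atTop (𝓝 (g t * f t)) := fun t =>
      (E.hasSum_eval hm hgm t).tendsto_sum_nat.mul (E.hasSum_eval hm hf t).tendsto_sum_nat
    have hlim := ((E.tendsto_V_partial hm hgm hf).sub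
      ((tendsto_finsetSum s fun p _ => hev (τ p)).const_mul (1 / M))).abs
    rw [← hipR f hf] at hlim
    refine le_of_tendsto hlim (Eventually.of_forall fun k => ?_)
    refine le_of_eq_of_le (congrArg abs ?_) (E.abs_sum_sum_le hm hlam.le hδ hΔ hgm hf k)
    simp only [mul_sub, Finset.sum_sub_distrib]
    congr 1
    · refine Finset.sum_congr rfl fun u hu => ?_
      rw [Finset.sum_eq_single u]
      · rw [E.V_eq, if_pos rfl, mul_one]
      · intro v _ hv
        rw [E.V_eq, if_neg hv.symm, mul_zero]
      · intro h; exact absurd hu h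
    · rw [Finset.sum_congr rfl fun p _ => Finset.sum_mul_sum (Finset.range k) (Finset.range k)
        (fun u => V ν g (e u) * e u (τ p)) (fun v => V ν f (e v) * e v (τ p))]
      simp only [Finset.mul_sum]
      rw [Finset.sum_comm]
      refine Finset.sum_congr rfl fun u _ => ?_
      rw [Finset.sum_comm]
      refine Finset.sum_congr rfl fun v _ => Finset.sum_congr rfl fun p _ => ?_
      ring
  have hipSb : ∀ f ∈ sobolev m, |ip ν m lam S f|
      ≤ (β + Real.sqrt (lam * J m μ μ)) * nrm ν m lam f := by
    intro f hf
    have h1 : |1 / M * ∑ p ∈ s, (y p - μ (τ p)) * f (τ p)| ≤ β * nrm ν m lam f := by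
      have hlim := ((tendsto_finsetSum s fun p _ =>
        ((E.hasSum_eval hm hf (τ p)).tendsto_sum_nat.const_mul
          (y p - μ (τ p)))).const_mul (1 / M)).abs
      refine le_of_tendsto hlim (Eventually.of_forall fun k => ?_)
      refine le_of_eq_of_le (congrArg abs ?_) (E.abs_sum_coef_le hm hlam.le hβ hZ hf k)
      simp only [Finset.mul_sum]
      rw [Finset.sum_comm]
      refine Finset.sum_congr rfl fun u _ => Finset.sum_congr rfl fun v _ => ?_
      ring
    have h2 : |lam * J m μ f| ≤ Real.sqrt (lam * J m μ μ) * nrm ν m lam f := by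
      refine abs_le_of_sq_le_sq ?_ (mul_nonneg (Real.sqrt_nonneg _) (Real.sqrt_nonneg _))
      rw [mul_pow, mul_pow, Real.sq_sqrt (mul_nonneg hlam.le (J_self_nonneg m μ)),
        nrm_sq ν m hlam.le]
      have h3 := J_sq_le hm hμ hf
      have h4 : lam * J m f f ≤ ip ν m lam f f := le_add_of_nonneg_left (V_self_nonneg ν f)
      calc lam ^ 2 * J m μ f ^ 2 ≤ lam ^ 2 * (J m μ μ * J m f f) := by gcongr
        _ = lam * J m μ μ * (lam * J m f f) := by ring
        _ ≤ _ := mul_le_mul_of_nonneg_left h4 (mul_nonneg hlam.le (J_self_nonneg m μ))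
    rw [hipS f hf, neg_mul, add_mul]
    exact (abs_add_le _ _).trans (add_le_add (by rwa [abs_neg]) h2)
  set b := β + Real.sqrt (lam * J m μ μ) with hb
  have hb0 : 0 ≤ b := add_nonneg hβ (Real.sqrt_nonneg _)
  have hg0 : 0 ≤ nrm ν m lam g := Real.sqrt_nonneg _
  -- `‖g‖² = ⟨g + S, g⟩ - ⟨S, g⟩ ≤ δ ‖g‖² + b ‖g‖`
  have hgb : nrm ν m lam g ≤ 2 * b := by
    rcases hg0.eq_or_lt with h0 | h0
    · rw [← h0]; positivity
    have h1 : nrm ν m lam g ^ 2 = ip ν m lam (g + S) g - ip ν m lam S g := by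
      rw [nrm_sq ν m hlam.le, ip_add_left hm lam hgm hSm hgm]; ring
    have h2 := (abs_le.1 (hD g hgm)).2
    have h3 := (abs_le.1 (hipSb g hgm)).1
    have h4 : nrm ν m lam g * nrm ν m lam g ≤ (2 * b) * nrm ν m lam g := by
      nlinarith [mul_le_mul_of_nonneg_right hδ' (mul_nonneg hg0 hg0)]
    exact le_of_mul_le_mul_right h4 h0
  have hR0 : 0 ≤ nrm ν m lam (g + S) := Real.sqrt_nonneg _
  have hRg : nrm ν m lam (g + S) ≤ δ * nrm ν m lam g := by
    rcases hR0.eq_or_lt with h0 | h0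
    · rw [← h0]; positivity
    have h2 := (abs_le.1 (hD _ hRm)).2
    rw [← nrm_sq ν m hlam.le] at h2
    refine le_of_mul_le_mul_right ?_ h0
    linarith
  calc nrm ν m lam (g + S) ≤ δ * nrm ν m lam g := hRg
    _ ≤ δ * (2 * b) := by gcongr
    _ = 2 * δ * b := by ring

end Regression

end Eigensystem

/-! ### Probabilistic tools -/

section Tools

variable {Ω : Type*} [MeasurableSpace Ω] {P : Measure Ω}

/-- Regrouping of independent pairs with independent components. -/
theorem indepFun_regroup [IsProbabilityMeasure P] {α₁ α₂ β₁ β₂ : Type*}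
    [MeasurableSpace α₁] [MeasurableSpace α₂]
    [MeasurableSpace β₁] [MeasurableSpace β₂] {A₁ : Ω → α₁} {A₂ : Ω → α₂} {B₁ : Ω → β₁}
    {B₂ : Ω → β₂} (hA₁ : Measurable A₁) (hA₂ : Measurable A₂) (hB₁ : Measurable B₁)
    (hB₂ : Measurable B₂)
    (hAB : IndepFun (fun ω => (A₁ ω, A₂ ω)) (fun ω => (B₁ ω, B₂ ω)) P)
    (hA : IndepFun A₁ A₂ P) (hB : IndepFun B₁ B₂ P) :
    IndepFun (fun ω => (A₁ ω, B₁ ω)) (fun ω => (A₂ ω, B₂ ω)) P := by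
  have h1 : IndepFun A₁ B₁ P := hAB.comp measurable_fst measurable_fst
  have h2 : IndepFun A₂ B₂ P := hAB.comp measurable_snd measurable_snd
  rw [IndepFun_iff_Indep]
  refine IndepSets.indep (hA₁.prodMk hB₁).comap_le (hA₂.prodMk hB₂).comap_le
    (isPiSystem_prod.comap _) (isPiSystem_prod.comap _)
    (p1 := {s | ∃ t ∈ Set.image2 (· ×ˢ ·) {s : Set α₁ | MeasurableSet s}
      {t : Set β₁ | MeasurableSet t}, (fun ω => (A₁ ω, B₁ ω)) ⁻¹' t = s})
    (p2 := {s | ∃ t ∈ Set.image2 (· ×ˢ ·) {s : Set α₂ | MeasurableSet s}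
      {t : Set β₂ | MeasurableSet t}, (fun ω => (A₂ ω, B₂ ω)) ⁻¹' t = s})
    ?_ ?_ ?_
  · rw [← generateFrom_prod, MeasurableSpace.comap_generateFrom]; rfl
  · rw [← generateFrom_prod, MeasurableSpace.comap_generateFrom]; rfl
  · rw [IndepSets_iff]
    rintro _ _ ⟨_, ⟨s₁, hs₁, t₁, ht₁, rfl⟩, rfl⟩ ⟨_, ⟨s₂, hs₂, t₂, ht₂, rfl⟩, rfl⟩
    have e1 : (fun ω => (A₁ ω, B₁ ω)) ⁻¹' s₁ ×ˢ t₁ = A₁ ⁻¹' s₁ ∩ B₁ ⁻¹' t₁ := rfl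
    have e2 : (fun ω => (A₂ ω, B₂ ω)) ⁻¹' s₂ ×ˢ t₂ = A₂ ⁻¹' s₂ ∩ B₂ ⁻¹' t₂ := rfl
    have h3 := hAB.measure_inter_preimage_eq_mul (s₁ ×ˢ s₂) (t₁ ×ˢ t₂) (hs₁.prod hs₂)
      (ht₁.prod ht₂)
    have e3 : (fun ω => (A₁ ω, A₂ ω)) ⁻¹' s₁ ×ˢ s₂ = A₁ ⁻¹' s₁ ∩ A₂ ⁻¹' s₂ := rfl
    have e4 : (fun ω => (B₁ ω, B₂ ω)) ⁻¹' t₁ ×ˢ t₂ = B₁ ⁻¹' t₁ ∩ B₂ ⁻¹' t₂ := rfl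
    rw [e3, e4, hA.measure_inter_preimage_eq_mul _ _ hs₁ hs₂,
      hB.measure_inter_preimage_eq_mul _ _ ht₁ ht₂] at h3
    rw [e1, e2, h1.measure_inter_preimage_eq_mul _ _ hs₁ ht₁,
      h2.measure_inter_preimage_eq_mul _ _ hs₂ ht₂, Set.inter_inter_inter_comm, h3]
    ring

/-- Conditioning on an independent discrete variable. -/
theorem lintegral_le_of_indepFun [IsProbabilityMeasure P] {α β : Type*}
    [MeasurableSpace α] [MeasurableSpace β]
    [Countable β] [MeasurableSingletonClass β] {D : Ω → α} {κ : Ω → β} (hD : Measurable D)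
    (hκ : Measurable κ) (hind : IndepFun D κ P) {F : α → β → ENNReal}
    (hF : ∀ b, Measurable fun a => F a b) {G : β → ENNReal}
    (hFG : ∀ b, ∫⁻ ω, F (D ω) b ∂P ≤ G b) :
    ∫⁻ ω, F (D ω) (κ ω) ∂P ≤ ∫⁻ ω, G (κ ω) ∂P := by
  have hFm : Measurable (fun p : α × β => F p.1 p.2) := measurable_from_prod_countable_left hF
  have hGm : Measurable G := measurable_of_countable G
  have : IsProbabilityMeasure (P.map D) := Measure.isProbabilityMeasure_map hD.aemeasurable
  have : IsProbabilityMeasure (P.map κ) := Measure.isProbabilityMeasure_map hκ.aemeasurable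
  calc ∫⁻ ω, F (D ω) (κ ω) ∂P
      = ∫⁻ p, F p.1 p.2 ∂(P.map fun ω => (D ω, κ ω)) :=
        (lintegral_map hFm (hD.prodMk hκ)).symm
    _ = ∫⁻ b, ∫⁻ a, F a b ∂(P.map D) ∂(P.map κ) := by
        rw [hind.map_prod_eq_prod_map_map hD.aemeasurable hκ.aemeasurable,
          lintegral_prod_symm' _ hFm]
    _ ≤ ∫⁻ b, G b ∂(P.map κ) := by
        refine lintegral_mono fun b => ?_
        rw [lintegral_map (hF b) hD]
        exact hFG b
    _ = ∫⁻ ω, G (κ ω) ∂P := lintegral_map hGm hκ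

/-- The second moment of a sum over clusters of sizes `κ i`, uncorrelated between clusters. -/
theorem integral_cluster_sum_sq_le {n : ℕ} {ζ : ℕ → ℕ → Ω → ℝ} {C : ℝ}
    (hL2 : ∀ i j, MemLp (ζ i j) 2 P) (hC : ∀ i j, ∫ ω, ζ i j ω ^ 2 ∂P ≤ C)
    (horth : ∀ i i' j j', i ≠ i' → ∫ ω, ζ i j ω * ζ i' j' ω ∂P = 0) (κ : Fin n → ℕ) :
    ∫ ω, (∑ i : Fin n, ∑ j ∈ Finset.range (κ i), ζ i j ω) ^ 2 ∂P ≤ C * ∑ i, (κ i : ℝ) ^ 2 := by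
  have hSL : ∀ i : Fin n, MemLp (fun ω => ∑ j ∈ Finset.range (κ i), ζ i j ω) 2 P := fun i =>
    memLp_finsetSum _ fun j _ => hL2 i j
  have hint : ∀ i i' : Fin n, Integrable (fun ω => (∑ j ∈ Finset.range (κ i), ζ i j ω) *
      ∑ j ∈ Finset.range (κ i'), ζ i' j ω) P := fun i i' => (hSL i).integrable_mul (hSL i')
  have hexp : ∀ ω, (∑ i : Fin n, ∑ j ∈ Finset.range (κ i), ζ i j ω) ^ 2
      = ∑ i : Fin n, ∑ i' : Fin n, (∑ j ∈ Finset.range (κ i), ζ i j ω) *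
        ∑ j ∈ Finset.range (κ i'), ζ i' j ω := fun ω => by rw [sq, Finset.sum_mul_sum]
  simp only [hexp]
  rw [integral_finsetSum _ fun i _ => integrable_finsetSum _ fun i' _ => hint i i']
  rw [Finset.mul_sum]
  refine Finset.sum_le_sum fun i _ => ?_
  rw [integral_finsetSum _ fun i' _ => hint i i', Finset.sum_eq_single i]
  · calc ∫ ω, (∑ j ∈ Finset.range (κ i), ζ i j ω) * ∑ j ∈ Finset.range (κ i), ζ i j ω ∂P
        ≤ ∫ ω, (κ i : ℝ) * ∑ j ∈ Finset.range (κ i), ζ i j ω ^ 2 ∂P := by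
          refine integral_mono (hint i i) (Integrable.const_mul
            (integrable_finsetSum _ fun j _ => (hL2 i j).integrable_sq) _) fun ω => ?_
          simpa [← sq] using sq_sum_le_card_mul_sum_sq (s := Finset.range (κ i))
            (f := fun j => ζ i j ω)
      _ = (κ i : ℝ) * ∑ j ∈ Finset.range (κ i), ∫ ω, ζ i j ω ^ 2 ∂P := by
          rw [integral_const_mul, integral_finsetSum _ fun j _ => (hL2 i j).integrable_sq]
      _ ≤ (κ i : ℝ) * ∑ j ∈ Finset.range (κ i), C := by
          gcongr with j _
          exact hC i j
      _ = C * (κ i : ℝ) ^ 2 := by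
          rw [Finset.sum_const, Finset.card_range, nsmul_eq_mul]; ring
  · intro i' _ hne
    simp only [Finset.sum_mul_sum]
    have hne' : (i : ℕ) ≠ i' := fun h => hne (Fin.ext h.symm)
    have hpair : ∀ j j', Integrable (fun ω => ζ i j ω * ζ i' j' ω) P := fun j j' =>
      (hL2 i j).integrable_mul (hL2 i' j')
    rw [integral_finsetSum _ fun j _ => integrable_finsetSum _ fun j' _ => hpair j j']
    refine Finset.sum_eq_zero fun j _ => ?_
    rw [integral_finsetSum _ fun j' _ => hpair j j']
    exact Finset.sum_eq_zero fun j' _ => horth _ _ _ _ hne'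
  · simp

variable {α : Type*} [MeasurableSpace α] {D : Ω → α} {N : ℕ → Ω → ℕ} {ζ : ℕ → ℕ → α → ℝ}

theorem measurable_cluster_sum (hζ : ∀ i j, Measurable (ζ i j)) {n : ℕ} (k : Fin n → ℕ) :
    Measurable fun a => ∑ i : Fin n, ∑ j ∈ Finset.range (k i), ζ i j a :=
  Finset.measurable_sum _ fun i _ => Finset.measurable_sum _ fun j _ => hζ i j

theorem measurable_average (hD : Measurable D) (hN : ∀ i, Measurable (N i))
    (hζ : ∀ i j, Measurable (ζ i j)) (n : ℕ) :
    Measurable fun ω => 1 / (M N n ω : ℝ) *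
      ∑ i ∈ Finset.range n, ∑ j ∈ Finset.range (N i ω), ζ i j (D ω) := by
  have h : Measurable (fun p : α × (Fin n → ℕ) => 1 / ((∑ i, p.2 i : ℕ) : ℝ) *
      ∑ i : Fin n, ∑ j ∈ Finset.range (p.2 i), ζ i j p.1) :=
    measurable_from_prod_countable_left fun k => (measurable_cluster_sum hζ k).const_mul
      (1 / ((∑ i, k i : ℕ) : ℝ))
  have h2 := h.comp (hD.prodMk (measurable_pi_lambda (fun ω (i : Fin n) => N i ω) fun i => hN i))
  refine (congrArg Measurable (funext fun ω => ?_)).mp h2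
  simp only [Function.comp_apply, M, Finset.sum_range]

/-- The second moment of an average over `n` clusters of independent random sizes is at most of
order `1 / n`: given the sizes `k i`, it is at most `C (∑ k i ^ 2) / (∑ k i) ^ 2`, and
`∑ k i ≥ n`. -/
theorem lintegral_average_sq_le [IsProbabilityMeasure P] (hD : Measurable D)
    (hN : ∀ i, Measurable (N i))
    (hind : IndepFun D (fun ω i => N i ω) P) (hζ : ∀ i j, Measurable (ζ i j)) {C Q : ℝ}
    (hQ : ∀ i, MemLp (fun ω => (N i ω : ℝ)) 2 P ∧ ∫ ω, (N i ω : ℝ) ^ 2 ∂P ≤ Q)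
    (hpos : ∀ i, ∀ᵐ ω ∂P, 0 < N i ω)
    (hL2 : ∀ i j, MemLp (fun ω => ζ i j (D ω)) 2 P) (hC0 : 0 ≤ C)
    (hC : ∀ i j, ∫ ω, ζ i j (D ω) ^ 2 ∂P ≤ C)
    (horth : ∀ i i' j j', i ≠ i' → ∫ ω, ζ i j (D ω) * ζ i' j' (D ω) ∂P = 0) {n : ℕ}
    (hn : 0 < n) :
    ∫⁻ ω, ENNReal.ofReal ((1 / (M N n ω : ℝ) *
      ∑ i ∈ Finset.range n, ∑ j ∈ Finset.range (N i ω), ζ i j (D ω)) ^ 2) ∂P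
      ≤ ENNReal.ofReal (C * Q / n) := by
  let κ : Ω → Fin n → ℕ := fun ω i => N i ω
  have hκ : Measurable κ := measurable_pi_lambda _ fun i => hN i
  have hind' : IndepFun D κ P := hind.comp measurable_id
    (measurable_pi_lambda (fun (x : ℕ → ℕ) (i : Fin n) => x i) fun i => measurable_pi_apply _)
  let F : α → (Fin n → ℕ) → ENNReal := fun a k => ENNReal.ofReal ((1 / ((∑ i, k i : ℕ) : ℝ) *
    ∑ i : Fin n, ∑ j ∈ Finset.range (k i), ζ i j a) ^ 2)
  let G : (Fin n → ℕ) → ENNReal := fun k =>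
    ENNReal.ofReal ((1 / ((∑ i, k i : ℕ) : ℝ)) ^ 2 * (C * ∑ i, (k i : ℝ) ^ 2))
  have hF : ∀ k, Measurable fun a => F a k := fun k =>
    (((measurable_cluster_sum hζ k).const_mul _).pow_const 2).ennreal_ofReal
  have hFG : ∀ k, ∫⁻ ω, F (D ω) k ∂P ≤ G k := fun k => by
    have hm : MemLp (fun ω => ∑ i : Fin n, ∑ j ∈ Finset.range (k i), ζ i j (D ω)) 2 P :=
      memLp_finsetSum _ fun i _ => memLp_finsetSum _ fun j _ => hL2 i j
    have hm' := (hm.const_mul (1 / ((∑ i, k i : ℕ) : ℝ))).integrable_sq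
    have h2 : ∫⁻ ω, F (D ω) k ∂P = ENNReal.ofReal (∫ ω, (1 / ((∑ i, k i : ℕ) : ℝ) *
        ∑ i : Fin n, ∑ j ∈ Finset.range (k i), ζ i j (D ω)) ^ 2 ∂P) :=
      (ofReal_integral_eq_lintegral_ofReal hm' (Eventually.of_forall fun ω => sq_nonneg _)).symm
    rw [h2]
    refine ENNReal.ofReal_le_ofReal ?_
    simp only [mul_pow]
    rw [integral_const_mul]
    exact mul_le_mul_of_nonneg_left (integral_cluster_sum_sq_le
      (ζ := fun i j ω => ζ i j (D ω)) hL2 hC horth k) (sq_nonneg _)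
  have h1 : ∫⁻ ω, F (D ω) (κ ω) ∂P ≤ ∫⁻ ω, G (κ ω) ∂P :=
    lintegral_le_of_indepFun hD hκ hind' hF hFG
  have e1 : ∀ ω, 1 / (M N n ω : ℝ) *
      ∑ i ∈ Finset.range n, ∑ j ∈ Finset.range (N i ω), ζ i j (D ω)
      = 1 / ((∑ i, κ ω i : ℕ) : ℝ) * ∑ i : Fin n, ∑ j ∈ Finset.range (κ ω i), ζ i j (D ω) :=
    fun ω => by simp only [M, Finset.sum_range, κ]
  simp only [e1]
  refine h1.trans ?_
  have hn' : (0 : ℝ) < n := by exact_mod_cast hn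
  have hall : ∀ᵐ ω ∂P, ∀ i, 0 < N i ω := ae_all_iff.2 hpos
  have hsq : ∀ i : Fin n, Integrable (fun ω => (N i ω : ℝ) ^ 2) P := fun i => (hQ i).1.integrable_sq
  calc ∫⁻ ω, ENNReal.ofReal ((1 / ((∑ i, κ ω i : ℕ) : ℝ)) ^ 2 * (C * ∑ i, (κ ω i : ℝ) ^ 2)) ∂P
      ≤ ∫⁻ ω, ENNReal.ofReal ((1 / (n : ℝ)) ^ 2 * (C * ∑ i : Fin n, (N i ω : ℝ) ^ 2)) ∂P := by
        refine lintegral_mono_ae ?_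
        filter_upwards [hall] with ω hω
        refine ENNReal.ofReal_le_ofReal ?_
        have h2 : (n : ℝ) ≤ ((∑ i, κ ω i : ℕ) : ℝ) := by
          have : ∑ i : Fin n, 1 ≤ ∑ i, κ ω i := Finset.sum_le_sum fun i _ => hω i
          simp only [Finset.sum_const, Finset.card_univ, Fintype.card_fin, smul_eq_mul,
            mul_one] at this
          exact_mod_cast this
        have h3 : 0 ≤ C * ∑ i : Fin n, (N i ω : ℝ) ^ 2 :=
          mul_nonneg hC0 (Finset.sum_nonneg fun _ _ => sq_nonneg _)
        gcongr
    _ = ENNReal.ofReal ((1 / (n : ℝ)) ^ 2 * (C * ∑ i : Fin n, ∫ ω, (N i ω : ℝ) ^ 2 ∂P)) := by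
        rw [← ofReal_integral_eq_lintegral_ofReal]
        · rw [integral_const_mul, integral_const_mul, integral_finsetSum _ fun i _ => hsq i]
        · exact ((integrable_finsetSum _ fun i _ => hsq i).const_mul _).const_mul _
        · exact Eventually.of_forall fun ω => mul_nonneg (sq_nonneg _)
            (mul_nonneg hC0 (Finset.sum_nonneg fun _ _ => sq_nonneg _))
    _ ≤ ENNReal.ofReal (C * Q / n) := by
        refine ENNReal.ofReal_le_ofReal ?_
        have h4 : ∑ i : Fin n, ∫ ω, (N i ω : ℝ) ^ 2 ∂P ≤ n * Q := by
          refine (Finset.sum_le_sum fun (i : Fin n) _ => (hQ i).2).trans ?_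
          simp
        calc (1 / (n : ℝ)) ^ 2 * (C * ∑ i : Fin n, ∫ ω, (N i ω : ℝ) ^ 2 ∂P)
            ≤ (1 / (n : ℝ)) ^ 2 * (C * (n * Q)) := by gcongr
          _ = C * Q / n := by field_simp

/-- Markov's inequality for a weighted sum of squares. -/
theorem measure_weighted_sum_sq_gt_le {ι : Type*} [Countable ι] {R : ι → Ω → ℝ} {p : ι → ℝ}
    {c w b : ℝ} (hR : ∀ i, Measurable (R i))
    (hc : ∀ i, ∫⁻ ω, ENNReal.ofReal (R i ω ^ 2) ∂P ≤ ENNReal.ofReal c) (hc0 : 0 ≤ c)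
    (hp : ∀ i, 0 ≤ p i) (hw : ∀ s : Finset ι, ∑ i ∈ s, p i ≤ w) (hb : 0 < b) :
    P {ω | ∃ s : Finset ι, b < ∑ i ∈ s, R i ω ^ 2 * p i} ≤ ENNReal.ofReal (c * w / b) := by
  set A : Ω → ENNReal := fun ω => ∑' i, ENNReal.ofReal (R i ω ^ 2 * p i) with hA
  have hAm : ∀ i, Measurable fun ω => ENNReal.ofReal (R i ω ^ 2 * p i) := fun i =>
    (((hR i).pow_const 2).mul_const _).ennreal_ofReal
  have hsub : {ω | ∃ s : Finset ι, b < ∑ i ∈ s, R i ω ^ 2 * p i}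
      ⊆ {ω | ENNReal.ofReal b ≤ A ω} := by
    rintro ω ⟨s, hs⟩
    calc ENNReal.ofReal b ≤ ENNReal.ofReal (∑ i ∈ s, R i ω ^ 2 * p i) :=
          ENNReal.ofReal_le_ofReal hs.le
      _ = ∑ i ∈ s, ENNReal.ofReal (R i ω ^ 2 * p i) :=
          ENNReal.ofReal_sum_of_nonneg fun i _ => mul_nonneg (sq_nonneg _) (hp i)
      _ ≤ A ω := ENNReal.sum_le_tsum s
  have hint : ∫⁻ ω, A ω ∂P ≤ ENNReal.ofReal (c * w) := by
    rw [hA, lintegral_tsum fun i => (hAm i).aemeasurable]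
    calc ∑' i, ∫⁻ ω, ENNReal.ofReal (R i ω ^ 2 * p i) ∂P
        ≤ ∑' i, ENNReal.ofReal c * ENNReal.ofReal (p i) := by
          refine ENNReal.tsum_le_tsum fun i => ?_
          simp only [ENNReal.ofReal_mul (sq_nonneg _)]
          rw [lintegral_mul_const _ ((hR i).pow_const 2).ennreal_ofReal]
          gcongr
          exact hc i
      _ = ENNReal.ofReal c * ∑' i, ENNReal.ofReal (p i) := ENNReal.tsum_mul_left
      _ ≤ ENNReal.ofReal c * ENNReal.ofReal w := by
          gcongr
          rw [ENNReal.tsum_eq_iSup_sum]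
          refine iSup_le fun s => ?_
          rw [← ENNReal.ofReal_sum_of_nonneg fun i _ => hp i]
          exact ENNReal.ofReal_le_ofReal (hw s)
      _ = ENNReal.ofReal (c * w) := (ENNReal.ofReal_mul hc0).symm
  calc P {ω | ∃ s : Finset ι, b < ∑ i ∈ s, R i ω ^ 2 * p i}
      ≤ P {ω | ENNReal.ofReal b ≤ A ω} := measure_mono hsub
    _ ≤ (∫⁻ ω, A ω ∂P) / ENNReal.ofReal b :=
        meas_ge_le_lintegral_div (AEMeasurable.tsum fun i => (hAm i).aemeasurable)
          (by simpa using hb) ENNReal.ofReal_ne_top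
    _ ≤ ENNReal.ofReal (c * w) / ENNReal.ofReal b := by gcongr
    _ = ENNReal.ofReal (c * w / b) := (ENNReal.ofReal_div_of_pos hb).symm

end Tools

/-! ### Evaluating a random path at a random time -/

/-- A version of the evaluation `(x, t) ↦ x t` that is jointly measurable for the product
`σ`-algebra on paths; the two agree on continuous paths. -/
noncomputable def evalLim (x : unitInterval → ℝ) (t : unitInterval) : ℝ :=
  limsup (fun k : ℕ => x (Set.projIcc 0 1 zero_le_one (⌊(t : ℝ) * k⌋₊ / (k : ℝ)))) atTop

theorem measurable_evalLim :
    Measurable fun p : (unitInterval → ℝ) × unitInterval => evalLim p.1 p.2 := by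
  refine Measurable.limsup fun k => ?_
  have h1 : Measurable fun q : (unitInterval → ℝ) × ℕ =>
      q.1 (Set.projIcc 0 1 zero_le_one ((q.2 : ℝ) / (k : ℝ))) :=
    measurable_from_prod_countable_left fun n =>
      measurable_pi_apply (Set.projIcc 0 1 zero_le_one ((n : ℝ) / (k : ℝ)))
  have h2 : Measurable fun p : (unitInterval → ℝ) × unitInterval => ⌊(p.2 : ℝ) * k⌋₊ :=
    Nat.measurable_floor.comp ((measurable_subtype_coe.comp measurable_snd).mul_const _)
  exact h1.comp (measurable_fst.prodMk h2)

theorem _root_.Measurable.evalLim {β : Type*} [MeasurableSpace β] {f : β → unitInterval → ℝ}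
    {g : β → unitInterval} (hf : Measurable f) (hg : Measurable g) :
    Measurable fun b => evalLim (f b) (g b) := by
  have h := measurable_evalLim.comp (hf.prodMk hg)
  exact h

theorem evalLim_eq {x : unitInterval → ℝ} (hx : Continuous x) (t : unitInterval) :
    evalLim x t = x t := by
  refine Tendsto.limsup_eq ((hx.tendsto t).comp ?_)
  have h1 : Tendsto (fun k : ℕ => (⌊(t : ℝ) * k⌋₊ : ℝ) / (k : ℝ)) atTop (𝓝 (t : ℝ)) :=
    (tendsto_nat_floor_mul_div_atTop t.2.1).comp tendsto_natCast_atTop_atTop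
  have h2 := (continuous_projIcc (h := zero_le_one' ℝ)).tendsto (t : ℝ) |>.comp h1
  rwa [Set.projIcc_val] at h2

theorem isOpenPosMeasure_volume_unitInterval :
    (volume : Measure unitInterval).IsOpenPosMeasure := by
  refine ⟨fun U hU ⟨x, hx⟩ h0 => ?_⟩
  obtain ⟨O, hO, rfl⟩ := isOpen_induced_iff.1 hU
  have hx' : (x : ℝ) ∈ closure (Set.Ioo (0 : ℝ) 1) := by
    rw [closure_Ioo zero_ne_one]; exact x.2
  have hne : (O ∩ Set.Ioo (0 : ℝ) 1).Nonempty := mem_closure_iff.1 hx' O hO hx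
  have hpos := (hO.inter isOpen_Ioo).measure_pos volume hne
  rw [unitInterval.volume_apply] at h0
  refine hpos.ne' (measure_mono_null ?_ h0)
  rintro y ⟨hyO, hy⟩
  exact ⟨⟨y, hy.1.le, hy.2.le⟩, hyO, rfl⟩

/-! ### Moments in the model -/

/-- The space of the paths, times and errors of all subjects. -/
abbrev DataSpace : Type :=
  (ℕ → unitInterval → ℝ) × (ℕ → ℕ → unitInterval) × (ℕ → ℕ → ℝ)

/-- The residual `Y_ij - μ(T_ij)` as a measurable function of the data; see `evalLim`. -/
noncomputable def resid (μ : unitInterval → ℝ) (i j : ℕ) (d : DataSpace) : ℝ :=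
  evalLim (d.1 i) (d.2.1 i j) + d.2.2 i j - μ (d.2.1 i j)

theorem exists_abs_le_of_continuous {f : unitInterval → ℝ} (hf : Continuous f) :
    ∃ A, 0 ≤ A ∧ ∀ t, |f t| ≤ A := by
  obtain ⟨A, hA⟩ := isCompact_univ.exists_bound_of_continuousOn hf.continuousOn
  exact ⟨A, (norm_nonneg _).trans (hA 0 (Set.mem_univ _)), fun t => hA t (Set.mem_univ t)⟩

section Moments

variable {Ω : Type*} [MeasurableSpace Ω] {P : Measure Ω}
  {X : ℕ → Ω → unitInterval → ℝ} {T : ℕ → ℕ → Ω → unitInterval} {ε : ℕ → ℕ → Ω → ℝ}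
  {N : ℕ → Ω → ℕ} {μ : unitInterval → ℝ} {m : ℕ}

theorem isOpenPosMeasure_map_T (h1 : BoundedDensities P X T ε) :
    (P.map (T 0 0)).IsOpenPosMeasure := by
  obtain ⟨-, π, c, C, hπ, hc, hb, hd⟩ := h1
  have := isOpenPosMeasure_volume_unitInterval
  refine ⟨fun U hU hne h0 => ?_⟩
  rw [hd 0 0, withDensity_apply _ hU.measurableSet] at h0
  have h2 : ENNReal.ofReal c * volume U ≤ ∫⁻ t in U, ENNReal.ofReal (π t) := by
    rw [← setLIntegral_const]
    exact lintegral_mono fun t => ENNReal.ofReal_le_ofReal (hb t).1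
  rw [h0, nonpos_iff_eq_zero, mul_eq_zero] at h2
  rcases h2 with h2 | h2
  · exact absurd (ENNReal.ofReal_eq_zero.1 h2) (not_le.2 hc)
  · exact (hU.measure_pos volume hne).ne' h2

namespace Model

theorem isProbabilityMeasure_map_T [IsProbabilityMeasure P] (hM : Model P X T ε N μ) :
    IsProbabilityMeasure (P.map (T 0 0)) :=
  Measure.isProbabilityMeasure_map (hM.measurable_T 0 0).aemeasurable

theorem map_T (hM : Model P X T ε N μ) (i j : ℕ) : P.map (T i j) = P.map (T 0 0) :=
  (hM.ident_T i j).map_eq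

theorem integral_comp_T (hM : Model P X T ε N μ) (i j : ℕ) {f : unitInterval → ℝ}
    (hf : Continuous f) : ∫ ω, f (T i j ω) ∂P = ∫ t, f t ∂(P.map (T 0 0)) := by
  rw [← hM.map_T i j, integral_map (hM.measurable_T i j).aemeasurable
    hf.aestronglyMeasurable]

theorem indepFun_X_T (hM : Model P X T ε N μ) (i i' j' : ℕ) : IndepFun (X i) (T i' j') P :=
  hM.indep_X_T.comp (φ := fun x : ℕ → unitInterval → ℝ => x i)
    (ψ := fun x : ℕ → ℕ → unitInterval => x i' j') (by fun_prop) (by fun_prop)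

theorem indepFun_T_ε (hM : Model P X T ε N μ) (i j : ℕ) : IndepFun (T i j) (ε i j) P :=
  hM.indep_XT_ε.comp
    (φ := fun x : (ℕ → unitInterval → ℝ) × (ℕ → ℕ → unitInterval) => x.2 i j)
    (ψ := fun x : ℕ → ℕ → ℝ => x i j) (by fun_prop) (by fun_prop)

/-- The path, time and error of different subjects are independent. -/
theorem indepFun_subject [IsProbabilityMeasure P] (hM : Model P X T ε N μ) {i i' : ℕ} (j j' : ℕ)
    (h : i ≠ i') :
    IndepFun (fun ω => ((X i ω, T i j ω), ε i j ω)) (fun ω => ((X i' ω, T i' j' ω), ε i' j' ω))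
      P := by
  have hne : (i, j) ≠ (i', j') := fun h' => h (congrArg Prod.fst h')
  have hXT : IndepFun (fun ω => (X i ω, T i j ω)) (fun ω => (X i' ω, T i' j' ω)) P :=
    indepFun_regroup (hM.measurable_X i) (hM.measurable_X i') (hM.measurable_T i j)
      (hM.measurable_T i' j')
      (hM.indep_X_T.comp (φ := fun x => (x i, x i')) (ψ := fun x => (x i j, x i' j'))
        (by fun_prop) (by fun_prop))
      (hM.indep_X.indepFun h) (hM.indep_T.indepFun hne)
  exact indepFun_regroup ((hM.measurable_X i).prodMk (hM.measurable_T i j))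
    ((hM.measurable_X i').prodMk (hM.measurable_T i' j')) (hM.measurable_ε i j)
    (hM.measurable_ε i' j')
    (hM.indep_XT_ε.comp (φ := fun x => ((x.1 i, x.2 i j), (x.1 i', x.2 i' j')))
      (ψ := fun x => (x i j, x i' j')) (by fun_prop) (by fun_prop))
    hXT (hM.indep_ε.indepFun hne)

theorem ae_evalLim_eq (hm : 1 ≤ m) (h4 : SmoothPaths P m X) (i : ℕ) :
    ∀ᵐ ω ∂P, ∀ t, evalLim (X i ω) t = X i ω t := by
  filter_upwards [(h4 i).1] with ω hω t
  exact evalLim_eq (continuous_of_mem_sobolev hm hω) t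

/-- An integrable bound for the paths in the norm of `H^m` and uniformly. The integral is a lower
integral: `G` need not be measurable, since the norm of the `m`-th derivative need not be. -/
theorem exists_path_bound (hm : 1 ≤ m) (hM : Model P X T ε N μ) (h4 : SmoothPaths P m X)
    {ν : Measure unitInterval} [IsProbabilityMeasure ν] [ν.IsOpenPosMeasure]
    {e : ℕ → unitInterval → ℝ} {γ : ℕ → ℝ} {B : ℝ} (E : Eigensystem ν m e γ B) :
    ∃ G : Ω → ENNReal, ∫⁻ ω, G ω ∂P ≠ ⊤ ∧ ∀ᵐ ω ∂P, (∀ t, ENNReal.ofReal (X 0 ω t ^ 2) ≤ G ω) ∧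
      ∀ k, ENNReal.ofReal (∑ v ∈ Finset.range k, (1 + γ v) * V ν (X 0 ω) (e v) ^ 2) ≤ G ω := by
  obtain ⟨S, C, hC, hsob⟩ := E.exists_sobolev_ineq hm
  set L : Ω → ENNReal := fun ω =>
    ∫⁻ t in Set.Icc (0 : ℝ) 1, ENNReal.ofReal (dv m (X 0 ω) t ^ 2) with hL
  refine ⟨fun ω => ENNReal.ofReal C * ∑ p ∈ S, ENNReal.ofReal (X 0 ω p ^ 2)
    + ENNReal.ofReal (C + 1) * L ω, ?_, ?_⟩
  · have hXm : ∀ p, Measurable fun ω => ENNReal.ofReal (X 0 ω p ^ 2) := fun p =>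
      (((measurable_pi_apply p).comp (hM.measurable_X 0)).pow_const 2).ennreal_ofReal
    rw [lintegral_add_left ((Finset.measurable_sum _ fun p _ => hXm p).const_mul _),
      lintegral_const_mul' _ _ ENNReal.ofReal_ne_top,
      lintegral_const_mul' _ _ ENNReal.ofReal_ne_top, lintegral_finsetSum _ fun p _ => hXm p]
    refine ENNReal.add_ne_top.2 ⟨ENNReal.mul_ne_top ENNReal.ofReal_ne_top ?_,
      ENNReal.mul_ne_top ENNReal.ofReal_ne_top (h4 0).2.ne⟩
    refine ENNReal.sum_ne_top.2 fun p _ => ?_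
    have h := (hM.second_moment 0 p).integrable_sq
    rw [← ofReal_integral_eq_lintegral_ofReal h (Eventually.of_forall fun _ => sq_nonneg _)]
    exact ENNReal.ofReal_ne_top
  · filter_upwards [(h4 0).1] with ω hω
    have hJ0 := J_self_nonneg m (X 0 ω)
    have hQ0 : 0 ≤ ∑ p ∈ S, X 0 ω p ^ 2 := Finset.sum_nonneg fun _ _ => sq_nonneg _
    have hJL : ENNReal.ofReal (J m (X 0 ω) (X 0 ω)) = L ω := by
      rw [hL, J, ofReal_integral_eq_lintegral_ofReal (integrable_dv_mul hω hω)
        (Eventually.of_forall fun _ => mul_self_nonneg _)]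
      simp only [sq]
    have hmax : ENNReal.ofReal (C * ∑ p ∈ S, X 0 ω p ^ 2 + (C + 1) * J m (X 0 ω) (X 0 ω))
        = ENNReal.ofReal C * ∑ p ∈ S, ENNReal.ofReal (X 0 ω p ^ 2)
          + ENNReal.ofReal (C + 1) * L ω := by
      rw [ENNReal.ofReal_add (by positivity) (by positivity), ENNReal.ofReal_mul hC,
        ENNReal.ofReal_mul (by positivity), hJL,
        ENNReal.ofReal_sum_of_nonneg fun _ _ => sq_nonneg _]
    rw [← hmax]
    refine ⟨fun t => ENNReal.ofReal_le_ofReal ?_, fun k => ENNReal.ofReal_le_ofReal ?_⟩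
    · linarith [hsob _ hω t]
    · have h1 := E.sum_le_nrm_sq hm zero_le_one hω k
      rw [nrm_sq ν m zero_le_one, ip] at h1
      have h2 : V ν (X 0 ω) (X 0 ω) ≤ C * (∑ p ∈ S, X 0 ω p ^ 2 + J m (X 0 ω) (X 0 ω)) := by
        calc V ν (X 0 ω) (X 0 ω)
            ≤ ∫ _, C * (∑ p ∈ S, X 0 ω p ^ 2 + J m (X 0 ω) (X 0 ω)) ∂ν := by
              refine integral_mono (integrable_mul_of_mem_sobolev hm ν hω hω)
                (integrable_const _) fun t => ?_
              simpa only [sq] using hsob _ hω t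
          _ = _ := by simp
      simp only [one_mul] at h1
      linarith

theorem exists_second_moment_le (hm : 1 ≤ m) (hM : Model P X T ε N μ) (h4 : SmoothPaths P m X)
    {ν : Measure unitInterval} [IsProbabilityMeasure ν] [ν.IsOpenPosMeasure]
    {e : ℕ → unitInterval → ℝ} {γ : ℕ → ℝ} {B : ℝ} (E : Eigensystem ν m e γ B) :
    ∃ C : ℝ, 0 ≤ C ∧ ∀ i t, ∫⁻ ω, ENNReal.ofReal (X i ω t ^ 2) ∂P ≤ ENNReal.ofReal C := by
  obtain ⟨G, hG, hb⟩ := hM.exists_path_bound hm h4 E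
  refine ⟨(∫⁻ ω, G ω ∂P).toReal, ENNReal.toReal_nonneg, fun i t => ?_⟩
  rw [ENNReal.ofReal_toReal hG]
  have hid := (hM.ident_X i).comp (u := fun x => ENNReal.ofReal (x t ^ 2))
    ((measurable_pi_apply t).pow_const 2).ennreal_ofReal
  refine (hid.lintegral_eq).trans_le (lintegral_mono_ae ?_)
  filter_upwards [hb] with ω hω
  exact hω.1 t

/-- The mean function lies in `H^m`: its coefficients are the means of those of the paths. -/
theorem mean_mem_sobolev [IsProbabilityMeasure P] (hm : 1 ≤ m) (hM : Model P X T ε N μ)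
    (h4 : SmoothPaths P m X)
    {ν : Measure unitInterval} [IsProbabilityMeasure ν] [ν.IsOpenPosMeasure]
    {e : ℕ → unitInterval → ℝ} {γ : ℕ → ℝ} {B : ℝ} (E : Eigensystem ν m e γ B) :
    μ ∈ sobolev m := by
  obtain ⟨G, hG, hb⟩ := hM.exists_path_bound hm h4 E
  have hec : ∀ v, Continuous (e v) := fun v => continuous_of_mem_sobolev hm (E.mem v)
  let ψ : ℕ → (unitInterval → ℝ) → ℝ := fun v x => ∫ t, evalLim x t * e v t ∂ν
  have hψm : ∀ v, Measurable (ψ v) := fun v =>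
    (StronglyMeasurable.integral_prod_right
      (measurable_evalLim.mul ((hec v).measurable.comp measurable_snd)).stronglyMeasurable).measurable
  let Ψ : ℕ → Ω → ℝ := fun v ω => ψ v (X 0 ω)
  have hΨm : ∀ v, Measurable (Ψ v) := fun v => (hψm v).comp (hM.measurable_X 0)
  have hΨ : ∀ᵐ ω ∂P, ∀ v, Ψ v ω = V ν (X 0 ω) (e v) := by
    filter_upwards [ae_evalLim_eq hm h4 0] with ω hω v
    simp only [Ψ, ψ, V, hω]
  have hsum : ∀ k, ∑ v ∈ Finset.range k, ∫⁻ ω, ENNReal.ofReal ((1 + γ v) * Ψ v ω ^ 2) ∂P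
      ≤ ∫⁻ ω, G ω ∂P := by
    intro k
    rw [← lintegral_finsetSum _ fun v _ =>
      (((hΨm v).pow_const 2).const_mul (1 + γ v)).ennreal_ofReal]
    refine lintegral_mono_ae ?_
    filter_upwards [hb, hΨ] with ω hω hΨω
    refine le_trans (le_of_eq ?_) (hω.2 k)
    rw [ENNReal.ofReal_sum_of_nonneg fun v _ =>
      mul_nonneg (by linarith [E.gamma_nonneg v]) (sq_nonneg _)]
    simp only [hΨω]
  have hint : ∀ v, Integrable (fun ω => (1 + γ v) * Ψ v ω ^ 2) P := by
    intro v
    refine ⟨(((hΨm v).pow_const 2).const_mul _).aestronglyMeasurable, ?_⟩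
    rw [hasFiniteIntegral_iff_ofReal (Eventually.of_forall fun ω =>
      mul_nonneg (by linarith [E.gamma_nonneg v]) (sq_nonneg _))]
    refine lt_of_le_of_lt ?_ hG.lt_top
    refine le_trans ?_ (hsum (v + 1))
    exact Finset.single_le_sum (f := fun v => ∫⁻ ω, ENNReal.ofReal ((1 + γ v) * Ψ v ω ^ 2) ∂P)
      (fun _ _ => zero_le) (Finset.self_mem_range_succ v)
  set q : ℕ → ℝ := fun v => ∫ ω, (1 + γ v) * Ψ v ω ^ 2 ∂P with hq
  have hq0 : ∀ v, 0 ≤ q v := fun v => integral_nonneg fun ω =>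
    mul_nonneg (by linarith [E.gamma_nonneg v]) (sq_nonneg _)
  have hqs : Summable q := by
    refine summable_of_sum_range_le (c := (∫⁻ ω, G ω ∂P).toReal) hq0 fun k => ?_
    rw [← ENNReal.ofReal_le_iff_le_toReal hG, ENNReal.ofReal_sum_of_nonneg fun v _ => hq0 v]
    refine le_trans (le_of_eq (Finset.sum_congr rfl fun v _ => ?_)) (hsum k)
    exact ofReal_integral_eq_lintegral_ofReal (hint v) (Eventually.of_forall fun ω =>
      mul_nonneg (by linarith [E.gamma_nonneg v]) (sq_nonneg _))
  have hΨ2 : ∀ v, MemLp (Ψ v) 2 P := fun v => by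
    rw [memLp_two_iff_integrable_sq (hΨm v).aestronglyMeasurable]
    have h := (hint v).const_mul (1 / (1 + γ v))
    have h0 := E.gamma_nonneg v
    refine h.congr (Eventually.of_forall fun ω => ?_)
    field_simp
  have hΨ1 : ∀ v, Integrable (Ψ v) P := fun v => (hΨ2 v).integrable one_le_two
  let c : ℕ → ℝ := fun v => ∫ ω, Ψ v ω ∂P
  have hcs : Summable fun v => (1 + γ v) * c v ^ 2 := by
    refine hqs.of_nonneg_of_le
      (fun v => mul_nonneg (by linarith [E.gamma_nonneg v]) (sq_nonneg _)) fun v => ?_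
    simp only [hq, integral_const_mul]
    refine mul_le_mul_of_nonneg_left ?_ (by linarith [E.gamma_nonneg v])
    -- Jensen's inequality
    have hvar := variance_nonneg (Ψ v) P
    rw [variance_eq_sub (hΨ2 v)] at hvar
    simpa [c] using hvar
  have hμ : μ = fun t => ∑' v, c v * e v t := by
    funext t
    have h1 := hasSum_integral_of_summable_integral_norm (μ := P)
      (F := fun v ω => Ψ v ω * e v t) (fun v => (hΨ1 v).mul_const _) (by
        refine Summable.of_nonneg_of_le (fun v => integral_nonneg fun ω => norm_nonneg _)
          (fun v => ?_) ((hqs.add (E.summable_wt hm zero_lt_one)).mul_left B)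
        have hdom : ∀ ω, ‖Ψ v ω * e v t‖ ≤ B * ((1 + γ v) * Ψ v ω ^ 2 + wt γ 1 v) := by
          intro ω
          rw [Real.norm_eq_abs, abs_mul, mul_comm]
          refine mul_le_mul (E.bound v t) ?_ (abs_nonneg _) E.B_nonneg
          have h2 := E.gamma_nonneg v
          have h3 : (1 + γ v) * wt γ 1 v = 1 := by
            rw [wt, one_mul]; exact mul_one_div_cancel (by linarith)
          have h4 := (E.wt_pos zero_le_one v).le
          have h5 : (1 + γ v) * Ψ v ω ^ 2 + wt γ 1 v - |Ψ v ω|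
              = (1 + γ v) * ((|Ψ v ω| - wt γ 1 v) ^ 2) + |Ψ v ω| * (2 * ((1 + γ v) * wt γ 1 v) - 1)
                + wt γ 1 v * (1 - (1 + γ v) * wt γ 1 v) := by
            rw [← sq_abs (Ψ v ω)]; ring
          rw [h3] at h5
          have h6 : 0 ≤ (1 + γ v) * ((|Ψ v ω| - wt γ 1 v) ^ 2) :=
            mul_nonneg (by linarith) (sq_nonneg _)
          nlinarith [abs_nonneg (Ψ v ω)]
        calc ∫ ω, ‖Ψ v ω * e v t‖ ∂P ≤ ∫ ω, B * ((1 + γ v) * Ψ v ω ^ 2 + wt γ 1 v) ∂P :=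
              integral_mono ((hΨ1 v).mul_const _).norm
                (((hint v).add (integrable_const _)).const_mul _) hdom
          _ = B * (q v + wt γ 1 v) := by
              rw [integral_const_mul, integral_add (hint v) (integrable_const _)]
              simp [hq])
    have h2 : ∫ ω, ∑' v, Ψ v ω * e v t ∂P = μ t := by
      rw [← hM.mean 0 t]
      refine integral_congr_ae ?_
      filter_upwards [hΨ, (h4 0).1] with ω hω hmem
      simp only [hω]
      exact (E.hasSum_eval hm hmem t).tsum_eq
    rw [h2] at h1
    rw [← h1.tsum_eq]
    refine tsum_congr fun v => ?_
    rw [integral_mul_const]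
  rw [hμ]
  exact (E.exists_mem_sobolev hm hcs).1

end Model

end Moments

/-! ### Empirical inner products and the score -/

section Averages

variable {Ω : Type*} [MeasurableSpace Ω] {P : Measure Ω}
  {X : ℕ → Ω → unitInterval → ℝ} {T : ℕ → ℕ → Ω → unitInterval} {ε : ℕ → ℕ → Ω → ℝ}
  {N : ℕ → Ω → ℕ} {μ : unitInterval → ℝ} {m : ℕ}

/-- The paths, times and errors of all subjects. -/
def dataOf (X : ℕ → Ω → unitInterval → ℝ) (T : ℕ → ℕ → Ω → unitInterval) (ε : ℕ → ℕ → Ω → ℝ)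
    (ω : Ω) : DataSpace :=
  (fun i => X i ω, fun i j => T i j ω, fun i j => ε i j ω)

theorem measurable_resid (hμ : Measurable μ) (i j : ℕ) : Measurable (resid μ i j) := by
  have hT : Measurable fun d : DataSpace => d.2.1 i j := by fun_prop
  have hX : Measurable fun d : DataSpace => d.1 i := by fun_prop
  have hε : Measurable fun d : DataSpace => d.2.2 i j := by fun_prop
  exact ((measurable_evalLim.comp (hX.prodMk hT)).add hε).sub (hμ.comp hT)

namespace Model

theorem measurable_dataOf (hM : Model P X T ε N μ) : Measurable (dataOf X T ε) :=
  (measurable_pi_lambda _ hM.measurable_X).prodMk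
    ((measurable_pi_lambda _ fun i => measurable_pi_lambda _ fun j => hM.measurable_T i j).prodMk
      (measurable_pi_lambda _ fun i => measurable_pi_lambda _ fun j => hM.measurable_ε i j))

theorem memLp_evalLim [IsProbabilityMeasure P] (hm : 1 ≤ m) (hM : Model P X T ε N μ)
    (h4 : SmoothPaths P m X) {C : ℝ} (hC0 : 0 ≤ C)
    (hC : ∀ i t, ∫⁻ ω, ENNReal.ofReal (X i ω t ^ 2) ∂P ≤ ENNReal.ofReal C) (i j : ℕ) :
    MemLp (fun ω => evalLim (X i ω) (T i j ω)) 2 P ∧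
      ∫ ω, evalLim (X i ω) (T i j ω) ^ 2 ∂P ≤ C := by
  have hmeas : Measurable fun ω => evalLim (X i ω) (T i j ω) :=
    (hM.measurable_X i).evalLim (hM.measurable_T i j)
  have hF : Measurable fun p : (unitInterval → ℝ) × unitInterval =>
      ENNReal.ofReal (evalLim p.1 p.2 ^ 2) := (measurable_evalLim.pow_const 2).ennreal_ofReal
  have : IsProbabilityMeasure (P.map (X i)) :=
    Measure.isProbabilityMeasure_map (hM.measurable_X i).aemeasurable
  have : IsProbabilityMeasure (P.map (T i j)) :=
    Measure.isProbabilityMeasure_map (hM.measurable_T i j).aemeasurable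
  have hl : ∫⁻ ω, ENNReal.ofReal (evalLim (X i ω) (T i j ω) ^ 2) ∂P ≤ ENNReal.ofReal C := by
    calc ∫⁻ ω, ENNReal.ofReal (evalLim (X i ω) (T i j ω) ^ 2) ∂P
        = ∫⁻ p, ENNReal.ofReal (evalLim p.1 p.2 ^ 2) ∂(P.map fun ω => (X i ω, T i j ω)) :=
          (lintegral_map hF ((hM.measurable_X i).prodMk (hM.measurable_T i j))).symm
      _ = ∫⁻ t, ∫⁻ x, ENNReal.ofReal (evalLim x t ^ 2) ∂(P.map (X i)) ∂(P.map (T i j)) := by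
          rw [(hM.indepFun_X_T i i j).map_prod_eq_prod_map_map (hM.measurable_X i).aemeasurable
            (hM.measurable_T i j).aemeasurable, lintegral_prod_symm' _ hF]
      _ ≤ ∫⁻ _, ENNReal.ofReal C ∂(P.map (T i j)) := by
          refine lintegral_mono fun t => ?_
          have hFt : Measurable fun x : unitInterval → ℝ => ENNReal.ofReal (evalLim x t ^ 2) :=
            ((measurable_id.evalLim measurable_const).pow_const 2).ennreal_ofReal
          rw [lintegral_map hFt (hM.measurable_X i)]
          refine le_trans (lintegral_mono_ae ?_) (hC i t)
          filter_upwards [ae_evalLim_eq hm h4 i] with ω hω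
          simp [hω]
      _ = ENNReal.ofReal C := by simp
  have hint : Integrable (fun ω => evalLim (X i ω) (T i j ω) ^ 2) P := by
    refine ⟨(hmeas.pow_const 2).aestronglyMeasurable, ?_⟩
    rw [hasFiniteIntegral_iff_ofReal (Eventually.of_forall fun _ => sq_nonneg _)]
    exact hl.trans_lt ENNReal.ofReal_lt_top
  refine ⟨(memLp_two_iff_integrable_sq hmeas.aestronglyMeasurable).2 hint, ?_⟩
  rw [← ofReal_integral_eq_lintegral_ofReal hint (Eventually.of_forall fun _ => sq_nonneg _)] at hl
  exact (ENNReal.ofReal_le_ofReal_iff hC0).1 hl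

theorem memLp_comp_T [IsProbabilityMeasure P] (hM : Model P X T ε N μ) {f : unitInterval → ℝ}
    (hf : Continuous f) (i j : ℕ) : MemLp (fun ω => f (T i j ω)) 2 P := by
  obtain ⟨A, -, hA⟩ := exists_abs_le_of_continuous hf
  exact MemLp.of_bound (hf.measurable.comp (hM.measurable_T i j)).aestronglyMeasurable A
    (Eventually.of_forall fun ω => hA _)

/-- The average of the path at the random time, weighted by a function of time. -/
theorem integral_evalLim_mul [IsProbabilityMeasure P] (hm : 1 ≤ m) (hM : Model P X T ε N μ)
    (h4 : SmoothPaths P m X) {g : unitInterval → ℝ} (hg : Continuous g) (i j : ℕ)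
    (hint : Integrable (fun ω => evalLim (X i ω) (T i j ω) * g (T i j ω)) P) :
    ∫ ω, evalLim (X i ω) (T i j ω) * g (T i j ω) ∂P = ∫ t, μ t * g t ∂(P.map (T 0 0)) := by
  have hF : Measurable fun p : (unitInterval → ℝ) × unitInterval => evalLim p.1 p.2 * g p.2 :=
    measurable_evalLim.mul (hg.measurable.comp measurable_snd)
  have hXT := (hM.measurable_X i).prodMk (hM.measurable_T i j)
  have : IsProbabilityMeasure (P.map (X i)) :=
    Measure.isProbabilityMeasure_map (hM.measurable_X i).aemeasurable
  have : IsProbabilityMeasure (P.map (T i j)) :=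
    Measure.isProbabilityMeasure_map (hM.measurable_T i j).aemeasurable
  have hmap := (hM.indepFun_X_T i i j).map_prod_eq_prod_map_map (hM.measurable_X i).aemeasurable
    (hM.measurable_T i j).aemeasurable
  have hint' : Integrable (fun p : (unitInterval → ℝ) × unitInterval => evalLim p.1 p.2 * g p.2)
      ((P.map (X i)).prod (P.map (T i j))) := by
    rw [← hmap, integrable_map_measure hF.aestronglyMeasurable hXT.aemeasurable]
    exact hint
  calc ∫ ω, evalLim (X i ω) (T i j ω) * g (T i j ω) ∂P
      = ∫ p, evalLim p.1 p.2 * g p.2 ∂(P.map fun ω => (X i ω, T i j ω)) :=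
        (integral_map hXT.aemeasurable hF.aestronglyMeasurable).symm
    _ = ∫ t, ∫ x, evalLim x t * g t ∂(P.map (X i)) ∂(P.map (T i j)) := by
        rw [hmap, integral_prod_symm _ hint']
    _ = ∫ t, μ t * g t ∂(P.map (T 0 0)) := by
        rw [hM.map_T i j]
        refine integral_congr_ae (Eventually.of_forall fun t => ?_)
        have h1 : ∫ x, evalLim x t * g t ∂(P.map (X i)) = ∫ ω, evalLim (X i ω) t * g t ∂P :=
          integral_map (hM.measurable_X i).aemeasurable
            (hF.comp (measurable_id.prodMk measurable_const)).aestronglyMeasurable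
        change ∫ x, evalLim x t * g t ∂(P.map (X i)) = μ t * g t
        rw [h1, integral_mul_const, ← hM.mean i t]
        congr 1
        refine integral_congr_ae ?_
        filter_upwards [ae_evalLim_eq hm h4 i] with ω hω using hω t

theorem memLp_resid [IsProbabilityMeasure P] (hm : 1 ≤ m) (hM : Model P X T ε N μ)
    (h2 : CenteredErrors P ε) (h4 : SmoothPaths P m X) (hμ : Continuous μ) {C : ℝ} (hC0 : 0 ≤ C)
    (hC : ∀ i t, ∫⁻ ω, ENNReal.ofReal (X i ω t ^ 2) ∂P ≤ ENNReal.ofReal C) :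
    ∃ K, 0 ≤ K ∧ ∀ i j, MemLp (fun ω => resid μ i j (dataOf X T ε ω)) 2 P ∧
      ∫ ω, resid μ i j (dataOf X T ε ω) ^ 2 ∂P ≤ K := by
  obtain ⟨A, hA0, hA⟩ := exists_abs_le_of_continuous hμ
  have hσ0 : 0 ≤ ∫ ω, ε 0 0 ω ^ 2 ∂P := integral_nonneg fun _ => sq_nonneg _
  refine ⟨3 * (C + ∫ ω, ε 0 0 ω ^ 2 ∂P + A ^ 2), by positivity, fun i j => ?_⟩
  obtain ⟨hx, hxC⟩ := hM.memLp_evalLim hm h4 hC0 hC i j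
  have hμT := hM.memLp_comp_T hμ i j
  have hε := (h2 i j).1
  have hL : MemLp (fun ω => resid μ i j (dataOf X T ε ω)) 2 P := (hx.add hε).sub hμT
  refine ⟨hL, ?_⟩
  have hεe : ∫ ω, ε i j ω ^ 2 ∂P = ∫ ω, ε 0 0 ω ^ 2 ∂P :=
    ((hM.ident_ε i j).comp (u := fun x : ℝ => x ^ 2) (by fun_prop)).integral_eq
  have hμ2 : ∫ ω, μ (T i j ω) ^ 2 ∂P ≤ A ^ 2 := by
    calc ∫ ω, μ (T i j ω) ^ 2 ∂P ≤ ∫ _, A ^ 2 ∂P :=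
          integral_mono hμT.integrable_sq (integrable_const _) fun ω =>
            sq_le_sq' (abs_le.1 (hA _)).1 (abs_le.1 (hA _)).2
      _ = A ^ 2 := by simp
  have i12 : Integrable (fun ω => evalLim (X i ω) (T i j ω) ^ 2 + ε i j ω ^ 2) P :=
    hx.integrable_sq.add hε.integrable_sq
  calc ∫ ω, resid μ i j (dataOf X T ε ω) ^ 2 ∂P
      ≤ ∫ ω, 3 * (evalLim (X i ω) (T i j ω) ^ 2 + ε i j ω ^ 2 + μ (T i j ω) ^ 2) ∂P := by
        refine integral_mono hL.integrable_sq
          ((i12.add hμT.integrable_sq).const_mul 3) fun ω => ?_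
        simp only [resid, dataOf]
        nlinarith [sq_nonneg (evalLim (X i ω) (T i j ω) - ε i j ω),
          sq_nonneg (evalLim (X i ω) (T i j ω) + μ (T i j ω)), sq_nonneg (ε i j ω + μ (T i j ω))]
    _ = 3 * (∫ ω, evalLim (X i ω) (T i j ω) ^ 2 ∂P + ∫ ω, ε i j ω ^ 2 ∂P
          + ∫ ω, μ (T i j ω) ^ 2 ∂P) := by
        rw [integral_const_mul, integral_add i12 hμT.integrable_sq,
          integral_add hx.integrable_sq hε.integrable_sq]
    _ ≤ 3 * (C + ∫ ω, ε 0 0 ω ^ 2 ∂P + A ^ 2) := by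
        rw [hεe]; linarith

theorem integral_resid_mul [IsProbabilityMeasure P] (hm : 1 ≤ m) (hM : Model P X T ε N μ)
    (h2 : CenteredErrors P ε) (h4 : SmoothPaths P m X) (hμ : Continuous μ) {C : ℝ} (hC0 : 0 ≤ C)
    (hC : ∀ i t, ∫⁻ ω, ENNReal.ofReal (X i ω t ^ 2) ∂P ≤ ENNReal.ofReal C)
    {g : unitInterval → ℝ} (hg : Continuous g) (i j : ℕ) :
    ∫ ω, resid μ i j (dataOf X T ε ω) * g (T i j ω) ∂P = 0 := by
  have hx := (hM.memLp_evalLim hm h4 hC0 hC i j).1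
  have hgT := hM.memLp_comp_T hg i j
  have hμT := hM.memLp_comp_T hμ i j
  have i1 : Integrable (fun ω => evalLim (X i ω) (T i j ω) * g (T i j ω)) P :=
    hx.integrable_mul hgT
  have i2 : Integrable (fun ω => ε i j ω * g (T i j ω)) P := (h2 i j).1.integrable_mul hgT
  have i3 : Integrable (fun ω => μ (T i j ω) * g (T i j ω)) P := hμT.integrable_mul hgT
  have i12 : Integrable (fun ω => evalLim (X i ω) (T i j ω) * g (T i j ω)
      + ε i j ω * g (T i j ω)) P := i1.add i2
  have e2 : ∫ ω, ε i j ω * g (T i j ω) ∂P = 0 := by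
    have hind : IndepFun (ε i j) (fun ω => g (T i j ω)) P :=
      (hM.indepFun_T_ε i j).symm.comp measurable_id hg.measurable
    rw [hind.integral_fun_mul_eq_mul_integral (h2 i j).1.aestronglyMeasurable
      hgT.aestronglyMeasurable, (h2 i j).2, zero_mul]
  have e3 : ∫ ω, μ (T i j ω) * g (T i j ω) ∂P = ∫ t, μ t * g t ∂(P.map (T 0 0)) :=
    hM.integral_comp_T i j (hμ.mul hg)
  calc ∫ ω, resid μ i j (dataOf X T ε ω) * g (T i j ω) ∂P
      = ∫ ω, (evalLim (X i ω) (T i j ω) * g (T i j ω) + ε i j ω * g (T i j ω)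
          - μ (T i j ω) * g (T i j ω)) ∂P := by
        refine integral_congr_ae (Eventually.of_forall fun ω => ?_)
        simp only [resid, dataOf]; ring
    _ = 0 := by
        rw [integral_sub i12 i3, integral_add i1 i2, e2, e3,
          hM.integral_evalLim_mul hm h4 hg i j i1]
        ring

theorem exists_count_bound (hM : Model P X T ε N μ) (h3 : SparseCounts P N) :
    ∃ Q, 0 ≤ Q ∧ ∀ i, MemLp (fun ω => (N i ω : ℝ)) 2 P ∧ ∫ ω, (N i ω : ℝ) ^ 2 ∂P ≤ Q :=
  ⟨∫ ω, (N 0 ω : ℝ) ^ 2 ∂P, integral_nonneg fun _ => sq_nonneg _, fun i =>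
    ⟨(h3 i).2.1, (((hM.ident_N i).comp (u := fun k : ℕ => (k : ℝ) ^ 2)
      (measurable_of_countable _)).integral_eq).le⟩⟩

/-- The coefficients of the stochastic part of the score have second moments of order at most
`1 / n`. -/
theorem exists_score_bound [IsProbabilityMeasure P] (hm : 1 ≤ m) (hM : Model P X T ε N μ)
    (h2 : CenteredErrors P ε) (h3 : SparseCounts P N) (h4 : SmoothPaths P m X)
    [(P.map (T 0 0)).IsOpenPosMeasure] {e : ℕ → unitInterval → ℝ} {γ : ℕ → ℝ} {B : ℝ}
    (E : Eigensystem (P.map (T 0 0)) m e γ B) :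
    ∃ K, 0 < K ∧ ∀ v n, 0 < n →
      Measurable (fun ω => 1 / (M N n ω : ℝ) * ∑ i ∈ Finset.range n, ∑ j ∈ Finset.range (N i ω),
        resid μ i j (dataOf X T ε ω) * e v (T i j ω)) ∧
      ∫⁻ ω, ENNReal.ofReal ((1 / (M N n ω : ℝ) * ∑ i ∈ Finset.range n,
        ∑ j ∈ Finset.range (N i ω), resid μ i j (dataOf X T ε ω) * e v (T i j ω)) ^ 2) ∂P
        ≤ ENNReal.ofReal (K / n) := by
  have := hM.isProbabilityMeasure_map_T
  have hμ : Continuous μ := continuous_of_mem_sobolev hm (hM.mean_mem_sobolev hm h4 E)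
  have hec : ∀ v, Continuous (e v) := fun v => continuous_of_mem_sobolev hm (E.mem v)
  obtain ⟨C, hC0, hC⟩ := hM.exists_second_moment_le hm h4 E
  obtain ⟨K, hK0, hK⟩ := hM.memLp_resid hm h2 h4 hμ hC0 hC
  obtain ⟨Q, hQ0, hQ⟩ := hM.exists_count_bound h3
  refine ⟨B ^ 2 * K * Q + 1, by positivity, fun v n hn => ?_⟩
  let ζ : ℕ → ℕ → DataSpace → ℝ := fun i j d => resid μ i j d * e v (d.2.1 i j)
  have hζ : ∀ i j, Measurable (ζ i j) := fun i j =>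
    (measurable_resid hμ.measurable i j).mul ((hec v).measurable.comp (by fun_prop))
  have hB : ∀ t, |e v t| ≤ B := E.bound v
  have hL2 : ∀ i j, MemLp (fun ω => ζ i j (dataOf X T ε ω)) 2 P := fun i j =>
    (hK i j).1.of_le_mul (c := B) ((hζ i j).comp hM.measurable_dataOf).aestronglyMeasurable
      (Eventually.of_forall fun ω => by
        rw [norm_mul, mul_comm]
        exact mul_le_mul_of_nonneg_right (hB _) (norm_nonneg _))
  have hsq : ∀ i j, ∫ ω, ζ i j (dataOf X T ε ω) ^ 2 ∂P ≤ B ^ 2 * K := fun i j => by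
    calc ∫ ω, ζ i j (dataOf X T ε ω) ^ 2 ∂P
        ≤ ∫ ω, B ^ 2 * resid μ i j (dataOf X T ε ω) ^ 2 ∂P := by
          refine integral_mono (hL2 i j).integrable_sq ((hK i j).1.integrable_sq.const_mul _)
            fun ω => ?_
          simp only [ζ, mul_pow]
          rw [mul_comm]
          exact mul_le_mul_of_nonneg_right
            (sq_le_sq' (abs_le.1 (hB _)).1 (abs_le.1 (hB _)).2) (sq_nonneg _)
      _ ≤ B ^ 2 * K := by
          rw [integral_const_mul]
          exact mul_le_mul_of_nonneg_left (hK i j).2 (sq_nonneg _)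
  have hmean : ∀ i j, ∫ ω, ζ i j (dataOf X T ε ω) ∂P = 0 := fun i j =>
    hM.integral_resid_mul hm h2 h4 hμ hC0 hC (hec v) i j
  have horth : ∀ i i' j j', i ≠ i' →
      ∫ ω, ζ i j (dataOf X T ε ω) * ζ i' j' (dataOf X T ε ω) ∂P = 0 := by
    intro i i' j j' hne
    have hu : Measurable fun z : ((unitInterval → ℝ) × unitInterval) × ℝ =>
        (evalLim z.1.1 z.1.2 + z.2 - μ z.1.2) * e v z.1.2 :=
      (((measurable_evalLim.comp measurable_fst).add measurable_snd).sub
        (hμ.measurable.comp (by fun_prop))).mul ((hec v).measurable.comp (by fun_prop))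
    have hind := (hM.indepFun_subject j j' hne).comp hu hu
    have h := hind.integral_fun_mul_eq_mul_integral (hL2 i j).aestronglyMeasurable
      (hL2 i' j').aestronglyMeasurable
    exact h.trans (by
      have h0 := hmean i j
      exact mul_eq_zero_of_left h0 _)
  refine ⟨measurable_average hM.measurable_dataOf hM.measurable_N hζ n, ?_⟩
  refine (lintegral_average_sq_le hM.measurable_dataOf hM.measurable_N hM.indep_XTε_N hζ hQ
    (fun i => (h3 i).1) hL2 (by positivity) hsq horth hn).trans (ENNReal.ofReal_le_ofReal ?_)
  gcongr
  linarith

/-- The errors of the empirical inner products of the eigenfunctions have second moments of order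
at most `1 / n`. -/
theorem exists_gram_bound [IsProbabilityMeasure P] (hm : 1 ≤ m) (hM : Model P X T ε N μ)
    (h3 : SparseCounts P N) {e : ℕ → unitInterval → ℝ} {γ : ℕ → ℝ} {B : ℝ}
    (E : Eigensystem (P.map (T 0 0)) m e γ B) :
    ∃ K, 0 < K ∧ ∀ u v n, 0 < n →
      Measurable (fun ω => 1 / (M N n ω : ℝ) * ∑ i ∈ Finset.range n, ∑ j ∈ Finset.range (N i ω),
        (V (P.map (T 0 0)) (e u) (e v) - e u (T i j ω) * e v (T i j ω))) ∧
      ∫⁻ ω, ENNReal.ofReal ((1 / (M N n ω : ℝ) * ∑ i ∈ Finset.range n,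
        ∑ j ∈ Finset.range (N i ω),
          (V (P.map (T 0 0)) (e u) (e v) - e u (T i j ω) * e v (T i j ω))) ^ 2) ∂P
        ≤ ENNReal.ofReal (K / n) := by
  have hec : ∀ v, Continuous (e v) := fun v => continuous_of_mem_sobolev hm (E.mem v)
  obtain ⟨Q, hQ0, hQ⟩ := hM.exists_count_bound h3
  refine ⟨(1 + B ^ 2) ^ 2 * Q + 1, by positivity, fun u v n hn => ?_⟩
  set c := V (P.map (T 0 0)) (e u) (e v) with hc
  let ζ : ℕ → ℕ → DataSpace → ℝ := fun i j d => c - e u (d.2.1 i j) * e v (d.2.1 i j)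
  have hcont : Continuous fun t => c - e u t * e v t :=
    continuous_const.sub ((hec u).mul (hec v))
  have hζ : ∀ i j, Measurable (ζ i j) := fun i j => hcont.measurable.comp (by fun_prop)
  have hb : ∀ t, |c - e u t * e v t| ≤ 1 + B ^ 2 := fun t => by
    have h1 : |c| ≤ 1 := by rw [hc, E.V_eq]; split_ifs <;> simp
    have h2 : |e u t * e v t| ≤ B ^ 2 := by
      rw [abs_mul, sq]
      exact mul_le_mul (E.bound u t) (E.bound v t) (abs_nonneg _) E.B_nonneg
    exact (abs_sub _ _).trans (add_le_add h1 h2)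
  have hL2 : ∀ i j, MemLp (fun ω => ζ i j (dataOf X T ε ω)) 2 P := fun i j =>
    hM.memLp_comp_T hcont i j
  have hsq : ∀ i j, ∫ ω, ζ i j (dataOf X T ε ω) ^ 2 ∂P ≤ (1 + B ^ 2) ^ 2 := fun i j => by
    calc ∫ ω, ζ i j (dataOf X T ε ω) ^ 2 ∂P ≤ ∫ _, (1 + B ^ 2) ^ 2 ∂P :=
          integral_mono (hL2 i j).integrable_sq (integrable_const _) fun ω =>
            sq_le_sq' (abs_le.1 (hb _)).1 (abs_le.1 (hb _)).2
      _ = _ := by simp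
  have hmean : ∀ i j, ∫ ω, ζ i j (dataOf X T ε ω) ∂P = 0 := fun i j => by
    have h1 : ∫ ω, e u (T i j ω) * e v (T i j ω) ∂P = c :=
      hM.integral_comp_T i j ((hec u).mul (hec v))
    have h2 : Integrable (fun ω => e u (T i j ω) * e v (T i j ω)) P :=
      (hM.memLp_comp_T (hec u) i j).integrable_mul (hM.memLp_comp_T (hec v) i j)
    change ∫ ω, (c - e u (T i j ω) * e v (T i j ω)) ∂P = 0
    rw [integral_sub (integrable_const _) h2, h1]
    simp
  have horth : ∀ i i' j j', i ≠ i' →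
      ∫ ω, ζ i j (dataOf X T ε ω) * ζ i' j' (dataOf X T ε ω) ∂P = 0 := by
    intro i i' j j' hne
    have hind : IndepFun (fun ω => ζ i j (dataOf X T ε ω)) (fun ω => ζ i' j' (dataOf X T ε ω)) P :=
      (hM.indep_T.indepFun (fun h' => hne (congrArg Prod.fst h') : (i, j) ≠ (i', j'))).comp
        hcont.measurable hcont.measurable
    rw [hind.integral_fun_mul_eq_mul_integral (hL2 i j).aestronglyMeasurable
      (hL2 i' j').aestronglyMeasurable, hmean, zero_mul]
  refine ⟨measurable_average hM.measurable_dataOf hM.measurable_N hζ n, ?_⟩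
  refine (lintegral_average_sq_le hM.measurable_dataOf hM.measurable_N hM.indep_XTε_N hζ hQ
    (fun i => (h3 i).1) hL2 (by positivity) hsq horth hn).trans (ENNReal.ofReal_le_ofReal ?_)
  gcongr
  linarith

end Model

end Averages

/-! ### Rates -/

section Rates

theorem eventually_one_le_log_log : ∀ᶠ n : ℕ in atTop, 1 ≤ Real.log (Real.log n) :=
  (Real.tendsto_log_atTop.comp (Real.tendsto_log_atTop.comp
    tendsto_natCast_atTop_atTop)).eventually_ge_atTop 1

/-- The bandwidth condition forces `n h² → ∞`, because `3 - 1/(2m) ≥ 2` and `log log n ≥ 1`. -/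
theorem eventually_le_mul_sq {m : ℕ} (hm : 1 ≤ m) {h : ℕ → ℝ} (hpos : ∀ n, 0 < h n)
    (hh : Tendsto h atTop (𝓝 0))
    (hrate : Tendsto (fun n : ℕ => ((n : ℝ) * h n ^ (3 - 1 / (2 * (m : ℝ)))) ^ (-(1 / 2) : ℝ) *
        Real.sqrt (Real.log (Real.log n))) atTop (𝓝 0)) {c : ℝ} (hc : 0 < c) :
    ∀ᶠ n : ℕ in atTop, c ≤ n * h n ^ 2 := by
  have hm' : (1 : ℝ) ≤ m := by exact_mod_cast hm
  filter_upwards [eventually_one_le_log_log, hh.eventually (gt_mem_nhds one_pos),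
    hrate.eventually (gt_mem_nhds (Real.rpow_pos_of_pos hc (-(1 / 2) : ℝ))),
    eventually_gt_atTop 0] with n hlog hn1 hn hn0
  have hn0' : (0 : ℝ) < n := by exact_mod_cast hn0
  set p : ℝ := 3 - 1 / (2 * (m : ℝ)) with hp
  have hp2 : (2 : ℝ) ≤ p := by
    have : 1 / (2 * (m : ℝ)) ≤ 1 := by
      rw [div_le_one (by positivity)]; linarith
    rw [hp]; linarith
  have hx : 0 < (n : ℝ) * h n ^ p := mul_pos hn0' (Real.rpow_pos_of_pos (hpos n) _)
  have h1 : ((n : ℝ) * h n ^ p) ^ (-(1 / 2) : ℝ) < c ^ (-(1 / 2) : ℝ) := by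
    refine lt_of_le_of_lt ?_ hn
    refine le_mul_of_one_le_right (Real.rpow_nonneg hx.le _) ?_
    exact Real.one_le_sqrt.2 hlog
  have h2 : c ≤ (n : ℝ) * h n ^ p := by
    by_contra hlt
    exact absurd h1 (not_lt.2 (Real.rpow_le_rpow_of_nonpos hx (not_le.1 hlt).le (by norm_num)))
  refine h2.trans (mul_le_mul_of_nonneg_left ?_ hn0'.le)
  rw [← Real.rpow_natCast]
  exact Real.rpow_le_rpow_of_exponent_ge (hpos n) hn1.le (by exact_mod_cast hp2)

/-- `n^(-1/2) h^(-1) (h^m + (nh)^(-1/2))` is at most the rate `a_n`, because `(6m-1)/(4m) ≥ 1`. -/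
theorem le_rate {m : ℕ} (hm : 1 ≤ m) {h : ℝ} (h0 : 0 < h) (h1 : h ≤ 1) {n : ℕ} (hn : 0 < n)
    (hlog : 1 ≤ Real.log (Real.log n)) :
    1 / Real.sqrt (n * h ^ 2) * (h ^ m + 1 / Real.sqrt (n * h)) ≤ rate m h n := by
  have hm' : (1 : ℝ) ≤ m := by exact_mod_cast hm
  have hn' : (0 : ℝ) < n := by exact_mod_cast hn
  have e1 : 1 / Real.sqrt (n * h ^ 2) = (n : ℝ) ^ (-(1 / 2) : ℝ) * h ^ (-1 : ℝ) := by
    rw [Real.sqrt_mul hn'.le, Real.sqrt_sq h0.le, Real.rpow_neg_one, Real.rpow_neg hn'.le,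
      ← Real.sqrt_eq_rpow, one_div, mul_inv]
  have e2 : 1 / Real.sqrt (n * h) = ((n : ℝ) * h) ^ (-(1 / 2) : ℝ) := by
    rw [Real.rpow_neg (by positivity), ← Real.sqrt_eq_rpow, one_div]
  rw [e1, e2, rate]
  have h2 : h ^ (-1 : ℝ) ≤ h ^ (-((6 * (m : ℝ) - 1) / (4 * (m : ℝ)))) := by
    refine Real.rpow_le_rpow_of_exponent_ge h0 h1 (neg_le_neg ?_)
    rw [le_div_iff₀ (by positivity)]
    linarith
  have h3 : 1 ≤ Real.sqrt (Real.log (Real.log n)) := Real.one_le_sqrt.2 hlog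
  have h4 : 0 ≤ h ^ m + ((n : ℝ) * h) ^ (-(1 / 2) : ℝ) := by positivity
  refine le_trans ?_ (le_mul_of_one_le_right (by positivity) h3)
  gcongr

end Rates

/-! ### The representation -/

section Conclusion

variable {Ω : Type*} {X : ℕ → Ω → unitInterval → ℝ} {T : ℕ → ℕ → Ω → unitInterval}
  {ε : ℕ → ℕ → Ω → ℝ}
  {N : ℕ → Ω → ℕ} {μ : unitInterval → ℝ} {m : ℕ}

/-- The deterministic bound for the remainder, for the data of the first `n` subjects. -/
theorem nrm_remainder_score_le (hm : 1 ≤ m) {ν : Measure unitInterval} [IsFiniteMeasure ν]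
    [ν.IsOpenPosMeasure] {e : ℕ → unitInterval → ℝ} {γ : ℕ → ℝ} {B : ℝ}
    (E : Eigensystem ν m e γ B) {lam : ℝ} (hlam : 0 < lam) (hμ : μ ∈ sobolev m) {n : ℕ}
    (hn : 0 < n) {ω : Ω} (hN : ∀ i, 0 < N i ω) (hev : ∀ i t, evalLim (X i ω) t = X i ω t)
    {fhat : unitInterval → ℝ} (hf : IsSplineEstimate X T ε N m lam n ω fhat)
    {δ β : ℝ} (hδ : 0 ≤ δ) (hδ' : δ ≤ 1 / 2) (hβ : 0 ≤ β)
    (hΔ : ∀ s : Finset (ℕ × ℕ), ∑ p ∈ s, (1 / (M N n ω : ℝ) * ∑ i ∈ Finset.range n,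
      ∑ j ∈ Finset.range (N i ω), (V ν (e p.1) (e p.2) - e p.1 (T i j ω) * e p.2 (T i j ω))) ^ 2 *
        (wt γ lam p.1 * wt γ lam p.2) ≤ δ ^ 2)
    (hZ : ∀ s : Finset ℕ, ∑ v ∈ s, (1 / (M N n ω : ℝ) * ∑ i ∈ Finset.range n,
      ∑ j ∈ Finset.range (N i ω), resid μ i j (dataOf X T ε ω) * e v (T i j ω)) ^ 2 * wt γ lam v
        ≤ β ^ 2) :
    nrm ν m lam (fhat - μ + score ν X T ε N m lam n ω μ)
      ≤ 2 * δ * (β + Real.sqrt (lam * J m μ μ)) := by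
  have hMpos : (0 : ℝ) < M N n ω := by
    have : 0 < M N n ω := Finset.sum_pos (fun i _ => hN i) ⟨0, Finset.mem_range.2 hn⟩
    exact_mod_cast this
  have hcard : ∑ i ∈ Finset.range n, ∑ _j ∈ Finset.range (N i ω), (1 : ℝ) = M N n ω := by
    simp [M]
  have hmin : IsMinOn (fun f : unitInterval → ℝ => 1 / (2 * (M N n ω : ℝ)) *
      ∑ p ∈ (Finset.range n).sigma (fun i => Finset.range (N i ω)),
        (Y X T ε p.1 p.2 ω - f (T p.1 p.2 ω)) ^ 2 + lam / 2 * J m f f) (sobolev m) fhat := by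
    have h := hf.2
    refine (congrArg (fun φ => IsMinOn φ (sobolev m) fhat) (funext fun f => ?_)).mp h
    simp only [loss, Finset.sum_sigma]
  have h := E.nrm_remainder_le hm (s := (Finset.range n).sigma (fun i => Finset.range (N i ω)))
    (τ := fun p => T p.1 p.2 ω) (y := fun p => Y X T ε p.1 p.2 ω) (M := (M N n ω : ℝ)) hlam hμ hf.1
    hmin hδ hδ' hβ ?_ ?_
  · simpa only [score, Finset.sum_sigma] using h
  · intro k
    rw [← Finset.sum_product']
    refine le_of_eq_of_le (Finset.sum_congr rfl fun p _ => ?_) (hΔ _)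
    congr 2
    simp only [Finset.sum_sigma, Finset.sum_sub_distrib]
    have hc : ∑ i ∈ Finset.range n, ∑ _j ∈ Finset.range (N i ω), V ν (e p.1) (e p.2)
        = M N n ω * V ν (e p.1) (e p.2) := by
      rw [← hcard, Finset.sum_mul]
      refine Finset.sum_congr rfl fun i _ => ?_
      rw [Finset.sum_mul]
      simp
    rw [hc]
    field_simp
  · intro k
    refine le_of_eq_of_le (Finset.sum_congr rfl fun v _ => ?_) (hZ _)
    simp only [Finset.sum_sigma, resid, dataOf, hev, Y]

/-- The probabilistic half of the representation: with `n` large, Markov's inequality controls the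
weighted sums of squares of the empirical Gram errors and of the score coefficients, and outside
the exceptional events the deterministic bound is at most a multiple of the rate. -/
theorem isBigOp_remainder [MeasurableSpace Ω] {P : Measure Ω} [IsProbabilityMeasure P]
    (hm : 1 ≤ m) (hM : Model P X T ε N μ) (h2 : CenteredErrors P ε)
    (h3 : SparseCounts P N) (h4 : SmoothPaths P m X) [(P.map (T 0 0)).IsOpenPosMeasure]
    {e : ℕ → unitInterval → ℝ} {γ : ℕ → ℝ} {B : ℝ} (E : Eigensystem (P.map (T 0 0)) m e γ B)
    {lam : ℕ → ℝ} (hlam : ∀ n, 0 < lam n)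
    (hh : Tendsto (fun n => bw m (lam n)) atTop (𝓝 0))
    (hrate : Tendsto (fun n : ℕ => ((n : ℝ) * bw m (lam n) ^ (3 - 1 / (2 * (m : ℝ)))) ^
      (-(1 / 2) : ℝ) * Real.sqrt (Real.log (Real.log n))) atTop (𝓝 0))
    {μhat : ℕ → Ω → unitInterval → ℝ}
    (hμhat : ∀ n, ∀ᵐ ω ∂P, IsSplineEstimate X T ε N m (lam n) n ω (μhat n ω)) :
    IsBigOp P (fun n ω => nrm (P.map (T 0 0)) m (lam n)
        (μhat n ω - μ + score (P.map (T 0 0)) X T ε N m (lam n) n ω μ))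
      (fun n => rate m (bw m (lam n)) n) := by
  have := hM.isProbabilityMeasure_map_T
  have hμ := hM.mean_mem_sobolev hm h4 E
  obtain ⟨KZ, hKZ, hZ⟩ := hM.exists_score_bound hm h2 h3 h4 E
  obtain ⟨KΔ, hKΔ, hΔ⟩ := hM.exists_gram_bound hm h3 E
  obtain ⟨CW, hCW, hW⟩ := E.exists_sum_wt_le hm
  intro η hη
  -- thresholds at which Markov's inequality leaves probability at most `η / 2`
  set cδ := 8 * KΔ * CW ^ 2 / η with hcδ
  set cβ := 4 * KZ * CW / η with hcβ
  have hcδ0 : 0 < cδ := by positivity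
  have hcβ0 : 0 < cβ := by positivity
  refine ⟨2 * Real.sqrt cδ * (Real.sqrt cβ + Real.sqrt (J m μ μ) + 1), by positivity, ?_⟩
  filter_upwards [eventually_one_le_log_log, hh.eventually (gt_mem_nhds one_pos),
    eventually_le_mul_sq hm (fun n => bw_pos (hlam n)) hh hrate
      (show 0 < 4 * cδ by positivity), eventually_gt_atTop 0] with n hlog hn1 hnh hn
  have hn' : (0 : ℝ) < n := by exact_mod_cast hn
  set h := bw m (lam n) with hhdef
  have h0 : 0 < h := bw_pos (hlam n)
  set δ := Real.sqrt (cδ / (n * h ^ 2)) with hδ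
  set β := Real.sqrt (cβ / (n * h)) with hβ
  have hδ2 : δ ^ 2 = cδ / (n * h ^ 2) := Real.sq_sqrt (by positivity)
  have hβ2 : β ^ 2 = cβ / (n * h) := Real.sq_sqrt (by positivity)
  have hδhalf : δ ≤ 1 / 2 := by
    refine Real.sqrt_le_iff.2 ⟨by norm_num, ?_⟩
    rw [div_le_iff₀ (by positivity)]
    linarith
  have hwpos : ∀ v, 0 ≤ wt γ (lam n) v := fun v => (E.wt_pos (hlam n).le v).le
  have hw : ∀ s : Finset ℕ, ∑ v ∈ s, wt γ (lam n) v ≤ 2 * CW / h := fun s => by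
    obtain ⟨k, hk⟩ := s.exists_nat_subset_range
    refine (Finset.sum_le_sum_of_subset_of_nonneg hk fun v _ _ => hwpos v).trans ?_
    refine (hW (lam n) (hlam n) k).trans ?_
    rw [← hhdef]
    have : 1 ≤ 1 / h := by rw [le_div_iff₀ h0]; linarith
    calc CW * (1 + 1 / h) ≤ CW * (1 / h + 1 / h) := by gcongr
      _ = 2 * CW / h := by ring
  have hw2 : ∀ s : Finset (ℕ × ℕ), ∑ p ∈ s, wt γ (lam n) p.1 * wt γ (lam n) p.2
      ≤ (2 * CW / h) ^ 2 := fun s => by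
    classical
    refine (Finset.sum_le_sum_of_subset_of_nonneg (Finset.subset_product (s := s))
      fun p _ _ => mul_nonneg (hwpos _) (hwpos _)).trans ?_
    rw [Finset.sum_product' (f := fun u v => wt γ (lam n) u * wt γ (lam n) v),
      ← Finset.sum_mul_sum, sq]
    exact mul_le_mul (hw _) (hw _) (Finset.sum_nonneg fun v _ => hwpos v) (by positivity)
  set bad1 : Set Ω := {ω | ∃ s : Finset (ℕ × ℕ), δ ^ 2 < ∑ p ∈ s, (1 / (M N n ω : ℝ) *
    ∑ i ∈ Finset.range n, ∑ j ∈ Finset.range (N i ω),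
      (V (P.map (T 0 0)) (e p.1) (e p.2) - e p.1 (T i j ω) * e p.2 (T i j ω))) ^ 2 *
        (wt γ (lam n) p.1 * wt γ (lam n) p.2)} with hbad1
  set bad2 : Set Ω := {ω | ∃ s : Finset ℕ, β ^ 2 < ∑ v ∈ s, (1 / (M N n ω : ℝ) *
    ∑ i ∈ Finset.range n, ∑ j ∈ Finset.range (N i ω),
      resid μ i j (dataOf X T ε ω) * e v (T i j ω)) ^ 2 * wt γ (lam n) v} with hbad2
  have hP1 : P bad1 ≤ ENNReal.ofReal (η / 2) := by
    refine (measure_weighted_sum_sq_gt_le (fun p : ℕ × ℕ => (hΔ p.1 p.2 n hn).1)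
      (fun p : ℕ × ℕ => (hΔ p.1 p.2 n hn).2) (by positivity)
      (fun p : ℕ × ℕ => mul_nonneg (hwpos p.1) (hwpos p.2)) hw2
      (by rw [hδ2]; positivity)).trans (ENNReal.ofReal_le_ofReal (le_of_eq ?_))
    rw [hδ2, hcδ]
    field_simp
    norm_num
  have hP2 : P bad2 ≤ ENNReal.ofReal (η / 2) := by
    refine (measure_weighted_sum_sq_gt_le (fun v => (hZ v n hn).1)
      (fun v => (hZ v n hn).2) (by positivity) hwpos hw
      (by rw [hβ2]; positivity)).trans (ENNReal.ofReal_le_ofReal (le_of_eq ?_))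
    rw [hβ2, hcβ]
    field_simp
    norm_num
  have hbound : 2 * δ * (β + Real.sqrt (lam n * J m μ μ))
      ≤ 2 * Real.sqrt cδ * (Real.sqrt cβ + Real.sqrt (J m μ μ) + 1) * rate m h n := by
    have hlamJ : Real.sqrt (lam n * J m μ μ) = h ^ m * Real.sqrt (J m μ μ) := by
      rw [Real.sqrt_mul (hlam n).le, ← bw_pow hm (hlam n), ← hhdef, mul_comm 2 m, pow_mul,
        Real.sqrt_sq (by positivity)]
    have e1 : δ = Real.sqrt cδ * (1 / Real.sqrt (n * h ^ 2)) := by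
      rw [hδ, Real.sqrt_div hcδ0.le, mul_one_div]
    have e2 : β = Real.sqrt cβ * (1 / Real.sqrt (n * h)) := by
      rw [hβ, Real.sqrt_div hcβ0.le, mul_one_div]
    have hrt := le_rate hm h0 hn1.le hn hlog
    set a := 1 / Real.sqrt (n * h ^ 2)
    set b := 1 / Real.sqrt (n * h)
    have ha : 0 ≤ a := by positivity
    have hb : 0 ≤ b := by positivity
    have hhm : 0 ≤ h ^ m := by positivity
    rw [hlamJ, e1, e2]
    have h5 : Real.sqrt cβ * b + h ^ m * Real.sqrt (J m μ μ)
        ≤ (Real.sqrt cβ + Real.sqrt (J m μ μ) + 1) * (h ^ m + b) := by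
      have p1 : 0 ≤ Real.sqrt cβ * h ^ m := by positivity
      have p2 : 0 ≤ Real.sqrt (J m μ μ) * b := by positivity
      linarith
    calc 2 * (Real.sqrt cδ * a) * (Real.sqrt cβ * b + h ^ m * Real.sqrt (J m μ μ))
        ≤ 2 * (Real.sqrt cδ * a) *
          ((Real.sqrt cβ + Real.sqrt (J m μ μ) + 1) * (h ^ m + b)) := by gcongr
      _ = 2 * Real.sqrt cδ * (Real.sqrt cβ + Real.sqrt (J m μ μ) + 1) * (a * (h ^ m + b)) := by
          ring
      _ ≤ _ := by gcongr
  calc P {ω | 2 * Real.sqrt cδ * (Real.sqrt cβ + Real.sqrt (J m μ μ) + 1) * rate m h n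
        < |nrm (P.map (T 0 0)) m (lam n)
          (μhat n ω - μ + score (P.map (T 0 0)) X T ε N m (lam n) n ω μ)|}
      ≤ P (bad1 ∪ bad2) := by
        refine measure_mono_ae ?_
        filter_upwards [hμhat n, ae_all_iff.2 fun i => (h3 i).1,
          ae_all_iff.2 fun i => Model.ae_evalLim_eq hm h4 i] with ω hmin hNω hev hlt
        by_contra hgood
        have hg1 : ω ∉ bad1 := fun h' => hgood (Or.inl h')
        have hg2 : ω ∉ bad2 := fun h' => hgood (Or.inr h')
        simp only [hbad1, hbad2, Set.mem_ofPred_eq, not_exists, not_lt] at hg1 hg2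
        have hle := nrm_remainder_score_le hm E (hlam n) hμ hn hNω hev hmin
          (Real.sqrt_nonneg _) hδhalf (Real.sqrt_nonneg _) hg1 hg2
        refine absurd (hle.trans hbound) (not_le.2 ?_)
        change _ < |nrm (P.map (T 0 0)) m (lam n)
          (μhat n ω - μ + score (P.map (T 0 0)) X T ε N m (lam n) n ω μ)| at hlt
        exact hlt.trans_eq (abs_of_nonneg (Real.sqrt_nonneg _))
    _ ≤ P bad1 + P bad2 := measure_union_le _ _
    _ ≤ ENNReal.ofReal (η / 2) + ENNReal.ofReal (η / 2) := add_le_add hP1 hP2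
    _ = ENNReal.ofReal η := by
        rw [← ENNReal.ofReal_add (by positivity) (by positivity), add_halves]

end Conclusion

end FBR

theorem theorem3p1 {Ω : Type*} [MeasurableSpace Ω] (P : Measure Ω) [IsProbabilityMeasure P]
    (m : ℕ) (hm : 1 ≤ m)
    (X : ℕ → Ω → unitInterval → ℝ) (T : ℕ → ℕ → Ω → unitInterval) (ε : ℕ → ℕ → Ω → ℝ)
    (N : ℕ → Ω → ℕ) (μ : unitInterval → ℝ)
    (hmodel : FBR.Model P X T ε N μ)
    (h1 : FBR.BoundedDensities P X T ε)
    (h2 : FBR.CenteredErrors P ε)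
    (h3 : FBR.SparseCounts P N)
    (h4 : FBR.SmoothPaths P m X)
    (h5 : FBR.HasEigenbasis (P.map (T 0 0)) m)
    (lam : ℕ → ℝ) (hlam : ∀ n, 0 < lam n)
    (hh : Tendsto (fun n => FBR.bw m (lam n)) atTop (𝓝 0))
    (hrate : Tendsto (fun n : ℕ =>
      ((n : ℝ) * FBR.bw m (lam n) ^ (3 - 1 / (2 * (m : ℝ)))) ^ (-(1 / 2) : ℝ) *
        Real.sqrt (Real.log (Real.log n))) atTop (𝓝 0))
    (μhat : ℕ → Ω → unitInterval → ℝ)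
    (hμhat : ∀ n, ∀ᵐ ω ∂P, FBR.IsSplineEstimate X T ε N m (lam n) n ω (μhat n ω)) :
    μ ∈ FBR.sobolev m ∧
    (∀ n t, FBR.Represents (P.map (T 0 0)) m (lam n) (fun g => g t)
      (FBR.kernelAt (P.map (T 0 0)) m (lam n) t)) ∧
    (∀ n, ∀ f ∈ FBR.sobolev m,
      FBR.Represents (P.map (T 0 0)) m (lam n) (fun g => lam n * FBR.J m f g)
        (FBR.W (P.map (T 0 0)) m (lam n) f)) ∧
    FBR.IsBigOp P
      (fun n ω => FBR.nrm (P.map (T 0 0)) m (lam n)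
        (μhat n ω - μ + FBR.score (P.map (T 0 0)) X T ε N m (lam n) n ω μ))
      (fun n => FBR.rate m (FBR.bw m (lam n)) n) := by
  have := hmodel.isProbabilityMeasure_map_T
  have := FBR.isOpenPosMeasure_map_T h1
  obtain ⟨e, γ, B, E⟩ := h5.exists_eigensystem
  exact ⟨hmodel.mean_mem_sobolev hm h4 E, fun n t => E.represents_kernelAt hm (hlam n) t,
    fun n f hf => E.represents_W hm (hlam n) hf,
    FBR.isBigOp_remainder hm hmodel h2 h3 h4 E hlam hh hrate hμhat⟩
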